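/- Setting. Let $(Z_k)_{k\in\mathbb Z}$ be i.i.d. random vectors in $\mathbb R^p$, let $\mathbf A_k=(A_{k,j})_{j\in\mathbb Z}$, $k\in\mathbb Z$, be a stationary sequence, where the $A_{k,j}$ are random $d\times p$ matrices, and let $(\mathbf A_k)_k$ be independent of $(Z_k)_k$. Write $|\cdot|$ for the Euclidean norm, $\|\cdot\|$ for the operator norm, $Z=Z_0$, $A_j=A_{0,j}$, and $$X_k=\sum_{j\in\mathbb Z}A_{k,j}Z_{k-j},\qquad S_n=X_1+\dots+X_n .$$ Convergence $m_n\to m$ in $\mathbf M_0(\mathbb R^d)$ is for measures on $\mathbb R^d\setminus\{0\}$ that are finite on $\{|x|\ge r\}$ for each $r>0$, and means $\int f\,dm_n\to\int f\,dm$ for every bounded continuous $f$ vanishing in a neighbourhood of $0$. Assume the following. 1. $Z$ is regularly varying: there are $\alpha>0$ and a non-null measure $\mu$ on $\mathbb R^p\setminus\{0\}$ with $\mu(uB)=u^{-\alpha}\mu(B)$ for all $u>0$ and Borel $B$, and $P(u^{-1}Z\in\cdot)/P(|Z|>u)\to\mu$ in $\mathbf M_0(\mathbb R^p)$ as $u\to\infty$.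 If $\alpha>1$, then $EZ=0$. 2. For some $0<\varepsilon<\alpha$: if $\alpha\in(0,1)\cup(1,2)$, then $\sum_jE\|A_j\|^{\alpha-\varepsilon}<\infty$ and $\sum_jE\|A_j\|^{\alpha+\varepsilon}<\infty$; if $\alpha\in\{1,2\}$, then $E\big(\sum_j\|A_j\|^{\alpha-\varepsilon}\big)^{(\alpha+\varepsilon)/(\alpha-\varepsilon)}<\infty$; if $\alpha>2$, then $E\big(\sum_j\|A_j\|^2\big)^{(\alpha+\varepsilon)/2}<\infty$. 3. $(\gamma_n)_{n\ge1}$ is a sequence of positive numbers with $(Z_1+\dots+Z_n)/\gamma_n\to0$ in probability; if $\alpha=2$, then $\gamma_n/\sqrt{n^{1+\varepsilon'}}\to\infty$ for some $\varepsilon'>0$; if $\alpha>2$, then $\gamma_n/\sqrt{n\log n}\to\infty$. 4. The sequences $\mathbf A_k$, $k\in\mathbb Z$, are i.i.d., and for some $M\in\{0,1,2,\dots\}$, $A_{k,j}=0$ a.s. for all $k$ and all $|j|>M$. Let $r_n=1/(nP(|Z|>\gamma_n))$. Then all of the following hold. (a) For each $\delta>0$, $$\lim_{\varepsilon\downarrow0}\limsup_{n}r_nP\Big(\Big|\sum_{k=1}^nX_kI\{|X_k|\le\gamma_n\varepsilon\}\Big|>\gamma_n\delta\Big)=0.$$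 (b) If $0<\alpha<1$, or if $\alpha=1$ and $(|Z_1|+\dots+|Z_n|)/\gamma_n\to0$ in probability, or if $\alpha>1$ and $n/\gamma_n\to0$, then for each $\delta>0$ $$\lim_{\varepsilon\downarrow0}\limsup_{n}r_nP\Big(\sum_{k=1}^n|X_k|I\{|X_k|\le\gamma_n\varepsilon\}>\gamma_n\delta\Big)=0.$$ (c) If $\alpha>1$ and $\gamma_n=n$ for all $n\ge 1$, then $E|X_0|<\infty$ and for each $\delta>0$ $$\lim_{\varepsilon\downarrow0}\limsup_{n}r_nP\Big(\Big|\sum_{k=1}^n(|X_k|-E|X_0|)I\{|X_k|\le n\varepsilon\}\Big|>n\delta\Big)=0.$$ (d) $E\big(\sum_j\|A_{j,j}\|\big)^\alpha<\infty$. (e) The sum $\sum_jA_{j,j}$ converges a.s. and $E\sup_{J\subset\mathbb Z}\big\|\sum_{j\in J}A_{j,j}\big\|^\alpha<\infty$. (f) Consequently, the partial sums satisfy the large deviation principle $$r_nP(\gamma_n^{-1}S_n\in\cdot)\to E\Big[\mu\Big\{z:\sum_{j\in\mathbb Z}A_{j,j}z\in\cdot\Big\}\Big]\quad\text{in }\mathbf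 M_0(\mathbb R^d).$$ -/

import Mathlib

open MeasureTheory ProbabilityTheory Filter Topology
open scoped ENNReal BoundedContinuousFunction

namespace RCLP

/-- Euclidean space `ℝ^m` with the Euclidean norm. -/
abbrev Vec (m : ℕ) : Type := EuclideanSpace ℝ (Fin m)

/-- Real `d × p` matrices, as linear maps `ℝ^p → ℝ^d`; `‖·‖` is the operator norm. -/
abbrev Mat (d p : ℕ) : Type := Vec p →L[ℝ] Vec d

/-- Membership in `M₀(ℝ^m)`. An element of `M₀(ℝ^m)` is a measure on `ℝ^m ∖ {0}`; it is
represented by a Borel measure on `ℝ^m` of which only the restriction to `ℝ^m ∖ {0}` matters. -/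
def InM0 {m : ℕ} (ν : Measure (Vec m)) : Prop :=
  ∀ r : ℝ, 0 < r → ν {x | r ≤ ‖x‖} < ∞

/-- Convergence in `M₀(ℝ^m)`: convergence of the integrals of all bounded continuous functions
that vanish in a neighbourhood of the origin. -/
def TendstoM0 {m : ℕ} {ι : Type*} (ν : ι → Measure (Vec m)) (l : Filter ι)
    (ν' : Measure (Vec m)) : Prop :=
  (∀ i, InM0 (ν i)) ∧ InM0 ν' ∧
    ∀ f : Vec m →ᵇ ℝ, (∃ r : ℝ, 0 < r ∧ ∀ x, ‖x‖ < r → f x = 0) →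
      Tendsto (fun i => ∫ x, f x ∂(ν i)) l (𝓝 (∫ x, f x ∂ν'))

section

variable {Ω : Type*} [MeasurableSpace Ω]

/-- `Z ∈ RV(μ, α)`: the vector `Z` is regularly varying with non-null limit measure `μ`
(a measure on `ℝ^m ∖ {0}`, so that the origin gets no mass) and index `α > 0`, the exponent in
the homogeneity property `μ(uB) = u^{-α} μ(B)`. -/
structure RegVar {m : ℕ} (P : Measure Ω) (Z : Ω → Vec m) (μ : Measure (Vec m)) (α : ℝ) :
    Prop where
  index_pos : 0 < α
  zero_null : μ {0} = 0
  ne_zero : μ ≠ 0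
  tendsto : TendstoM0
    (fun u : ℝ => ENNReal.ofReal (1 / P.real {ω | u < ‖Z ω‖}) • P.map (fun ω => u⁻¹ • Z ω))
    atTop μ
  homogeneous : ∀ u : ℝ, 0 < u → ∀ B : Set (Vec m), MeasurableSet B → (0 : Vec m) ∉ B →
    μ ((fun x => u • x) '' B) = ENNReal.ofReal (u ^ (-α)) * μ B

variable {d p : ℕ}

/-- The standing assumptions on coefficients and noise: `(Z_k)` is i.i.d., the sequence
`(𝐀_k)`, `𝐀_k = (A_{k,j})_j`, is stationary, and the two sequences are independent. -/
structure Model (P : Measure Ω) (A : ℤ → ℤ → Ω → Mat d p) (Z : ℤ → Ω → Vec p) : Prop where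
  meas_A : ∀ k j, Measurable (A k j)
  meas_Z : ∀ k, Measurable (Z k)
  indep_Z : iIndepFun Z P
  ident_Z : ∀ k, IdentDistrib (Z k) (Z 0) P P
  stationary_A : ∀ m : ℤ,
    IdentDistrib (fun ω (k j : ℤ) => A (k + m) j ω) (fun ω (k j : ℤ) => A k j ω) P P
  indep_A_Z : IndepFun (fun ω (k j : ℤ) => A k j ω) (fun ω (k : ℤ) => Z k ω) P

/-- The moment conditions on the coefficients; by stationarity they are stated for `𝐀_0`. -/
def MomentCond (P : Measure Ω) (A : ℤ → ℤ → Ω → Mat d p) (α : ℝ) : Prop :=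
  ∃ ε : ℝ, 0 < ε ∧ ε < α ∧
    (α < 2 → α ≠ 1 →
      (∑' j : ℤ, ∫⁻ ω, ‖A 0 j ω‖ₑ ^ (α - ε) ∂P) < ∞ ∧
      (∑' j : ℤ, ∫⁻ ω, ‖A 0 j ω‖ₑ ^ (α + ε) ∂P) < ∞) ∧
    (α = 1 ∨ α = 2 →
      ∫⁻ ω, (∑' j : ℤ, ‖A 0 j ω‖ₑ ^ (α - ε)) ^ ((α + ε) / (α - ε)) ∂P < ∞) ∧
    (2 < α →
      ∫⁻ ω, (∑' j : ℤ, ‖A 0 j ω‖ₑ ^ (2 : ℝ)) ^ ((α + ε) / 2) ∂P < ∞)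

/-- The assumptions on the normalizing sequence `(γ_n)_{n ≥ 1}` of positive numbers. -/
structure GammaCond (P : Measure Ω) (Z : ℤ → Ω → Vec p) (α : ℝ) (γ : ℕ → ℝ) : Prop where
  pos : ∀ n, 1 ≤ n → 0 < γ n
  tendsto_zero : TendstoInMeasure P
    (fun (n : ℕ) ω => (γ n)⁻¹ • ∑ k ∈ Finset.Icc 1 n, Z (k : ℤ) ω) atTop (fun _ => (0 : Vec p))
  two : α = 2 → ∃ ε : ℝ, 0 < ε ∧
    Tendsto (fun n : ℕ => γ n / Real.sqrt ((n : ℝ) ^ (1 + ε))) atTop atTop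
  gt_two : 2 < α →
    Tendsto (fun n : ℕ => γ n / Real.sqrt ((n : ℝ) * Real.log n)) atTop atTop

/-- All hypotheses of the large deviation theorem for the point processes of the
random coefficient linear process. -/
structure Hyp (P : Measure Ω) (A : ℤ → ℤ → Ω → Mat d p) (Z : ℤ → Ω → Vec p)
    (μ : Measure (Vec p)) (α : ℝ) (γ : ℕ → ℝ) : Prop where
  model : Model P A Z
  regVar : RegVar P (Z 0) μ α
  centered : 1 < α → Integrable (Z 0) P ∧ ∫ ω, Z 0 ω ∂P = 0
  moment : MomentCond P A α
  gamma : GammaCond P Z α γ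

/-- The process `X_k = ∑_{j ∈ ℤ} A_{k,j} Z_{k-j}`. -/
noncomputable def X (A : ℤ → ℤ → Ω → Mat d p) (Z : ℤ → Ω → Vec p) (k : ℤ) (ω : Ω) : Vec d :=
  ∑' j : ℤ, A k j ω (Z (k - j) ω)

/-- The partial sums `S_n = X_1 + ⋯ + X_n`. -/
noncomputable def S (A : ℤ → ℤ → Ω → Mat d p) (Z : ℤ → Ω → Vec p) (n : ℕ) (ω : Ω) : Vec d :=
  ∑ k ∈ Finset.Icc 1 n, X A Z (k : ℤ) ω

/-- `r_n = 1 / (n P(|Z| > γ_n))`. -/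
noncomputable def r (P : Measure Ω) (Z : ℤ → Ω → Vec p) (γ : ℕ → ℝ) (n : ℕ) : ℝ :=
  1 / (n * P.real {ω | γ n < ‖Z 0 ω‖})

/-- `lim_{ε ↓ 0} limsup_n r_n P(|∑_{k ≤ n} X_k I{|X_k| ≤ γ_n ε}| > γ_n δ) = 0` for all `δ > 0`. -/
def SmallJump (P : Measure Ω) (A : ℤ → ℤ → Ω → Mat d p) (Z : ℤ → Ω → Vec p) (γ : ℕ → ℝ) :
    Prop :=
  ∀ δ : ℝ, 0 < δ → Tendsto
    (fun ε : ℝ => limsup (fun n : ℕ => ENNReal.ofReal (r P Z γ n) *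
      P {ω | γ n * δ <
        ‖∑ k ∈ Finset.Icc 1 n, if ‖X A Z k ω‖ ≤ γ n * ε then X A Z k ω else 0‖}) atTop)
    (𝓝[>] 0) (𝓝 0)

/-- `lim_{ε ↓ 0} limsup_n r_n P(∑_{k ≤ n} |X_k| I{|X_k| ≤ γ_n ε} > γ_n δ) = 0` for all `δ > 0`. -/
def SmallJumpAbs1 (P : Measure Ω) (A : ℤ → ℤ → Ω → Mat d p) (Z : ℤ → Ω → Vec p)
    (γ : ℕ → ℝ) : Prop :=
  ∀ δ : ℝ, 0 < δ → Tendsto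
    (fun ε : ℝ => limsup (fun n : ℕ => ENNReal.ofReal (r P Z γ n) *
      P {ω | γ n * δ <
        ∑ k ∈ Finset.Icc 1 n, if ‖X A Z k ω‖ ≤ γ n * ε then ‖X A Z k ω‖ else 0}) atTop)
    (𝓝[>] 0) (𝓝 0)

/-- The mean `E|X_0|` is finite and, for all `δ > 0`,
`lim_{ε ↓ 0} limsup_n r_n P(|∑_{k ≤ n} (|X_k| - E|X_0|) I{|X_k| ≤ n ε}| > n δ) = 0`. -/
def SmallJumpAbs2 (P : Measure Ω) (A : ℤ → ℤ → Ω → Mat d p) (Z : ℤ → Ω → Vec p)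
    (γ : ℕ → ℝ) : Prop :=
  Integrable (X A Z 0) P ∧
  ∀ δ : ℝ, 0 < δ → Tendsto
    (fun ε : ℝ => limsup (fun n : ℕ => ENNReal.ofReal (r P Z γ n) *
      P {ω | n * δ <
        |∑ k ∈ Finset.Icc 1 n,
          if ‖X A Z k ω‖ ≤ n * ε then ‖X A Z k ω‖ - ∫ ω', ‖X A Z 0 ω'‖ ∂P else 0|}) atTop)
    (𝓝[>] 0) (𝓝 0)

/-- `∑ A_{j,j}` converges a.s. and `E sup_{J ⊆ ℤ} ‖∑_{j ∈ J} A_{j,j}‖^α < ∞`. -/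
def SumA (P : Measure Ω) (A : ℤ → ℤ → Ω → Mat d p) (α : ℝ) : Prop :=
  (∀ᵐ ω ∂P, Summable (fun j : ℤ => A j j ω)) ∧
    ∫⁻ ω, ⨆ J : Set ℤ, ‖∑' j : J, A j j ω‖ₑ ^ α ∂P < ∞

/-- `E (∑ ‖A_{j,j}‖)^α < ∞`. -/
def SumAabs (P : Measure Ω) (A : ℤ → ℤ → Ω → Mat d p) (α : ℝ) : Prop :=
  ∫⁻ ω, (∑' j : ℤ, ‖A j j ω‖ₑ) ^ α ∂P < ∞

/-- The large deviation principle for the partial sums: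
`r_n P(γ_n⁻¹ S_n ∈ ·) → E[μ(z : ∑_j A_{j,j} z ∈ ·)]` in `M₀(ℝ^d)`, where the right-hand side
defines a measure `ν` on `ℝ^d ∖ {0}`. -/
def PartialSumLD (P : Measure Ω) (A : ℤ → ℤ → Ω → Mat d p) (Z : ℤ → Ω → Vec p)
    (μ : Measure (Vec p)) (γ : ℕ → ℝ) : Prop :=
  ∃ ν : Measure (Vec d),
    (∀ B : Set (Vec d), MeasurableSet B → (0 : Vec d) ∉ B →
      ν B = ∫⁻ ω, μ {z | ∑' j : ℤ, A j j ω z ∈ B} ∂P) ∧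
    TendstoM0 (fun n : ℕ => ENNReal.ofReal (r P Z γ n) • P.map (fun ω => (γ n)⁻¹ • S A Z n ω))
      atTop ν

end

end RCLP

/-! The theorem is an instance of the single big jump principle. Write V(u) = P(|Z| > u) and L_n =
-log(n V(γ_n)), so that r_n = exp(L_n) and a probability is negligible when it is o(exp(-L_n)). The
weak law for Z_1 + ... + Z_n forces γ_n → ∞ and n V(γ_n) → 0 (`weakLaw_consequences`, by
characteristic functions and symmetrization), hence L_n → ∞. Tails of all derived variables are only
compared with V, through one-sided Potter bounds P(R > x/s) ≤ C s^a V(x), a > α. This class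
(`HasTail`) is stable under finite sums and under independent factors with a moment of order above
α.

For (a)-(c), X_k is a.s. a finite sum of the A_{k,j} Z_{k-j} with |j| ≤ M, a functional of the pairs
(𝐀_i, Z_i) with |i - k| ≤ M. These pairs are i.i.d., so indices in one residue class modulo 2M + 1
give independent summands. A Chernoff bound with parameter of order L_n / γ_n
(`tendsto_truncated_sum`) shows that sums truncated at εγ_n exceed δγ_n with probability
o(exp(-L_n)) for every fixed small ε. It needs n E[truncated variable] = o(γ_n), which comes from
the weak law, centring, or α < 1, as the case may be (`Coeffs.mean_of_one_le`,
`Setup.abs_mean_linear`). It also needs L_n n E[truncated square] = o(γ_n²), which is where the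
growth conditions for α ≥ 2 enter (`GammaTail.truncated_sq`). Statements (d) and (e) concern sums
with finitely many nonzero terms, with moments of order above α.

For (f), reorder S_n by noise vectors: up to boundary terms it is the sum over i ≤ n of the jumps
W_i Z_i, with W_i = ∑_j A_{i+j,j}. Jumps below εγ_n are negligible as in (a), and two jumps above
εγ_n are too unlikely to matter (`Setup.exists_two_jumps_le`, `Setup.tendsto_pairs`). Therefore E
f(S_n/γ_n) is n E f(W_0 Z_0/γ_n) up to o(n V(γ_n)) (`Setup.tendsto_sum_sub_jump`), and Breiman's
lemma (`RegVar.tendsto_apply`) gives the limit, since W_0 = ∑_j A_{j,j}. -/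

/-! ### Potter bounds for regularly varying tails -/

namespace RCLP

/-- A tail function `V(u) = P(R > u)` that is positive and regularly varying of index `-α`. -/
structure RVTail (V : ℝ → ℝ) (α : ℝ) : Prop where
  index_pos : 0 < α
  anti : Antitone V
  pos : ∀ u, 0 < V u
  le_one : ∀ u, V u ≤ 1
  ratio : ∀ s : ℝ, 0 < s → Tendsto (fun u => V (s * u) / V u) atTop (𝓝 (s ^ (-α)))

namespace RVTail

variable {V : ℝ → ℝ} {α : ℝ}

/-- Lower Potter bound. -/
theorem potter_lower (h : RVTail V α) {a : ℝ} (ha : α < a) :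
    ∃ C x₀ : ℝ, 1 ≤ C ∧ 1 ≤ x₀ ∧ ∀ x, x₀ ≤ x → ∀ s, 1 ≤ s → V (x / s) ≤ C * s ^ a * V x := by
  have hα := h.index_pos
  have ha0 : 0 < a := hα.trans ha
  -- The slack a > α makes V(2u) ≥ 2^(-a) V(u) for large u. Iterating over powers of 2 and rounding
  -- s up to the next power costs only a factor 2^a.
  have h2 : (2:ℝ) ^ (-a) < 2 ^ (-α) :=
    Real.rpow_lt_rpow_of_exponent_lt (by norm_num) (by linarith)
  obtain ⟨x₁, hx₁⟩ := eventually_atTop.1 ((h.ratio 2 (by norm_num)).eventually (lt_mem_nhds h2))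
  set x₀ := max x₁ 1 with hx₀
  have hx₀1 : 1 ≤ x₀ := le_max_right _ _
  have step : ∀ k : ℕ, ∀ y, x₀ ≤ y → ((2:ℝ) ^ k) ^ (-a) * V y ≤ V (2 ^ k * y) := by
    intro k
    induction k with
    | zero => intro y _; simp
    | succ k ih =>
      intro y hy
      have hy0 : 0 < y := by linarith
      have h1 := ih y hy
      have hge : x₀ ≤ 2 ^ k * y :=
        hy.trans (le_mul_of_one_le_left hy0.le (one_le_pow₀ (by norm_num)))
      have h3 := hx₁ (2 ^ k * y) ((le_max_left _ _).trans hge)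
      rw [lt_div_iff₀ (h.pos _)] at h3
      have e : (2:ℝ) ^ (k + 1) * y = 2 * (2 ^ k * y) := by ring
      rw [e, pow_succ', Real.mul_rpow (by norm_num) (by positivity), mul_assoc]
      exact (mul_le_mul_of_nonneg_left h1 (by positivity)).trans h3.le
  have main : ∀ y, x₀ ≤ y → ∀ s, 1 ≤ s → V y ≤ (2 * s) ^ a * V (s * y) := by
    intro y hy s hs
    have hy0 : 0 < y := by linarith
    obtain ⟨k, hk1, hk2⟩ := exists_nat_pow_near hs (by norm_num : (1:ℝ) < 2)
    have h1 := step (k + 1) y hy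
    have h2 : V (2 ^ (k + 1) * y) ≤ V (s * y) :=
      h.anti (mul_le_mul_of_nonneg_right hk2.le hy0.le)
    have hpw : (0:ℝ) < ((2:ℝ) ^ (k + 1)) ^ a := by positivity
    have h3 : V y ≤ ((2:ℝ) ^ (k + 1)) ^ a * V (s * y) := by
      have := h1.trans h2
      rw [Real.rpow_neg (by positivity), inv_mul_le_iff₀ hpw] at this
      exact this
    refine h3.trans (mul_le_mul_of_nonneg_right ?_ (h.pos _).le)
    refine Real.rpow_le_rpow (by positivity) ?_ ha0.le
    rw [pow_succ']
    linarith
  have hV0 := h.pos x₀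
  refine ⟨2 ^ a / V x₀, x₀, ?_, hx₀1, ?_⟩
  · rw [le_div_iff₀ hV0, one_mul]
    exact (h.le_one _).trans (Real.one_le_rpow (by norm_num) ha0.le)
  intro x hx s hs
  have hs0 : 0 < s := by linarith
  have hx0 : 0 < x := by linarith
  have e1 : 2 ^ a / V x₀ * s ^ a * V x = (2 * s) ^ a * V x / V x₀ := by
    rw [Real.mul_rpow (by norm_num) hs0.le]; ring
  rw [e1]
  have hV1 := h.le_one x₀
  -- Below x₀ nothing is known about the ratios: there V is bounded by 1 and V x is compared with V
  -- x₀, whence the denominator in the constant.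
  rcases le_total x₀ (x / s) with hxs | hxs
  · have := main (x / s) hxs s hs
    rw [mul_div_cancel₀ _ hs0.ne'] at this
    refine this.trans ?_
    have : 0 ≤ (2 * s) ^ a * V x := mul_nonneg (by positivity) (h.pos _).le
    rw [le_div_iff₀ hV0]
    nlinarith
  · refine (h.le_one _).trans ?_
    rw [one_le_div hV0]
    have h1 := main x₀ le_rfl (x / x₀) (by rw [le_div_iff₀ (by linarith)]; linarith)
    rw [div_mul_cancel₀ _ (by linarith)] at h1
    refine h1.trans (mul_le_mul_of_nonneg_right ?_ (h.pos _).le)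
    refine Real.rpow_le_rpow (by positivity) ?_ ha0.le
    have : x / x₀ ≤ s := by
      rw [div_le_iff₀ (by linarith)]
      rw [div_le_iff₀ hs0] at hxs
      linarith
    linarith

/-- Upper Potter bound. -/
theorem potter_upper (h : RVTail V α) {b : ℝ} (hb0 : 0 < b) (hb : b < α) :
    ∃ C x₀ : ℝ, 1 ≤ C ∧ 1 ≤ x₀ ∧ ∀ x, x₀ ≤ x → ∀ s, 1 ≤ s → V (s * x) ≤ C * s ^ (-b) * V x := by
  have h2 : (2:ℝ) ^ (-α) < 2 ^ (-b) :=
    Real.rpow_lt_rpow_of_exponent_lt (by norm_num) (by linarith)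
  obtain ⟨x₁, hx₁⟩ := eventually_atTop.1 ((h.ratio 2 (by norm_num)).eventually (gt_mem_nhds h2))
  set x₀ := max x₁ 1 with hx₀
  have hx₀1 : 1 ≤ x₀ := le_max_right _ _
  have step : ∀ k : ℕ, ∀ y, x₀ ≤ y → V (2 ^ k * y) ≤ ((2:ℝ) ^ k) ^ (-b) * V y := by
    intro k
    induction k with
    | zero => intro y _; simp
    | succ k ih =>
      intro y hy
      have hy0 : 0 < y := by linarith
      have h1 := ih y hy
      have hge : x₀ ≤ 2 ^ k * y :=
        hy.trans (le_mul_of_one_le_left hy0.le (one_le_pow₀ (by norm_num)))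
      have h3 := hx₁ (2 ^ k * y) ((le_max_left _ _).trans hge)
      rw [div_lt_iff₀ (h.pos _)] at h3
      have e : (2:ℝ) ^ (k + 1) * y = 2 * (2 ^ k * y) := by ring
      rw [e, pow_succ', Real.mul_rpow (by norm_num) (by positivity), mul_assoc]
      exact h3.le.trans (mul_le_mul_of_nonneg_left h1 (by positivity))
  refine ⟨2 ^ b, x₀, Real.one_le_rpow (by norm_num) hb0.le, hx₀1, ?_⟩
  intro y hy s hs
  have hy0 : 0 < y := by linarith
  have hs0 : 0 < s := by linarith
  obtain ⟨k, hk1, hk2⟩ := exists_nat_pow_near hs (by norm_num : (1:ℝ) < 2)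
  have h2 : V (s * y) ≤ V (2 ^ k * y) := h.anti (mul_le_mul_of_nonneg_right hk1 hy0.le)
  refine (h2.trans (step k y hy)).trans (mul_le_mul_of_nonneg_right ?_ (h.pos _).le)
  rw [Real.rpow_neg (by positivity), Real.rpow_neg hs0.le, ← div_eq_mul_inv, ← one_div,
    div_le_div_iff₀ (by positivity) (by positivity), one_mul, ← Real.mul_rpow (by norm_num)
    (by positivity)]
  refine Real.rpow_le_rpow hs0.le ?_ hb0.le
  rw [pow_succ'] at hk2
  exact hk2.le

/-- Polynomial lower bound for a regularly varying tail. -/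
theorem rpow_le (h : RVTail V α) {a : ℝ} (ha : α < a) :
    ∃ c x₀ : ℝ, 0 < c ∧ 1 ≤ x₀ ∧ ∀ x, x₀ ≤ x → c * x ^ (-a) ≤ V x := by
  obtain ⟨C, x₀, hC, hx₀, hP⟩ := h.potter_lower ha
  refine ⟨V 1 / C, x₀, div_pos (h.pos _) (by linarith), hx₀, fun x hx => ?_⟩
  have hx0 : 0 < x := by linarith
  have := hP x hx x (by linarith)
  rw [div_self hx0.ne'] at this
  rw [Real.rpow_neg hx0.le, ← div_eq_mul_inv, div_div, div_le_iff₀ (by positivity)]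
  linarith

/-- Polynomial upper bound for a regularly varying tail. -/
theorem le_rpow (h : RVTail V α) {b : ℝ} (hb0 : 0 < b) (hb : b < α) :
    ∃ C : ℝ, 0 < C ∧ ∀ x, 0 < x → V x ≤ C * x ^ (-b) := by
  obtain ⟨C, x₀, hC, hx₀, hP⟩ := h.potter_upper hb0 hb
  have hx₀0 : 0 < x₀ := by linarith
  have hc : 0 < x₀ ^ b := by positivity
  refine ⟨C * x₀ ^ b, by positivity, fun x hx => ?_⟩
  have e : x₀ ^ b * x ^ (-b) = (x / x₀) ^ (-b) := by
    rw [Real.div_rpow hx.le hx₀0.le, Real.rpow_neg hx₀0.le]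
    field_simp
  rw [mul_assoc, e]
  -- For x ≤ x₀ the power is at least 1, so V ≤ 1 suffices and the bound extends to all positive x.
  rcases le_total x₀ x with hx' | hx'
  · have := hP x₀ le_rfl (x / x₀) ((one_le_div hx₀0).2 hx')
    rw [div_mul_cancel₀ _ hx₀0.ne'] at this
    refine this.trans (mul_le_of_le_one_right (by positivity) (h.le_one _))
  · refine (h.le_one _).trans ?_
    have : 1 ≤ (x / x₀) ^ (-b) :=
      Real.one_le_rpow_of_pos_of_le_one_of_nonpos (by positivity) ((div_le_one hx₀0).2 hx')
        (by linarith)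
    nlinarith

end RVTail
end RCLP

/-! ### The norm of a regularly varying vector has a regularly varying tail -/

namespace RCLP

variable {Ω : Type*} [MeasurableSpace Ω]

/-- A continuous function of the norm that increases from `0` at radius `s` to `1` at radius
`t`. -/
noncomputable def ramp (m : ℕ) (s t : ℝ) : Vec m →ᵇ ℝ :=
  BoundedContinuousFunction.ofNormedAddCommGroup
    (fun x => max 0 (min 1 ((‖x‖ - s) / (t - s)))) (by fun_prop) 1 (fun x => by
      rw [Real.norm_of_nonneg (le_max_left _ _)]
      exact max_le zero_le_one (min_le_left _ _))

theorem ramp_apply {m : ℕ} (s t : ℝ) (x : Vec m) :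
    ramp m s t x = max 0 (min 1 ((‖x‖ - s) / (t - s))) := rfl

theorem indicator_le_ramp {m : ℕ} {s t : ℝ} (hst : s < t) (x : Vec m) :
    Set.indicator {x : Vec m | t < ‖x‖} (fun _ => (1:ℝ)) x ≤ ramp m s t x := by
  rw [ramp_apply]
  by_cases h : t < ‖x‖
  · rw [Set.indicator_of_mem (by exact h)]
    refine le_max_of_le_right (le_min le_rfl ?_)
    rw [one_le_div (by linarith)]; linarith
  · rw [Set.indicator_of_notMem (by exact h)]
    exact le_max_left _ _

theorem ramp_le_indicator {m : ℕ} {s t : ℝ} (hst : s < t) (x : Vec m) :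
    ramp m s t x ≤ Set.indicator {x : Vec m | s < ‖x‖} (fun _ => (1:ℝ)) x := by
  rw [ramp_apply]
  by_cases h : s < ‖x‖
  · rw [Set.indicator_of_mem (by exact h)]
    exact max_le zero_le_one (min_le_left _ _)
  · rw [Set.indicator_of_notMem (by exact h)]
    refine max_le le_rfl ((min_le_right _ _).trans ?_)
    exact div_nonpos_of_nonpos_of_nonneg (by linarith) (by linarith)

theorem ramp_eq_zero {m : ℕ} {s t : ℝ} (hst : s < t) {x : Vec m} (hx : ‖x‖ < s) :
    ramp m s t x = 0 := by
  refine le_antisymm ?_ (le_max_left _ _)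
  have := ramp_le_indicator hst x
  rwa [Set.indicator_of_notMem (by simpa using hx.le)] at this

theorem measurableSet_norm_gt {m : ℕ} (t : ℝ) : MeasurableSet {x : Vec m | t < ‖x‖} :=
  measurableSet_lt measurable_const measurable_norm

theorem InM0.lt_top {m : ℕ} {μ : Measure (Vec m)} (h : InM0 μ) {t : ℝ} (ht : 0 < t) :
    μ {x | t < ‖x‖} < ∞ :=
  lt_of_le_of_lt (measure_mono fun x (hx : t < ‖x‖) => (hx.le : t ≤ ‖x‖)) (h t ht)

/-- Bounded continuous functions vanishing near the origin are integrable for measures in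
`M₀`. -/
theorem InM0.integrable {m : ℕ} {μ : Measure (Vec m)} (h : InM0 μ) (f : Vec m →ᵇ ℝ) {r : ℝ}
    (hr : 0 < r) (hf : ∀ x, ‖x‖ < r → f x = 0) : Integrable f μ := by
  have hms : MeasurableSet {x : Vec m | r ≤ ‖x‖} := measurableSet_le measurable_const measurable_norm
  have h1 : Integrable (Set.indicator {x : Vec m | r ≤ ‖x‖} (fun _ => ‖f‖)) μ :=
    (integrable_indicator_iff hms).2 (integrableOn_const (h r hr).ne)
  refine h1.mono' f.continuous.aestronglyMeasurable (Eventually.of_forall fun x => ?_)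
  by_cases hx : r ≤ ‖x‖
  · rw [Set.indicator_of_mem (by exact hx)]; exact f.norm_coe_le_norm x
  · rw [Set.indicator_of_notMem (by exact hx), hf x (not_le.1 hx), norm_zero]

theorem integrable_indicator_gt {m : ℕ} {μ : Measure (Vec m)} (h : InM0 μ) {t : ℝ} (ht : 0 < t) :
    Integrable (Set.indicator {x : Vec m | t < ‖x‖} (fun _ => (1:ℝ))) μ :=
  (integrable_indicator_iff (measurableSet_norm_gt t)).2 (integrableOn_const (h.lt_top ht).ne)

theorem integral_ramp_mem {m : ℕ} {μ : Measure (Vec m)} (h : InM0 μ) {s t : ℝ} (hs : 0 < s)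
    (hst : s < t) : μ.real {x | t < ‖x‖} ≤ ∫ x, ramp m s t x ∂μ ∧
      ∫ x, ramp m s t x ∂μ ≤ μ.real {x | s < ‖x‖} := by
  have hi := h.integrable (ramp m s t) hs (fun x hx => ramp_eq_zero hst hx)
  constructor
  · rw [← integral_indicator_one (measurableSet_norm_gt t)]
    exact integral_mono (integrable_indicator_gt h (hs.trans hst)) hi (indicator_le_ramp hst)
  · rw [← integral_indicator_one (measurableSet_norm_gt s)]
    exact integral_mono hi (integrable_indicator_gt h hs) (ramp_le_indicator hst)

/-- The integral of a function against the normalized law of `u⁻¹ Z`. -/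
theorem integral_smul_map {m : ℕ} {P : Measure Ω} {Y : Ω → Vec m} (hY : Measurable Y) {c : ℝ}
    (hc : 0 ≤ c) (u : ℝ) (f : Vec m → ℝ) (hf : Continuous f) :
    ∫ x, f x ∂(ENNReal.ofReal c • P.map (fun ω => u⁻¹ • Y ω)) = c * ∫ ω, f (u⁻¹ • Y ω) ∂P := by
  rw [integral_smul_measure, ENNReal.toReal_ofReal hc, smul_eq_mul,
    integral_map (by fun_prop) hf.aestronglyMeasurable]

theorem RegVar.real_gt {m : ℕ} {P : Measure Ω} {Z : Ω → Vec m} {μ : Measure (Vec m)} {α : ℝ}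
    (h : RegVar P Z μ α) {t : ℝ} (ht : 0 < t) :
    μ.real {x | t < ‖x‖} = t ^ (-α) * μ.real {x | 1 < ‖x‖} := by
  have := h.homogeneous t ht {x | 1 < ‖x‖} (measurableSet_norm_gt 1) (by simp)
  have e : (fun x : Vec m => t • x) '' {x | 1 < ‖x‖} = {x | t < ‖x‖} := by
    ext x
    constructor
    · rintro ⟨y, hy, rfl⟩
      have hy' : 1 < ‖y‖ := hy
      simp only [Set.mem_ofPred_eq, norm_smul, Real.norm_of_nonneg ht.le]
      nlinarith
    · intro hx
      refine ⟨t⁻¹ • x, ?_, by simp [smul_smul, ht.ne']⟩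
      have hx' : t < ‖x‖ := hx
      simp only [Set.mem_ofPred_eq, norm_smul, norm_inv, Real.norm_of_nonneg ht.le]
      rw [inv_mul_eq_div, lt_div_iff₀ ht]; linarith
  rw [e] at this
  rw [measureReal_def, this, ENNReal.toReal_mul, ENNReal.toReal_ofReal (by positivity), measureReal_def]

/-- Ramps squeeze the indicator of {|x| > t} between continuous test functions. By homogeneity the
limiting tail G(t) = t^(-α) G(1) is continuous, so the squeeze closes at every radius, and t = 1
shows G(1) = 1. -/
theorem RegVar.rvTail {m : ℕ} {P : Measure Ω} [IsProbabilityMeasure P] {Z : Ω → Vec m}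
    {μ : Measure (Vec m)} {α : ℝ} (hZ : Measurable Z) (h : RegVar P Z μ α) :
    RVTail (fun u => P.real {ω | u < ‖Z ω‖}) α := by
  set V : ℝ → ℝ := fun u => P.real {ω | u < ‖Z ω‖} with hV
  have hα := h.index_pos
  have hanti : Antitone V := fun u v huv => measureReal_mono fun ω hω => lt_of_le_of_lt huv hω
  have hnn : ∀ u, 0 ≤ V u := fun u => measureReal_nonneg
  obtain ⟨hM, hμ, hT⟩ := h.tendsto
  have hms : ∀ u, MeasurableSet {ω | u < ‖Z ω‖} := fun u =>
    measurableSet_lt measurable_const hZ.norm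
  have hlim : ∀ s t, 0 < s → s < t →
      Tendsto (fun u => 1 / V u * ∫ ω, ramp m s t (u⁻¹ • Z ω) ∂P) atTop
        (𝓝 (∫ x, ramp m s t x ∂μ)) := by
    intro s t hs hst
    refine (hT (ramp m s t) ⟨s, hs, fun x hx => ramp_eq_zero hst hx⟩).congr fun u => ?_
    exact integral_smul_map hZ (one_div_nonneg.2 (hnn u)) u _ (ramp m s t).continuous
  have hbd : ∀ s t u, 0 < s → s < t → 0 < u →
      V (t * u) ≤ ∫ ω, ramp m s t (u⁻¹ • Z ω) ∂P ∧
      ∫ ω, ramp m s t (u⁻¹ • Z ω) ∂P ≤ V (s * u) := by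
    intro s t u hs hst hu
    have hin : ∀ c, InM0 (P.map (fun ω => u⁻¹ • Z ω)) ∧
        (P.map (fun ω => u⁻¹ • Z ω)).real {x | c < ‖x‖} = V (c * u) := by
      intro c
      have : IsProbabilityMeasure (P.map (fun ω => u⁻¹ • Z ω)) :=
        Measure.isProbabilityMeasure_map (by fun_prop)
      refine ⟨fun r _ => measure_lt_top _ _, ?_⟩
      rw [map_measureReal_apply (by fun_prop) (measurableSet_norm_gt c)]
      congr 1
      ext ω
      simp only [Set.mem_preimage, Set.mem_ofPred_eq, norm_smul, norm_inv, Real.norm_of_nonneg hu.le]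
      rw [inv_mul_eq_div, lt_div_iff₀ hu]
    have := integral_ramp_mem (hin 1).1 hs hst
    rw [(hin t).2, (hin s).2, integral_map (by fun_prop)
      (ramp m s t).continuous.aestronglyMeasurable] at this
    exact this
  -- If V vanished beyond u₀, the normalization there would be 1 / 0 = 0. All limits would then be
  -- zero, and μ would have no mass off the origin.
  have hpos : ∀ u, 0 < V u := by
    intro u₀
    by_contra h0
    have hz : ∀ u, u₀ ≤ u → V u = 0 := fun u hu =>
      le_antisymm ((hanti hu).trans (not_lt.1 h0)) (hnn u)
    have hG : ∀ t, 0 < t → μ {x | t < ‖x‖} = 0 := by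
      intro t ht
      have h1 := (integral_ramp_mem hμ (half_pos ht) (half_lt_self ht)).1
      have h2 : ∫ x, ramp m (t / 2) t x ∂μ = 0 := by
        refine tendsto_nhds_unique (hlim _ _ (half_pos ht) (half_lt_self ht)) ?_
        refine tendsto_const_nhds.congr' ?_
        filter_upwards [eventually_ge_atTop u₀] with u hu
        simp [hz u hu]
      rw [h2] at h1
      have h3 := le_antisymm h1 measureReal_nonneg
      rw [measureReal_def, ENNReal.toReal_eq_zero_iff] at h3
      exact h3.resolve_right (hμ.lt_top ht).ne
    refine h.ne_zero (Measure.measure_univ_eq_zero.1 ?_)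
    have : (Set.univ : Set (Vec m)) ⊆ {0} ∪ ⋃ n : ℕ, {x | (1 / ((n:ℝ) + 1)) < ‖x‖} := by
      intro x _
      by_cases hx : x = 0
      · exact Or.inl hx
      · right
        obtain ⟨n, hn⟩ := exists_nat_one_div_lt (norm_pos_iff.2 hx)
        exact Set.mem_iUnion.2 ⟨n, hn⟩
    refine measure_mono_null this (measure_union_null h.zero_null (measure_iUnion_null fun n => ?_))
    exact hG _ (by positivity)
  set G : ℝ → ℝ := fun t => t ^ (-α) * μ.real {x | 1 < ‖x‖} with hGdef
  have hGc : ∀ t, 0 < t → ContinuousAt G t := fun t ht =>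
    (Real.continuousAt_rpow_const _ _ (Or.inl ht.ne')).mul continuousAt_const
  have key : ∀ t, 0 < t → Tendsto (fun u => V (t * u) / V u) atTop (𝓝 (G t)) := by
    intro t ht
    rw [tendsto_order]
    constructor
    · intro a ha
      have hev := (hGc t ht).eventually (lt_mem_nhds ha)
      obtain ⟨t', ht', hat'⟩ : ∃ t', t < t' ∧ a < G t' := by
        have := (hev.filter_mono nhdsWithin_le_nhds : ∀ᶠ x in 𝓝[>] t, a < G x)
        obtain ⟨x, hx, hx'⟩ := (this.and self_mem_nhdsWithin).exists
        exact ⟨x, hx', hx⟩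
      have h1 := (integral_ramp_mem hμ ht ht').1
      rw [h.real_gt (ht.trans ht')] at h1
      filter_upwards [(hlim t t' ht ht').eventually (lt_mem_nhds (hat'.trans_le h1)),
        eventually_gt_atTop 0] with u hu hu0
      refine hu.trans_le ?_
      rw [one_div, inv_mul_eq_div]
      exact div_le_div_of_nonneg_right (hbd t t' u ht ht' hu0).2 (hnn u)
    · intro a ha
      have hev := (hGc t ht).eventually (gt_mem_nhds ha)
      obtain ⟨s, hs0, hst, has⟩ : ∃ s, 0 < s ∧ s < t ∧ G s < a := by
        have := (hev.filter_mono nhdsWithin_le_nhds : ∀ᶠ x in 𝓝[<] t, G x < a)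
        have h0 : ∀ᶠ x in 𝓝[<] t, 0 < x :=
          (lt_mem_nhds ht : ∀ᶠ x in 𝓝 t, 0 < x).filter_mono nhdsWithin_le_nhds
        obtain ⟨x, hx, hx', hx''⟩ := (this.and (h0.and self_mem_nhdsWithin)).exists
        exact ⟨x, hx', hx'', hx⟩
      have h1 := (integral_ramp_mem hμ hs0 hst).2
      rw [h.real_gt hs0] at h1
      filter_upwards [(hlim s t hs0 hst).eventually (gt_mem_nhds (h1.trans_lt has)),
        eventually_gt_atTop 0] with u hu hu0
      refine lt_of_le_of_lt ?_ hu
      rw [one_div, inv_mul_eq_div]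
      exact div_le_div_of_nonneg_right (hbd s t u hs0 hst hu0).1 (hnn u)
  have hG1 : μ.real {x : Vec m | 1 < ‖x‖} = 1 := by
    have h1 := key 1 one_pos
    have h2 : Tendsto (fun u => V (1 * u) / V u) atTop (𝓝 1) := by
      refine tendsto_const_nhds.congr fun u => ?_
      rw [one_mul, div_self (hpos u).ne']
    have := tendsto_nhds_unique h1 h2
    simpa [hGdef] using this
  refine ⟨hα, hanti, hpos, fun u => measureReal_le_one, fun s hs => ?_⟩
  have := key s hs
  simpa [hGdef, hG1] using this

end RCLP

/-! ### Truncated moments and means above a level -/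

namespace RCLP

variable {Ω : Type*} [MeasurableSpace Ω]

/-- A one-sided Potter type bound `P(R > x / s) ≤ C s^a V(x)` for the tail of `R`. -/
def TailBound (P : Measure Ω) (V : ℝ → ℝ) (a : ℝ) (R : Ω → ℝ) : Prop :=
  ∃ C x₀ : ℝ, 1 ≤ C ∧ 1 ≤ x₀ ∧
    ∀ x, x₀ ≤ x → ∀ s, 1 ≤ s → P.real {ω | x / s < R ω} ≤ C * s ^ a * V x

theorem lintegral_rpow_Ioc {x b : ℝ} (hx : 0 < x) (hb : -1 < b) :
    ∫⁻ t in Set.Ioc 0 x, ENNReal.ofReal (t ^ b) = ENNReal.ofReal (x ^ (b + 1) / (b + 1)) := by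
  have hi : IntervalIntegrable (fun t : ℝ => t ^ b) volume 0 x :=
    intervalIntegral.intervalIntegrable_rpow' hb
  rw [← ofReal_integral_eq_lintegral_ofReal]
  · rw [← intervalIntegral.integral_of_le hx.le, integral_rpow (Or.inl hb),
      Real.zero_rpow (by linarith), sub_zero]
  · exact (intervalIntegrable_iff_integrableOn_Ioc_of_le hx.le).1 hi
  · filter_upwards [ae_restrict_mem measurableSet_Ioc] with t ht
    exact Real.rpow_nonneg ht.1.le _

theorem lintegral_rpow_Ioi {x b : ℝ} (hx : 0 < x) (hb : b < -1) :
    ∫⁻ t in Set.Ioi x, ENNReal.ofReal (t ^ b) = ENNReal.ofReal (-x ^ (b + 1) / (b + 1)) := by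
  rw [← ofReal_integral_eq_lintegral_ofReal]
  · rw [integral_Ioi_rpow_of_lt hb hx]
  · exact integrableOn_Ioi_rpow_of_lt hb hx
  · filter_upwards [ae_restrict_mem measurableSet_Ioi] with t ht
    exact Real.rpow_nonneg (hx.trans ht).le _

/-- Truncated moments of order above the tail exponent. -/
theorem TailBound.trunc_moment {P : Measure Ω} [IsProbabilityMeasure P] {V : ℝ → ℝ} {a q : ℝ}
    {R : Ω → ℝ} (hV : ∀ u, 0 < V u) (h : TailBound P V a R) (hR : Measurable R)
    (hR0 : ∀ ω, 0 ≤ R ω) (hq : 0 < q) (haq : a < q) :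
    ∃ C x₀ : ℝ, 0 < C ∧ 1 ≤ x₀ ∧ ∀ x, x₀ ≤ x →
      ∫ ω, (min (R ω) x) ^ q ∂P ≤ C * x ^ q * V x := by
  obtain ⟨C, x₀, hC, hx₀, hB⟩ := h
  refine ⟨q * C / (q - a), x₀, div_pos (by positivity) (by linarith), hx₀, fun x hx => ?_⟩
  have hx0 : 0 < x := by linarith
  have hnn : ∀ ω, 0 ≤ min (R ω) x := fun ω => le_min (hR0 ω) hx0.le
  have hm : Measurable fun ω => min (R ω) x := hR.min measurable_const
  rw [integral_eq_lintegral_of_nonneg_ae (Eventually.of_forall fun ω => Real.rpow_nonneg (hnn ω) _)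
    (hm.pow_const q).aestronglyMeasurable]
  refine ENNReal.toReal_le_of_le_ofReal (mul_nonneg (mul_nonneg (div_nonneg (by positivity)
    (by linarith)) (by positivity)) (hV x).le) ?_
  rw [lintegral_rpow_eq_lintegral_meas_lt_mul P (Eventually.of_forall hnn) hm.aemeasurable hq]
  -- Layer cake: for t ≤ x the tail bound is used with s = x / t, and above x there is no mass. The
  -- remaining power t^(q-1-a) is integrable at 0 because a < q.
  have hb : ∀ t ∈ Set.Ioi (0:ℝ), P {ω | t < min (R ω) x} * ENNReal.ofReal (t ^ (q - 1)) ≤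
      Set.indicator (Set.Ioc 0 x) (fun t => ENNReal.ofReal (C * x ^ a * V x) *
        ENNReal.ofReal (t ^ (q - 1 - a))) t := by
    intro t ht
    have ht0 : 0 < t := ht
    by_cases htx : t ≤ x
    · rw [Set.indicator_of_mem (show t ∈ Set.Ioc 0 x from ⟨ht0, htx⟩)]
      have h1 := hB x hx (x / t) ((one_le_div ht0).2 htx)
      rw [div_div_cancel₀ hx0.ne'] at h1
      have h2 : P {ω | t < min (R ω) x} ≤ ENNReal.ofReal (C * (x / t) ^ a * V x) := by
        refine (measure_mono fun ω (hω : t < min (R ω) x) => ?_).trans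
          ((ENNReal.le_ofReal_iff_toReal_le (measure_ne_top _ _)
            (measureReal_nonneg.trans h1)).2 h1)
        exact hω.trans_le (min_le_left _ _)
      refine (mul_le_mul_left h2 _).trans ?_
      have hVx := (hV x).le
      rw [← ENNReal.ofReal_mul (by positivity), ← ENNReal.ofReal_mul (by positivity)]
      refine ENNReal.ofReal_le_ofReal (le_of_eq ?_)
      rw [Real.div_rpow hx0.le ht0.le, Real.rpow_sub ht0 (q - 1)]
      field_simp
    · have : {ω | t < min (R ω) x} = ∅ := by
        ext ω
        simp only [Set.mem_ofPred_eq, Set.mem_empty_iff_false, iff_false, not_lt]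
        exact (min_le_right _ _).trans (not_le.1 htx).le
      rw [this]; simp
  refine (mul_le_mul_right (setLIntegral_mono' measurableSet_Ioi hb) _).trans ?_
  rw [setLIntegral_indicator measurableSet_Ioc, Set.inter_eq_left.2 Set.Ioc_subset_Ioi_self,
    lintegral_const_mul' _ _ ENNReal.ofReal_ne_top, lintegral_rpow_Ioc hx0 (by linarith)]
  have hVx := (hV x).le
  rw [← ENNReal.ofReal_mul (by positivity), ← ENNReal.ofReal_mul (by positivity)]
  refine ENNReal.ofReal_le_ofReal (le_of_eq ?_)
  rw [show q - 1 - a + 1 = q - a by ring]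
  have : x ^ q = x ^ a * x ^ (q - a) := by rw [← Real.rpow_add hx0]; ring_nf
  rw [this]; ring

theorem RVTail.tailBound {P : Measure Ω} {V : ℝ → ℝ} {α a : ℝ} (hV : RVTail V α) {R : Ω → ℝ}
    (hR : ∀ u, P.real {ω | u < R ω} = V u) (ha : α < a) : TailBound P V a R := by
  obtain ⟨C, x₀, hC, hx₀, h⟩ := hV.potter_lower ha
  exact ⟨C, x₀, hC, hx₀, fun x hx s hs => by rw [hR]; exact h x hx s hs⟩

/-- The mean above a high level, for tail index larger than one. -/
theorem RVTail.integral_gt_le {P : Measure Ω} [IsProbabilityMeasure P] {V : ℝ → ℝ} {α : ℝ}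
    (hV : RVTail V α) (hα : 1 < α) {R : Ω → ℝ} (hRm : Measurable R) (hR0 : ∀ ω, 0 ≤ R ω)
    (hR : ∀ u, P.real {ω | u < R ω} = V u) :
    ∃ C x₀ : ℝ, 0 < C ∧ 1 ≤ x₀ ∧ ∀ x, x₀ ≤ x →
      ∫ ω, Set.indicator {ω | x < R ω} R ω ∂P ≤ C * x * V x := by
  -- Here b < α allows the upper Potter bound V(t) ≤ C (t/x)^(-b) V(x) for t > x, and b > 1 makes it
  -- integrable there. Levels below x contribute x V(x).
  obtain ⟨b, h1b, hbα⟩ := exists_between hα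
  obtain ⟨C, x₀, hC, hx₀, hP⟩ := hV.potter_upper (by linarith) hbα
  refine ⟨1 + C / (b - 1), x₀, by have : 0 < C / (b-1) := div_pos (by linarith) (by linarith)
                                  linarith, hx₀, fun x hx => ?_⟩
  have hx0 : 0 < x := by linarith
  have hVx := hV.pos x
  have hms : MeasurableSet {ω | x < R ω} := measurableSet_lt measurable_const hRm
  have hnn : ∀ ω, 0 ≤ Set.indicator {ω | x < R ω} R ω := fun ω =>
    Set.indicator_nonneg (fun ω _ => hR0 ω) ω
  have hm := hRm.indicator hms
  have hcb : 0 ≤ C / (b - 1) := div_nonneg (by linarith) (by linarith)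
  rw [integral_eq_lintegral_of_nonneg_ae (Eventually.of_forall hnn) hm.aestronglyMeasurable]
  refine ENNReal.toReal_le_of_le_ofReal (by positivity) ?_
  have := lintegral_rpow_eq_lintegral_meas_lt_mul P (Eventually.of_forall hnn) hm.aemeasurable
    one_pos
  simp only [Real.rpow_one, ENNReal.ofReal_one, one_mul, sub_self, Real.rpow_zero, mul_one] at this
  rw [this]
  have e : Set.Ioi (0:ℝ) = Set.Ioc 0 x ∪ Set.Ioi x := (Set.Ioc_union_Ioi_eq_Ioi hx0.le).symm
  rw [e]
  have hE : ∀ u, P {ω | u < R ω} = ENNReal.ofReal (V u) := fun u => by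
    rw [← hR u, ofReal_measureReal (measure_ne_top _ _)]
  have s1 : ∫⁻ t in Set.Ioc 0 x, P {ω | t < Set.indicator {ω | x < R ω} R ω} ≤
      ENNReal.ofReal (x * V x) := by
    refine (setLIntegral_mono' measurableSet_Ioc (g := fun _ => ENNReal.ofReal (V x))
      fun t ht => ?_).trans ?_
    · rw [← hE]
      refine measure_mono fun ω hω => ?_
      by_contra hn
      have hω' : t < Set.indicator {ω | x < R ω} R ω := hω
      rw [Set.indicator_of_notMem hn] at hω'
      exact absurd ht.1 (not_lt.2 hω'.le)
    · rw [setLIntegral_const, Real.volume_Ioc, sub_zero, ← ENNReal.ofReal_mul hVx.le, mul_comm]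
  have s2 : ∫⁻ t in Set.Ioi x, P {ω | t < Set.indicator {ω | x < R ω} R ω} ≤
      ENNReal.ofReal (C / (b - 1) * x * V x) := by
    refine (setLIntegral_mono' measurableSet_Ioi (g := fun t => ENNReal.ofReal (C * x ^ b * V x) *
      ENNReal.ofReal (t ^ (-b))) fun t ht => ?_).trans ?_
    · have hxt : x < t := ht
      have ht0 : 0 < t := hx0.trans hxt
      have h1 : P {ω | t < Set.indicator {ω | x < R ω} R ω} ≤ ENNReal.ofReal (V t) := by
        rw [← hE]
        exact measure_mono fun ω (hω : t < _) => hω.trans_le (Set.indicator_le_self' (fun _ _ => hR0 _) _)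
      refine h1.trans ?_
      rw [← ENNReal.ofReal_mul (by positivity)]
      refine ENNReal.ofReal_le_ofReal ?_
      have := hP x hx (t / x) ((one_le_div hx0).2 hxt.le)
      rw [div_mul_cancel₀ _ hx0.ne'] at this
      refine this.trans (le_of_eq ?_)
      rw [Real.div_rpow ht0.le hx0.le, Real.rpow_neg hx0.le]
      field_simp
    · rw [lintegral_const_mul' _ _ ENNReal.ofReal_ne_top, lintegral_rpow_Ioi hx0 (by linarith),
        ← ENNReal.ofReal_mul (by positivity)]
      refine ENNReal.ofReal_le_ofReal (le_of_eq ?_)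
      have : x ^ b * x ^ (-b + 1) = x := by
        rw [← Real.rpow_add hx0]; norm_num
      have h3 : b - 1 ≠ 0 := by linarith
      calc C * x ^ b * V x * (-x ^ (-b + 1) / (-b + 1))
          = C * V x * (x ^ b * x ^ (-b + 1)) / (b - 1) := by
            rw [show -b + 1 = -(b - 1) by ring, neg_div_neg_eq]; ring
        _ = C / (b - 1) * x * V x := by rw [this]; ring
  refine (lintegral_union_le _ _ _).trans ((add_le_add s1 s2).trans ?_)
  rw [← ENNReal.ofReal_add (by positivity) (by positivity)]
  exact ENNReal.ofReal_le_ofReal (le_of_eq (by ring))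

end RCLP

/-! ### Consequences of the weak law -/

namespace RCLP

variable {Ω : Type*} [MeasurableSpace Ω]

/-- `1 - E e^{itT}` is small when `T` is small in probability. -/
theorem norm_one_sub_charFun_le {P : Measure Ω} [IsProbabilityMeasure P] {T : Ω → ℝ}
    (hT : Measurable T) {e : ℝ} (he : 0 ≤ e) (t : ℝ) :
    ‖1 - charFun (P.map T) t‖ ≤ |t| * e + 2 * P.real {ω | e ≤ |T ω|} := by
  have hms : MeasurableSet {ω | e ≤ |T ω|} := measurableSet_le measurable_const hT.abs
  have h1 : charFun (P.map T) t = ∫ ω, Complex.exp (t * T ω * Complex.I) ∂P := by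
    rw [charFun_apply_real, integral_map hT.aemeasurable (by fun_prop)]
  have hint : Integrable (fun ω => Complex.exp (t * T ω * Complex.I)) P := by
    refine (integrable_const (1:ℝ)).mono' (by fun_prop) (Eventually.of_forall fun ω => ?_)
    rw [← Complex.ofReal_mul, Complex.norm_exp_ofReal_mul_I]
  have h2 : 1 - charFun (P.map T) t = ∫ ω, (1 - Complex.exp (t * T ω * Complex.I)) ∂P := by
    rw [integral_sub (integrable_const _) hint, h1]; simp
  rw [h2]
  have hint2 : Integrable (fun ω => |t| * e + Set.indicator {ω | e ≤ |T ω|} (fun _ => (2:ℝ)) ω) P :=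
    (integrable_const _).add ((integrable_const _).indicator hms)
  refine (norm_integral_le_integral_norm _).trans ((integral_mono_of_nonneg
    (Eventually.of_forall fun _ => norm_nonneg _) hint2 (Eventually.of_forall fun ω => ?_)).trans ?_)
  · have hx : (t * T ω * Complex.I : ℂ) = Complex.I * ((t * T ω : ℝ) : ℂ) := by push_cast; ring
    change ‖1 - Complex.exp (t * T ω * Complex.I)‖ ≤
      |t| * e + Set.indicator {ω | e ≤ |T ω|} (fun _ => (2:ℝ)) ω
    rw [hx, norm_sub_rev]
    by_cases h : e ≤ |T ω|
    · rw [Set.indicator_of_mem (by exact h)]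
      have h3 : ‖Complex.exp (Complex.I * ((t * T ω : ℝ) : ℂ)) - 1‖ ≤ 2 := by
        refine (norm_sub_le _ _).trans ?_
        rw [mul_comm, Complex.norm_exp_ofReal_mul_I]; norm_num
      have : 0 ≤ |t| * e := by positivity
      linarith
    · rw [Set.indicator_of_notMem (by exact h), add_zero]
      refine Real.norm_exp_I_mul_ofReal_sub_one_le.trans ?_
      rw [norm_mul, Real.norm_eq_abs, Real.norm_eq_abs]
      exact mul_le_mul_of_nonneg_left (not_le.1 h).le (abs_nonneg _)
  · rw [integral_add (integrable_const _) ((integrable_const _).indicator hms),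
      integral_indicator_const _ hms]
    simp [mul_comm]

/-- With u = n(1 - x) one has x^n ≤ exp(-u), hence (1 - 2η)(1 + u) ≤ 1. Since (1 - 2η)(1 + 4η) ≥ 1
for η ≤ 1/4, u cannot exceed 4η. -/
theorem mul_one_sub_le_of_pow {x η : ℝ} {n : ℕ} (hx : 0 ≤ x) (hη : 0 ≤ η) (hη4 : η ≤ 1 / 4)
    (h : 1 - 2 * η ≤ x ^ n) : n * (1 - x) ≤ 4 * η := by
  set u := n * (1 - x) with hu
  have h1 : x ^ n ≤ Real.exp (-u) := by
    have : x ≤ Real.exp (-(1 - x)) := by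
      have := Real.add_one_le_exp (-(1 - x)); linarith
    refine (pow_le_pow_left₀ hx this n).trans (le_of_eq ?_)
    rw [← Real.exp_nat_mul]; congr 1; rw [hu]; ring
  have h2 : (1 - 2 * η) * Real.exp u ≤ 1 := by
    have := mul_le_mul_of_nonneg_right (h.trans h1) (Real.exp_pos u).le
    rwa [← Real.exp_add, neg_add_cancel, Real.exp_zero] at this
  have h3 := Real.add_one_le_exp u
  by_contra hcon
  nlinarith

/-- If normalized sums of i.i.d. variables vanish in probability, then the symmetrized summands
have tails of order `o(1/n)` at the scale of the normalization. -/
theorem tendsto_mul_symm_tail {P : Measure Ω} [IsProbabilityMeasure P] {ζ : ℤ → Ω → ℝ}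
    (hm : ∀ k, Measurable (ζ k)) (hind : iIndepFun ζ P) (hid : ∀ k, IdentDistrib (ζ k) (ζ 0) P P)
    {γ : ℕ → ℝ} (hγ : ∀ n, 1 ≤ n → 0 < γ n)
    (hT : ∀ e : ℝ, 0 < e → Tendsto
      (fun n : ℕ => P.real {ω | e ≤ |(γ n)⁻¹ * ∑ k ∈ Finset.Icc 1 n, ζ (k : ℤ) ω|}) atTop (𝓝 0))
    {c : ℝ} (hc : 0 < c) :
    Tendsto (fun n : ℕ => (n:ℝ) * P.real {ω | c * γ n < |ζ 1 ω - ζ 2 ω|}) atTop (𝓝 0) := by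
  set φ : ℝ → ℂ := charFun (P.map (ζ 0)) with hφ
  -- The symmetrized variable has characteristic function |φ|². Only the modulus of φ^n, the
  -- characteristic function of the sum, is then needed, and no centring arises.
  set D : Ω → ℝ := ζ 1 + -ζ 2 with hD
  have hDm : Measurable D := (hm 1).add (hm 2).neg
  have hmap : ∀ k, P.map (ζ k) = P.map (ζ 0) := fun k => (hid k).map_eq
  have hDφ : ∀ t, charFun (P.map D) t = ((‖φ t‖ ^ 2 : ℝ) : ℂ) := by
    intro t
    have hi : IndepFun (ζ 1) (-ζ 2) P :=
      (hind.indepFun (by norm_num : (1:ℤ) ≠ 2)).comp measurable_id measurable_neg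
    rw [hD, hi.charFun_map_add_eq_mul (hm 1).aemeasurable (hm 2).neg.aemeasurable]
    have : charFun (P.map (-ζ 2)) t = (starRingEnd ℂ) (φ t) := by
      rw [hφ, ← charFun_neg, ← hmap 2, charFun_apply_real, charFun_apply_real,
        integral_map (hm 2).neg.aemeasurable (by fun_prop),
        integral_map (hm 2).aemeasurable (by fun_prop)]
      simp
    rw [Pi.mul_apply, this, hmap 1, Complex.mul_conj, Complex.normSq_eq_norm_sq]
  have hψ : ∀ n : ℕ, ∀ t, charFun (P.map (fun ω => (γ n)⁻¹ * ∑ k ∈ Finset.Icc 1 n, ζ (k : ℤ) ω)) t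
      = φ ((γ n)⁻¹ * t) ^ n := by
    intro n t
    have hinj : Function.Injective (fun k : ℕ => (k : ℤ)) := Nat.cast_injective
    have h1 : iIndepFun (fun k : ℕ => ζ k) P := hind.precomp hinj
    have h2 := iIndepFun.charFun_map_fun_finsetSum_eq_prod (s := Finset.Icc 1 n)
      (X := fun k : ℕ => ζ k) (P := P) (fun k _ => (hm k).aemeasurable) (h1.restrict _)
    have h3 : P.map (fun ω => (γ n)⁻¹ * ∑ k ∈ Finset.Icc 1 n, ζ (k : ℤ) ω) =
        (P.map (fun ω => ∑ k ∈ Finset.Icc 1 n, ζ (k : ℤ) ω)).map (fun x => (γ n)⁻¹ * x) := by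
      rw [Measure.map_map (by fun_prop) (by fun_prop)]; rfl
    rw [h3, charFun_map_mul, h2, Finset.prod_apply]
    simp [hmap, hφ]
  rw [Metric.tendsto_atTop]
  intro e he
  obtain ⟨η, hη0, hη4, hηe⟩ : ∃ η : ℝ, 0 < η ∧ η ≤ 1 / 4 ∧ 8 * η < e :=
    ⟨min (1 / 4) (e / 16), by positivity, min_le_left _ _, by
      have := min_le_right (1 / 4) (e / 16); linarith⟩
  -- In the range |t| ≤ 2/(cγ_n) of the truncation inequality one has |γ_n t| ≤ 2/c. The threshold
  -- ηc/4 thus contributes η/2, and the probability bound η/4, which enters twice, another η/2.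
  have hev := (hT (η * c / 4) (by positivity)).eventually (gt_mem_nhds (show (0:ℝ) < η / 4 by positivity))
  obtain ⟨N, hN⟩ := eventually_atTop.1 hev
  refine ⟨max N 1, fun n hn => ?_⟩
  have hn1 : 1 ≤ n := (le_max_right _ _).trans hn
  have hn0 : (0:ℝ) < n := by exact_mod_cast hn1
  have hg := hγ n hn1
  have hPN := hN n ((le_max_left _ _).trans hn)
  have hub : ∀ t : ℝ, |t| ≤ 2 * (c * γ n)⁻¹ → ‖1 - charFun (P.map D) t‖ ≤ 4 * η / n := by
    intro t ht
    have h1 := norm_one_sub_charFun_le (P := P)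
      (T := fun ω => (γ n)⁻¹ * ∑ k ∈ Finset.Icc 1 n, ζ (k : ℤ) ω) (by fun_prop)
      (e := η * c / 4) (by positivity) (γ n * t)
    rw [hψ, inv_mul_cancel_left₀ hg.ne'] at h1
    have h2 : |γ n * t| * (η * c / 4) ≤ η / 2 := by
      rw [abs_mul, abs_of_pos hg]
      calc γ n * |t| * (η * c / 4) ≤ γ n * (2 * (c * γ n)⁻¹) * (η * c / 4) := by gcongr
        _ = η / 2 := by field_simp; norm_num
    have h3 : 1 - η ≤ ‖φ t‖ ^ n := by
      have h4 : ‖(1:ℂ)‖ - ‖φ t ^ n‖ ≤ ‖1 - φ t ^ n‖ := norm_sub_norm_le _ _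
      rw [norm_one, norm_pow] at h4
      linarith
    have h5 : 1 - 2 * η ≤ (‖φ t‖ ^ 2) ^ n := by
      rw [show (‖φ t‖ ^ 2) ^ n = (‖φ t‖ ^ n) ^ 2 by rw [← pow_mul, ← pow_mul, mul_comm]]
      nlinarith
    have h6 := mul_one_sub_le_of_pow (by positivity) hη0.le hη4 h5
    have h7 : ‖φ t‖ ^ 2 ≤ 1 := by
      have : IsProbabilityMeasure (P.map (ζ 0)) := Measure.isProbabilityMeasure_map (hm 0).aemeasurable
      exact pow_le_one₀ (norm_nonneg _) (norm_charFun_le_one t)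
    rw [hDφ, ← Complex.ofReal_one, ← Complex.ofReal_sub, Complex.norm_real, Real.norm_of_nonneg
      (by linarith), le_div_iff₀ hn0]
    linarith
  have hprob : IsProbabilityMeasure (P.map D) := Measure.isProbabilityMeasure_map hDm.aemeasurable
  have h8 := measureReal_abs_gt_le_integral_charFun (μ := P.map D) (mul_pos hc hg)
  rw [map_measureReal_apply hDm (measurableSet_lt measurable_const (by fun_prop))] at h8
  have h9 : ‖∫ t in (-2 * (c * γ n)⁻¹)..(2 * (c * γ n)⁻¹), 1 - charFun (P.map D) t‖ ≤
      4 * η / n * |2 * (c * γ n)⁻¹ - -2 * (c * γ n)⁻¹| := by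
    refine intervalIntegral.norm_integral_le_of_norm_le_const fun t ht => hub t ?_
    have hpos : 0 < (c * γ n)⁻¹ := by positivity
    rw [Set.uIoc_of_le (by linarith)] at ht
    rw [abs_le]; constructor <;> linarith [ht.1, ht.2]
  have h10 : P.real (D ⁻¹' {x | c * γ n < |x|}) ≤ 8 * η / n := by
    refine h8.trans ((mul_le_mul_of_nonneg_left h9 (by positivity)).trans (le_of_eq ?_))
    have hpos : 0 < (c * γ n)⁻¹ := by positivity
    rw [abs_of_pos (by linarith)]
    field_simp
    norm_num
  have hset : {ω | c * γ n < |ζ 1 ω - ζ 2 ω|} = D ⁻¹' {x | c * γ n < |x|} := by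
    ext ω; simp [hD, sub_eq_add_neg]
  rw [Real.dist_eq, sub_zero, abs_of_nonneg (by positivity), hset]
  rw [le_div_iff₀ hn0] at h10
  linarith

theorem norm_le_sum_abs {m : ℕ} (x : Vec m) : ‖x‖ ≤ ∑ i, |x i| := by
  have h : x = ∑ i, x i • EuclideanSpace.single i (1:ℝ) := by
    ext j
    simp [Pi.single_apply]
  conv_lhs => rw [h]
  refine (norm_sum_le _ _).trans (Finset.sum_le_sum fun i _ => ?_)
  rw [norm_smul, PiLp.norm_single, norm_one, mul_one, Real.norm_eq_abs]

theorem abs_apply_le_norm {m : ℕ} (x : Vec m) (i : Fin m) : |x i| ≤ ‖x‖ := by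
  simpa using PiLp.norm_apply_le x i

theorem exists_abs_apply_gt {m : ℕ} {x : Vec m} {t : ℝ} (h : m * t < ‖x‖) :
    ∃ i, t < |x i| := by
  by_contra! hc
  have h2 : ‖x‖ ≤ m * t := by
    refine (norm_le_sum_abs x).trans ((Finset.sum_le_sum fun i _ => hc i).trans ?_)
    simp
  linarith

theorem tendstoInMeasure_real {P : Measure Ω} [IsProbabilityMeasure P] {E : Type*}
    [NormedAddCommGroup E] {T : ℕ → Ω → E}
    (h : TendstoInMeasure P T atTop (fun _ => (0 : E))) {e : ℝ} (he : 0 < e) :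
    Tendsto (fun n : ℕ => P.real {ω | e ≤ ‖T n ω‖}) atTop (𝓝 0) := by
  rw [tendstoInMeasure_iff_norm] at h
  have := h e he
  simp only [sub_zero] at this
  exact (ENNReal.tendsto_toReal_zero_iff (fun n => measure_ne_top _ _)).2 this

section WeakLaw

variable {P : Measure Ω} [IsProbabilityMeasure P] {p : ℕ} {Z : ℤ → Ω → Vec p}
  {α : ℝ} {γ : ℕ → ℝ}

theorem tendsto_mul_symm_norm_tail
    (hm : ∀ k, Measurable (Z k)) (hind : iIndepFun Z P) (hid : ∀ k, IdentDistrib (Z k) (Z 0) P P)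
    (hγ : ∀ n, 1 ≤ n → 0 < γ n)
    (hT : TendstoInMeasure P
      (fun (n : ℕ) ω => (γ n)⁻¹ • ∑ k ∈ Finset.Icc 1 n, Z (k : ℤ) ω) atTop (fun _ => (0 : Vec p)))
    {c : ℝ} (hc : 0 < c) :
    Tendsto (fun n : ℕ => (n:ℝ) * P.real {ω | c * γ n < ‖Z 1 ω - Z 2 ω‖}) atTop (𝓝 0) := by
  -- Dividing by p + 1 instead of p leaves room for the union over coordinates and covers p = 0.
  have hp0 : (0:ℝ) < p + 1 := by positivity
  have hco : ∀ i : Fin p, Measurable fun x : Vec p => x i := fun i => by fun_prop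
  have hi : ∀ i : Fin p, Tendsto (fun n : ℕ => (n:ℝ) *
      P.real {ω | c / (p + 1) * γ n < |Z 1 ω i - Z 2 ω i|}) atTop (𝓝 0) := by
    intro i
    refine tendsto_mul_symm_tail (ζ := fun k ω => Z k ω i) (fun k => (hco i).comp (hm k))
      (hind.comp (fun _ x => x i) fun _ => hco i) (fun k => (hid k).comp (hco i)) hγ ?_
      (div_pos hc hp0)
    intro e he
    refine squeeze_zero (fun _ => measureReal_nonneg) (fun n => measureReal_mono ?_)
      (tendstoInMeasure_real hT he)
    intro ω hω
    have h1 : e ≤ |(γ n)⁻¹ * ∑ k ∈ Finset.Icc 1 n, Z (k : ℤ) ω i| := hω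
    refine h1.trans ?_
    have := abs_apply_le_norm ((γ n)⁻¹ • ∑ k ∈ Finset.Icc 1 n, Z (k : ℤ) ω) i
    simpa using this
  have hsum := tendsto_finsetSum Finset.univ fun i _ => hi i
  rw [Finset.sum_const_zero] at hsum
  refine squeeze_zero' (Eventually.of_forall fun n => by positivity) ?_ hsum
  filter_upwards [eventually_ge_atTop 1] with n hn
  have hg := hγ n hn
  rw [← Finset.mul_sum]
  refine mul_le_mul_of_nonneg_left ?_ (Nat.cast_nonneg n)
  refine (measureReal_mono ?_).trans (measureReal_iUnion_fintype_le _)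
  intro ω hω
  have hω' : c * γ n < ‖Z 1 ω - Z 2 ω‖ := hω
  have h2 : (p:ℝ) * (c / (p + 1) * γ n) < ‖Z 1 ω - Z 2 ω‖ := by
    refine lt_of_le_of_lt ?_ hω'
    rw [← mul_assoc]
    refine mul_le_mul_of_nonneg_right ?_ hg.le
    rw [mul_div_assoc', div_le_iff₀ hp0]
    nlinarith
  obtain ⟨i, hi⟩ := exists_abs_apply_gt h2
  exact Set.mem_iUnion.2 ⟨i, by simpa using hi⟩

theorem RVTail.tendsto_zero {V : ℝ → ℝ} {α : ℝ} (h : RVTail V α) : Tendsto V atTop (𝓝 0) := by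
  have hα := h.index_pos
  obtain ⟨C, hC, hle⟩ := h.le_rpow (half_pos hα) (half_lt_self hα)
  have h1 : Tendsto (fun x : ℝ => C * x ^ (-(α / 2))) atTop (𝓝 (C * 0)) :=
    (tendsto_rpow_neg_atTop (half_pos hα)).const_mul C
  rw [mul_zero] at h1
  refine squeeze_zero' (Eventually.of_forall fun u => (h.pos u).le) ?_ h1
  filter_upwards [eventually_gt_atTop 0] with x hx using hle x hx

/-- If |Z_1| > u and |Z_2| ≤ u - K, then |Z_1 - Z_2| > K, and these two events are independent. This
transfers tail estimates from the symmetrized vector back to Z. -/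
theorem symm_tail_ge {V : ℝ → ℝ} (hm : ∀ k, Measurable (Z k)) (hind : iIndepFun Z P)
    (hV : ∀ k u, P.real {ω | u < ‖Z k ω‖} = V u) (u K : ℝ) :
    V u * (1 - V (u - K)) ≤ P.real {ω | K < ‖Z 1 ω - Z 2 ω‖} := by
  have h1 := congrArg ENNReal.toReal
    ((hind.indepFun (by norm_num : (1:ℤ) ≠ 2)).measure_inter_preimage_eq_mul
    {x | u < ‖x‖} {x | u - K < ‖x‖}ᶜ (measurableSet_norm_gt _) (measurableSet_norm_gt _).compl)
  rw [ENNReal.toReal_mul, ← measureReal_def, ← measureReal_def, ← measureReal_def] at h1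
  have h2 : P.real (Z 2 ⁻¹' {x | u - K < ‖x‖}ᶜ) = 1 - V (u - K) := by
    rw [Set.preimage_compl, probReal_compl_eq_one_sub (hm 2 (measurableSet_norm_gt _)), ← hV 2]; rfl
  rw [h2, show P.real (Z 1 ⁻¹' {x | u < ‖x‖}) = V u from hV 1 u] at h1
  rw [← h1]
  refine measureReal_mono fun ω hω => ?_
  have ha : u < ‖Z 1 ω‖ := hω.1
  have hb : ¬ u - K < ‖Z 2 ω‖ := hω.2
  have hc := norm_sub_norm_le (Z 1 ω) (Z 2 ω)
  change K < ‖Z 1 ω - Z 2 ω‖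
  linarith [not_lt.1 hb]

/-- The normalization of a weak law for a regularly varying law tends to infinity, and
`n P(|Z| > γ_n) → 0`. -/
theorem weakLaw_consequences {V : ℝ → ℝ} (hVt : RVTail V α)
    (hV : ∀ k u, P.real {ω | u < ‖Z k ω‖} = V u)
    (hm : ∀ k, Measurable (Z k)) (hind : iIndepFun Z P) (hid : ∀ k, IdentDistrib (Z k) (Z 0) P P)
    (hγ : ∀ n, 1 ≤ n → 0 < γ n)
    (hT : TendstoInMeasure P
      (fun (n : ℕ) ω => (γ n)⁻¹ • ∑ k ∈ Finset.Icc 1 n, Z (k : ℤ) ω) atTop (fun _ => (0 : Vec p))) :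
    Tendsto γ atTop atTop ∧ Tendsto (fun n : ℕ => (n:ℝ) * V (γ n)) atTop (𝓝 0) := by
  have hsym : ∀ c : ℝ, 0 < c → Tendsto (fun n : ℕ => (n:ℝ) * P.real {ω | c * γ n < ‖Z 1 ω - Z 2 ω‖})
    atTop (𝓝 0) := fun c hc => tendsto_mul_symm_norm_tail hm hind hid hγ hT hc
  have hinf : Tendsto γ atTop atTop := by
    rw [tendsto_atTop]
    by_contra! hcon
    obtain ⟨K, hK⟩ := hcon
    -- Were γ_n ≤ K for infinitely many n, then n P(|Z_1 - Z_2| > K) would be small along these n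
    -- although the probability is a positive constant.
    have hpos : 0 < P.real {ω | K < ‖Z 1 ω - Z 2 ω‖} := by
      have h0 : Tendsto (fun u => V (u - K)) atTop (𝓝 0) :=
        hVt.tendsto_zero.comp (tendsto_atTop_add_const_right _ _ tendsto_id)
      obtain ⟨u, hu⟩ := (h0.eventually (gt_mem_nhds one_pos)).exists
      exact lt_of_lt_of_le (mul_pos (hVt.pos u) (by linarith)) (symm_tail_ge hm hind hV u K)
    have h1 := (hsym 1 one_pos).eventually (gt_mem_nhds hpos)
    obtain ⟨n, hn, h2, h3⟩ := (hK.and_eventually (h1.and (eventually_ge_atTop 1))).exists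
    have h4 : P.real {ω | K < ‖Z 1 ω - Z 2 ω‖} ≤ P.real {ω | 1 * γ n < ‖Z 1 ω - Z 2 ω‖} := by
      refine measureReal_mono fun ω (hω : K < _) => ?_
      change 1 * γ n < _
      linarith
    have h5 : (1:ℝ) ≤ n := by exact_mod_cast h3
    have h6 : 0 ≤ P.real {ω | 1 * γ n < ‖Z 1 ω - Z 2 ω‖} := measureReal_nonneg
    nlinarith
  refine ⟨hinf, ?_⟩
  have h1 : Tendsto (fun n => V (γ n / 2)) atTop (𝓝 0) :=
    hVt.tendsto_zero.comp (hinf.atTop_div_const two_pos)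
  have h2 := (hsym (1 / 2) (by norm_num)).const_mul 2
  rw [mul_zero] at h2
  refine squeeze_zero' (Eventually.of_forall fun n => mul_nonneg (Nat.cast_nonneg n)
    (hVt.pos _).le) ?_ h2
  filter_upwards [h1.eventually (gt_mem_nhds (show (0:ℝ) < 1 / 2 by norm_num))] with n hn
  -- With K = γ_n/2 the second factor is 1 - V(γ_n/2), which is eventually at least 1/2.
  have h3 := symm_tail_ge hm hind hV (γ n) (1 / 2 * γ n)
  rw [show γ n - 1 / 2 * γ n = γ n / 2 by ring] at h3
  have h4 := hVt.pos (γ n)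
  have h5 : V (γ n) ≤ 2 * P.real {ω | 1 / 2 * γ n < ‖Z 1 ω - Z 2 ω‖} := by nlinarith
  have := mul_le_mul_of_nonneg_left h5 (Nat.cast_nonneg (α := ℝ) n)
  linarith

/-- Truncated means under a weak law, for tail index smaller than two. -/
theorem tendsto_truncated_mean {V : ℝ → ℝ} (hVt : RVTail V α) (hα2 : α < 2)
    (hV : ∀ k u, P.real {ω | u < ‖Z k ω‖} = V u)
    (hm : ∀ k, Measurable (Z k)) (hind : iIndepFun Z P) (hid : ∀ k, IdentDistrib (Z k) (Z 0) P P)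
    (hinf : Tendsto γ atTop atTop) (hnV : Tendsto (fun n : ℕ => (n:ℝ) * V (γ n)) atTop (𝓝 0))
    {g : Vec p → ℝ} (hg : Measurable g) (hgn : ∀ z, |g z| ≤ ‖z‖)
    (hS : ∀ e : ℝ, 0 < e → Tendsto
      (fun n : ℕ => P.real {ω | e ≤ |(γ n)⁻¹ * ∑ k ∈ Finset.Icc 1 n, g (Z (k : ℤ) ω)|}) atTop (𝓝 0)) :
    Tendsto (fun n : ℕ => (n:ℝ) / γ n * ∫ ω, (if ‖Z 0 ω‖ ≤ γ n then g (Z 0 ω) else 0) ∂P)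
      atTop (𝓝 0) := by
  obtain ⟨a, haα, ha2⟩ := exists_between hα2
  have ha0 : 0 < a := hVt.index_pos.trans haα
  obtain ⟨C, x₀, hC, hx₀, htm⟩ := (hVt.tailBound (hV 0) haα).trunc_moment hVt.pos (hm 0).norm
    (fun ω => norm_nonneg _) two_pos ha2
  set τ : ℕ → Vec p → ℝ := fun n z => if ‖z‖ ≤ γ n then g z else 0 with hτ
  have hτm : ∀ n, Measurable (τ n) := fun n =>
    Measurable.ite (measurableSet_le measurable_norm measurable_const) hg measurable_const
  have hτb : ∀ n, 0 ≤ γ n → ∀ z, |τ n z| ≤ min ‖z‖ (γ n) := by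
    intro n hn z
    simp only [hτ]
    split_ifs with h
    · exact le_min (hgn z) ((hgn z).trans h)
    · rw [abs_zero]; exact le_min (norm_nonneg _) hn
  rw [Metric.tendsto_atTop]
  intro e he
  have he3 : 0 < e / 3 := by positivity
  have hvar0 : Tendsto (fun n : ℕ => C / (e / 3) ^ 2 * (n * V (γ n))) atTop (𝓝 0) := by
    simpa using hnV.const_mul (C / (e / 3) ^ 2)
  have hall := (hvar0.add ((hS _ he3).add hnV)).eventually
    (gt_mem_nhds (show (0:ℝ) + (0 + 0) < 1 by norm_num))
  refine eventually_atTop.1 ?_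
  filter_upwards [hall, eventually_ge_atTop 1, hinf.eventually_ge_atTop x₀] with n hn hn1 hnx
  have hg0 : 0 < γ n := by linarith
  set b := ∫ ω, τ n (Z 0 ω) ∂P with hb
  have hmem : ∀ k : ℤ, MemLp (fun ω => τ n (Z k ω)) 2 P := fun k =>
    MemLp.of_bound ((hτm n).comp (hm k)).aestronglyMeasurable (γ n)
      (Eventually.of_forall fun ω => (hτb n hg0.le _).trans (min_le_right _ _))
  set T : Ω → ℝ := ∑ k ∈ Finset.Icc 1 n, fun ω => τ n (Z (k : ℤ) ω) with hT
  have hidτ : ∀ k : ℤ, IdentDistrib (fun ω => τ n (Z k ω)) (fun ω => τ n (Z 0 ω)) P P :=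
    fun k => (hid k).comp (hτm n)
  have hTmem : MemLp T 2 P := memLp_finsetSum' _ fun k _ => hmem k
  have hET : ∫ ω, T ω ∂P = n * b := by
    simp only [hT, Finset.sum_apply]
    rw [integral_finsetSum _ fun (k : ℕ) _ => (hmem (k : ℤ)).integrable one_le_two]
    rw [Finset.sum_congr rfl fun (k : ℕ) _ => (hidτ (k : ℤ)).integral_eq]
    simp [hb]
  have hvar : variance T P ≤ n * (C * γ n ^ 2 * V (γ n)) := by
    rw [hT, IndepFun.variance_sum (fun (k : ℕ) _ => hmem (k : ℤ))]
    · rw [Finset.sum_congr rfl fun (k : ℕ) _ => (hidτ (k : ℤ)).variance_eq]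
      simp only [Finset.sum_const, Nat.card_Icc, Nat.add_sub_cancel, nsmul_eq_mul]
      refine mul_le_mul_of_nonneg_left ?_ (Nat.cast_nonneg n)
      refine (variance_le_expectation_sq (hmem 0).aestronglyMeasurable).trans ?_
      have h2 := htm (γ n) hnx
      simp only [Real.rpow_two] at h2
      refine (integral_mono_of_nonneg (Eventually.of_forall fun ω => sq_nonneg _) ?_
        (Eventually.of_forall fun ω => ?_)).trans h2
      · refine (integrable_const (γ n ^ 2)).mono' ?_ (Eventually.of_forall fun ω => ?_)
        · exact (((hm 0).norm.min measurable_const).pow_const 2).aestronglyMeasurable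
        · rw [Real.norm_of_nonneg (sq_nonneg _)]
          exact pow_le_pow_left₀ (le_min (norm_nonneg _) hg0.le) (min_le_right _ _) 2
      · simp only [Pi.pow_apply]
        rw [← sq_abs]
        exact pow_le_pow_left₀ (abs_nonneg _) (hτb n hg0.le _) 2
    · intro i _ j _ hij
      exact (hind.indepFun (by exact_mod_cast hij)).comp (hτm n) (hτm n)
  have hcheb : P.real {ω | e / 3 * γ n ≤ |T ω - n * b|} ≤ C / (e / 3) ^ 2 * (n * V (γ n)) := by
    have h1 := meas_ge_le_variance_div_sq hTmem (c := e / 3 * γ n) (by positivity)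
    rw [hET] at h1
    have h0 : 0 ≤ C / (e / 3) ^ 2 * (n * V (γ n)) := by have := hVt.pos (γ n); positivity
    refine ENNReal.toReal_le_of_le_ofReal h0 (h1.trans (ENNReal.ofReal_le_ofReal ?_))
    rw [div_le_iff₀ (by positivity)]
    refine hvar.trans (le_of_eq ?_)
    field_simp
  have hne : P.real {ω | ∃ k ∈ Finset.Icc 1 n, γ n < ‖Z (k : ℤ) ω‖} ≤ n * V (γ n) := by
    have : {ω | ∃ k ∈ Finset.Icc 1 n, γ n < ‖Z (k : ℤ) ω‖} =
        ⋃ k ∈ Finset.Icc 1 n, {ω | γ n < ‖Z (k : ℤ) ω‖} := by ext; simp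
    rw [this]
    refine (measureReal_biUnion_finset_le _ _).trans (le_of_eq ?_)
    rw [Finset.sum_congr rfl fun (k : ℕ) _ => hV (k : ℤ) (γ n)]
    simp
  rw [Real.dist_eq, sub_zero]
  by_contra hcon
  have hcon' := not_lt.1 hcon
  -- The truncated mean n b is deterministic. If it were at least e γ_n in modulus, every ω would
  -- lie in one of three events: a Chebyshev deviation, a large sum, or a summand that is truncated.
  -- Their total probability is eventually below 1.
  have hcover : (Set.univ : Set Ω) ⊆ {ω | e / 3 * γ n ≤ |T ω - n * b|} ∪
      ({ω | e / 3 ≤ |(γ n)⁻¹ * ∑ k ∈ Finset.Icc 1 n, g (Z (k : ℤ) ω)|} ∪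
        {ω | ∃ k ∈ Finset.Icc 1 n, γ n < ‖Z (k : ℤ) ω‖}) := by
    intro ω _
    by_contra hω
    simp only [Set.mem_union, Set.mem_ofPred_eq, not_or, not_le, not_exists, not_and, not_lt] at hω
    obtain ⟨h1, h2, h3⟩ := hω
    have hTe : T ω = ∑ k ∈ Finset.Icc 1 n, g (Z (k : ℤ) ω) := by
      simp only [hT, Finset.sum_apply]
      exact Finset.sum_congr rfl fun k hk => if_pos (h3 k hk)
    rw [← hTe, abs_mul, abs_inv, abs_of_pos hg0, inv_mul_lt_iff₀ hg0] at h2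
    have h4 : |(n:ℝ) * b| < e * γ n := by
      have := abs_sub_abs_le_abs_sub ((n:ℝ) * b) (T ω)
      rw [abs_sub_comm] at this
      have := mul_pos he hg0
      linarith
    rw [div_mul_eq_mul_div, abs_div, abs_of_pos hg0, le_div_iff₀ hg0] at hcon'
    linarith
  have := (measureReal_mono hcover).trans ((measureReal_union_le _ _).trans
    (add_le_add hcheb ((measureReal_union_le _ _).trans (add_le_add le_rfl hne))))
  rw [probReal_univ] at this
  linarith

end WeakLaw

end RCLP

/-! ### Exponential bounds for truncated m-dependent sums -/

namespace RCLP

variable {Ω : Type*} [MeasurableSpace Ω]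

theorem exp_le_one_add_add_sq {u : ℝ} (hu : u ≤ 1) : Real.exp u ≤ 1 + u + u ^ 2 := by
  rcases le_total (-1) u with h | h
  · have := abs_le.1 (Real.abs_exp_sub_one_sub_id_le (abs_le.2 ⟨h, hu⟩))
    linarith [this.2]
  · have : Real.exp u ≤ 1 := Real.exp_le_one_iff.2 (by linarith)
    nlinarith

/-- A bound for the moment generating function of a bounded variable that separates the values
above and below `1 / h`. -/
theorem mgf_le_exp {P : Measure Ω} [IsProbabilityMeasure P] {ξ : Ω → ℝ} (hm : Measurable ξ) {b h : ℝ}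
    (hb : ∀ ω, |ξ ω| ≤ b) (hh : 0 < h) :
    mgf ξ P h ≤ Real.exp (h * |∫ ω, ξ ω ∂P| + h ^ 2 * ∫ ω, ξ ω ^ 2 ∂P +
      Real.exp (h * b) * P.real {ω | 1 / h < |ξ ω|}) := by
  have hms : MeasurableSet {ω | 1 / h < |ξ ω|} := measurableSet_lt measurable_const hm.abs
  have hi1 : Integrable ξ P := (integrable_const b).mono' hm.aestronglyMeasurable
    (Eventually.of_forall hb)
  have hi2 : Integrable (fun ω => ξ ω ^ 2) P :=
    (integrable_const (b ^ 2)).mono' (hm.pow_const 2).aestronglyMeasurable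
      (Eventually.of_forall fun ω => by
        rw [Real.norm_of_nonneg (sq_nonneg _), ← sq_abs]
        exact pow_le_pow_left₀ (abs_nonneg _) (hb ω) 2)
  have hi3 : Integrable (Set.indicator {ω | 1 / h < |ξ ω|} (fun _ => Real.exp (h * b))) P :=
    (integrable_const _).indicator hms
  have hpt : ∀ ω, Real.exp (h * ξ ω) ≤ (1 + h * ξ ω + h ^ 2 * ξ ω ^ 2) +
      Set.indicator {ω | 1 / h < |ξ ω|} (fun _ => Real.exp (h * b)) ω := by
    intro ω
    by_cases hω : 1 / h < |ξ ω|
    · rw [Set.indicator_of_mem (by exact hω)]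
      have h1 : Real.exp (h * ξ ω) ≤ Real.exp (h * b) :=
        Real.exp_le_exp.2 (mul_le_mul_of_nonneg_left ((le_abs_self _).trans (hb ω)) hh.le)
      nlinarith [sq_nonneg (1 + h * ξ ω), sq_nonneg (h * ξ ω)]
    · rw [Set.indicator_of_notMem (by exact hω), add_zero]
      have h1 : h * ξ ω ≤ 1 := by
        have := (le_abs_self _).trans (not_lt.1 hω)
        rw [le_div_iff₀ hh] at this
        linarith
      refine (exp_le_one_add_add_sq h1).trans (le_of_eq (by ring))
  have hi4 : Integrable (fun ω => 1 + h * ξ ω + h ^ 2 * ξ ω ^ 2) P :=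
    ((integrable_const 1).add (hi1.const_mul h)).add (hi2.const_mul (h ^ 2))
  have hi5 : Integrable (fun ω => 1 + h * ξ ω) P := (integrable_const 1).add (hi1.const_mul h)
  have h1 : mgf ξ P h ≤ 1 + h * ∫ ω, ξ ω ∂P + h ^ 2 * ∫ ω, ξ ω ^ 2 ∂P +
      Real.exp (h * b) * P.real {ω | 1 / h < |ξ ω|} := by
    refine (integral_mono_of_nonneg (Eventually.of_forall fun ω => (Real.exp_pos _).le)
      (hi4.add hi3) (Eventually.of_forall hpt)).trans (le_of_eq ?_)
    simp only [Pi.add_apply]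
    rw [integral_add hi4 hi3, integral_indicator_const _ hms,
      integral_add hi5 (hi2.const_mul (h ^ 2)),
      integral_add (integrable_const 1) (hi1.const_mul h), integral_const_mul, integral_const_mul]
    simp [mul_comm]
  refine h1.trans (le_trans ?_ (Real.add_one_le_exp _))
  have := mul_le_mul_of_nonneg_left (le_abs_self (∫ ω, ξ ω ∂P)) hh.le
  linarith

/-- Chernoff's inequality with the bound of `mgf_le_exp` for each factor. That exponent is
nonnegative, so an upper bound N for the number of summands is enough, and all residue classes can
share N = n. -/
theorem sum_gt_le_exp {P : Measure Ω} [IsProbabilityMeasure P] {ι : Type*} {ξ : ι → Ω → ℝ}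
    {ξ₀ : Ω → ℝ} (hm : ∀ k, Measurable (ξ k)) (hm₀ : Measurable ξ₀) (hind : iIndepFun ξ P)
    (hid : ∀ k, IdentDistrib (ξ k) ξ₀ P P) {b h : ℝ} (hb : ∀ k ω, |ξ k ω| ≤ b)
    (hb₀ : ∀ ω, |ξ₀ ω| ≤ b) (hh : 0 < h)
    (s : Finset ι) {N : ℝ} (hs : s.card ≤ N) (x : ℝ) :
    P.real {ω | x < ∑ k ∈ s, ξ k ω} ≤ Real.exp (-(h * x) + N * (h * |∫ ω, ξ₀ ω ∂P| +
      h ^ 2 * ∫ ω, ξ₀ ω ^ 2 ∂P + Real.exp (h * b) * P.real {ω | 1 / h < |ξ₀ ω|})) := by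
  set Q := h * |∫ ω, ξ₀ ω ∂P| + h ^ 2 * ∫ ω, ξ₀ ω ^ 2 ∂P +
    Real.exp (h * b) * P.real {ω | 1 / h < |ξ₀ ω|} with hQ
  have hQ0 : 0 ≤ Q := by
    have : 0 ≤ ∫ ω, ξ₀ ω ^ 2 ∂P := integral_nonneg fun ω => sq_nonneg _
    positivity
  have hmg : mgf ξ₀ P h ≤ Real.exp Q := mgf_le_exp hm₀ hb₀ hh
  have hsum : mgf (∑ k ∈ s, ξ k) P h ≤ Real.exp (N * Q) := by
    rw [hind.mgf_sum hm]
    have : ∀ k ∈ s, mgf (ξ k) P h = mgf ξ₀ P h := fun k _ => by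
      rw [mgf_congr_identDistrib (hid k)]
    rw [Finset.prod_congr rfl this, Finset.prod_const]
    refine (pow_le_pow_left₀ mgf_nonneg hmg _).trans ?_
    rw [← Real.exp_nat_mul]
    exact Real.exp_le_exp.2 (mul_le_mul_of_nonneg_right hs hQ0)
  have hint : Integrable (fun ω => Real.exp (h * (∑ k ∈ s, ξ k) ω)) P := by
    have hms : Measurable (∑ k ∈ s, ξ k) := by
      rw [Finset.sum_fn]; exact Finset.measurable_sum _ fun k _ => hm k
    refine (integrable_const (Real.exp (h * (s.card * b)))).mono' (by fun_prop)
      (Eventually.of_forall fun ω => ?_)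
    rw [Real.norm_of_nonneg (Real.exp_pos _).le]
    refine Real.exp_le_exp.2 (mul_le_mul_of_nonneg_left ?_ hh.le)
    rw [Finset.sum_apply, ← nsmul_eq_mul]
    exact Finset.sum_le_card_nsmul _ _ _ fun k _ => (le_abs_self _).trans (hb k ω)
  have h1 := measure_ge_le_exp_mul_mgf (μ := P) x hh.le hint
  rw [Real.exp_add, ← neg_mul]
  refine le_trans (measureReal_mono fun ω hω => ?_)
    (h1.trans (mul_le_mul_of_nonneg_left hsum (Real.exp_pos _).le))
  have : x < ∑ k ∈ s, ξ k ω := hω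
  simpa using this.le

/-- Summation within a class runs over the subtype because independence is available for the family
indexed by that subtype. -/
theorem sum_Icc_eq_sum_residues {m : ℕ} (hm : 0 < m) (n : ℕ) {E : Type*} [AddCommMonoid E]
    (f : ℤ → E) :
    ∑ k ∈ Finset.Icc 1 n, f (k : ℤ) = ∑ c ∈ Finset.range m,
      ∑ k ∈ (Finset.Icc (1:ℤ) n).subtype (fun k => k % (m:ℤ) = (c : ℤ)), f k := by
  have hm' : (m:ℤ) ≠ 0 := by exact_mod_cast hm.ne'
  have h1 : ∑ k ∈ Finset.Icc 1 n, f (k : ℤ) = ∑ k ∈ Finset.Icc (1:ℤ) n, f k := by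
    refine Finset.sum_nbij (fun k : ℕ => (k : ℤ)) ?_ ?_ ?_ fun _ _ => rfl
    · intro k hk; simp at hk ⊢; omega
    · intro a _ b _ hab; exact Int.ofNat.inj hab
    · intro k hk
      simp only [Finset.coe_Icc, Set.mem_Icc] at hk
      exact ⟨k.toNat, by simp; omega, by simp; omega⟩
  rw [h1, ← Finset.sum_fiberwise_of_maps_to (t := Finset.range m) (g := fun k : ℤ => (k % m).toNat)]
  · refine Finset.sum_congr rfl fun c _ => ?_
    rw [Finset.sum_subtype_eq_sum_filter]
    refine Finset.sum_congr (Finset.filter_congr fun k _ => ?_) fun _ _ => rfl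
    have := Int.emod_nonneg k hm'
    omega
  · intro k _
    have h2 := Int.emod_nonneg k hm'
    have h3 := Int.emod_lt_of_pos k (show (0:ℤ) < m by exact_mod_cast hm)
    simp; omega

/-- Large deviations of sums of truncated `m`-dependent variables are negligible when the
truncation level is small compared to the deviation. -/
theorem tendsto_truncated_sum {P : Measure Ω} [IsProbabilityMeasure P] {ξ : ℕ → ℤ → Ω → ℝ}
    {V : ℝ → ℝ} {γ : ℕ → ℝ} {m : ℕ} (hm : 0 < m)
    (hmeas : ∀ n k, Measurable (ξ n k))
    (hind : ∀ n, ∀ c : ℤ, iIndepFun (fun k : {k : ℤ // k % (m : ℤ) = c} => ξ n k) P)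
    (hid : ∀ n k, IdentDistrib (ξ n k) (ξ n 0) P P)
    (hV : ∀ u, 0 < V u) (hγ : Tendsto γ atTop atTop)
    (hnV : Tendsto (fun n : ℕ => (n:ℝ) * V (γ n)) atTop (𝓝 0))
    {y δ : ℝ} (hδ : 0 < δ) (hy : 4 * m * y ≤ δ)
    (hbd : ∀ᶠ n in atTop, ∀ k ω, |ξ n k ω| ≤ y * γ n)
    (hmean : Tendsto (fun n : ℕ => (n:ℝ) / γ n * ∫ ω, ξ n 0 ω ∂P) atTop (𝓝 0))
    (hsq : Tendsto (fun n : ℕ => -Real.log (n * V (γ n)) *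
      ((n:ℝ) / γ n ^ 2 * ∫ ω, ξ n 0 ω ^ 2 ∂P)) atTop (𝓝 0))
    {C a : ℝ} (htail : ∀ᶠ n in atTop, ∀ s, 1 ≤ s →
      P.real {ω | γ n / s < |ξ n 0 ω|} ≤ C * s ^ a * V (γ n)) :
    Tendsto (fun n : ℕ => 1 / (n * V (γ n)) *
      P.real {ω | γ n * δ < ∑ k ∈ Finset.Icc 1 n, ξ n (k : ℤ) ω}) atTop (𝓝 0) := by
  have hm0 : (0:ℝ) < m := by exact_mod_cast hm
  set L : ℕ → ℝ := fun n => -Real.log (n * V (γ n)) with hL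
  have hv0 : ∀ n : ℕ, 1 ≤ n → 0 < (n:ℝ) * V (γ n) := fun n hn =>
    mul_pos (by exact_mod_cast hn) (hV _)
  have hLinf : Tendsto L atTop atTop := by
    refine tendsto_neg_atBot_atTop.comp (Real.tendsto_log_nhdsGT_zero.comp ?_)
    exact tendsto_nhdsWithin_iff.2 ⟨hnV, (eventually_ge_atTop 1).mono fun n hn => hv0 n hn⟩
  -- With h = κ L / γ this gives h (γδ/m) = 2L, and 4my ≤ δ becomes h y γ ≤ L/2.
  set κ : ℝ := 2 * m / δ with hκ
  have hκ0 : 0 < κ := by positivity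
  have hQ : Tendsto (fun n => C * (κ * L n) ^ a * Real.exp (-(L n / 2))) atTop (𝓝 0) := by
    have h1 : Tendsto (fun x : ℝ => C * κ ^ a * (x ^ a * Real.exp (-(1 / 2) * x))) atTop
        (𝓝 (C * κ ^ a * 0)) :=
      (tendsto_rpow_mul_exp_neg_mul_atTop_nhds_zero a (1 / 2) (by norm_num)).const_mul _
    rw [mul_zero] at h1
    refine (h1.comp hLinf).congr' ?_
    filter_upwards [hLinf.eventually_ge_atTop 0] with n hn
    simp only [Function.comp]
    rw [Real.mul_rpow hκ0.le hn, show -(1 / 2) * L n = -(L n / 2) by ring]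
    ring
  have hmean' : Tendsto (fun n : ℕ => κ * |(n:ℝ) / γ n * ∫ ω, ξ n 0 ω ∂P|) atTop (𝓝 0) := by
    simpa using hmean.abs.const_mul κ
  have hsq' := hsq.const_mul (κ ^ 2)
  rw [mul_zero] at hsq'
  have hfin : Tendsto (fun n => m * Real.exp (-(L n / 2))) atTop (𝓝 0) := by
    have := (Real.tendsto_exp_neg_atTop_nhds_zero.comp (hLinf.atTop_div_const two_pos)).const_mul
      (m:ℝ)
    simpa using this
  refine squeeze_zero' ?_ ?_ hfin
  · filter_upwards [eventually_ge_atTop 1] with n hn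
    have := hv0 n hn
    positivity
  -- The mean, the square and the large-value term each contribute at most L/8, so the exponent is
  -- at most -2L + 3L/8 ≤ -3L/2. This beats the normalization exp(L) with exp(-L/2) to spare.
  filter_upwards [eventually_ge_atTop 1, hbd, htail, hγ.eventually_gt_atTop 0,
    hLinf.eventually_ge_atTop 8, hLinf.eventually_ge_atTop (1 / κ),
    hQ.eventually (gt_mem_nhds one_pos),
    hmean'.eventually (gt_mem_nhds (show (0:ℝ) < 1 / 8 by norm_num)),
    hsq'.eventually (gt_mem_nhds (show (0:ℝ) < 1 / 8 by norm_num))]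
    with n hn hbd htail hg hL8 hLκ hQ hmean hsq
  have hL0 : 0 < L n := by linarith
  have hn0 : (0:ℝ) < n := by exact_mod_cast hn
  set h := κ * L n / γ n with hh
  have hhpos : 0 < h := by positivity
  have hLexp : (n:ℝ) * V (γ n) = Real.exp (-(L n)) := by
    simp only [hL]; rw [neg_neg, Real.exp_log (hv0 n hn)]
  have hhx : h * (γ n * δ / m) = 2 * L n := by
    rw [hh, hκ]; field_simp
  have hhb : h * (y * γ n) ≤ L n / 2 := by
    have : h * (y * γ n) = κ * y * L n := by rw [hh]; field_simp
    rw [this]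
    have h2 : κ * y ≤ 1 / 2 := by
      rw [hκ, div_mul_eq_mul_div, div_le_iff₀ hδ]; linarith
    nlinarith
  have t1 : n * (h * |∫ ω, ξ n 0 ω ∂P|) ≤ L n / 8 := by
    have : n * (h * |∫ ω, ξ n 0 ω ∂P|) = L n * (κ * |(n:ℝ) / γ n * ∫ ω, ξ n 0 ω ∂P|) := by
      rw [abs_mul, abs_of_pos (div_pos hn0 hg), hh]; field_simp
    rw [this]; nlinarith
  have t2 : n * (h ^ 2 * ∫ ω, ξ n 0 ω ^ 2 ∂P) ≤ L n / 8 := by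
    have : n * (h ^ 2 * ∫ ω, ξ n 0 ω ^ 2 ∂P) =
        L n * (κ ^ 2 * (L n * ((n:ℝ) / γ n ^ 2 * ∫ ω, ξ n 0 ω ^ 2 ∂P))) := by
      rw [hh]; field_simp
    rw [this]; nlinarith
  have t3 : n * (Real.exp (h * (y * γ n)) * P.real {ω | 1 / h < |ξ n 0 ω|}) ≤ L n / 8 := by
    -- The level 1/h is γ_n divided by κL, so the tail bound costs only a power of L, against a gain
    -- of exp(-L/2).
    have h1 := htail (κ * L n) (by rw [div_le_iff₀ hκ0] at hLκ; linarith)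
    have h2 : γ n / (κ * L n) = 1 / h := by rw [hh]; field_simp
    rw [h2] at h1
    have h3 : Real.exp (h * (y * γ n)) ≤ Real.exp (L n / 2) := Real.exp_le_exp.2 hhb
    have h4 : n * (Real.exp (h * (y * γ n)) * P.real {ω | 1 / h < |ξ n 0 ω|}) ≤
        n * (Real.exp (L n / 2) * (C * (κ * L n) ^ a * V (γ n))) := by gcongr
    have h5 : n * (Real.exp (L n / 2) * (C * (κ * L n) ^ a * V (γ n))) =
        C * (κ * L n) ^ a * Real.exp (-(L n / 2)) := by
      have : Real.exp (-(L n / 2)) = Real.exp (L n / 2) * (n * V (γ n)) := by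
        rw [hLexp, ← Real.exp_add]; congr 1; ring
      rw [this]; ring
    linarith
  have hclass : ∀ c ∈ Finset.range m, P.real {ω | γ n * δ / m <
      ∑ k ∈ (Finset.Icc (1:ℤ) n).subtype (fun k => k % (m:ℤ) = (c : ℤ)), ξ n k ω} ≤
      Real.exp (-(3 / 2 * L n)) := by
    intro c _
    refine (sum_gt_le_exp (ξ := fun k : {k : ℤ // k % (m : ℤ) = c} => ξ n k)
      (fun k => hmeas n k) (hmeas n 0) (hind n c) (fun k => hid n k)
      (fun k ω => hbd k ω) (fun ω => hbd 0 ω) hhpos _ (N := n) ?_ _).trans ?_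
    · rw [Finset.card_subtype]
      exact_mod_cast (Finset.card_filter_le _ _).trans (by simp)
    · refine Real.exp_le_exp.2 ?_
      rw [hhx, mul_add, mul_add]
      linarith
  have hunion : P.real {ω | γ n * δ < ∑ k ∈ Finset.Icc 1 n, ξ n (k : ℤ) ω} ≤
      m * Real.exp (-(3 / 2 * L n)) := by
    have hsub : {ω | γ n * δ < ∑ k ∈ Finset.Icc 1 n, ξ n (k : ℤ) ω} ⊆
        ⋃ c ∈ Finset.range m, {ω | γ n * δ / m <
          ∑ k ∈ (Finset.Icc (1:ℤ) n).subtype (fun k => k % (m:ℤ) = (c : ℤ)), ξ n k ω} := by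
      intro ω hω
      have hω' : γ n * δ < ∑ k ∈ Finset.Icc 1 n, ξ n (k : ℤ) ω := hω
      rw [sum_Icc_eq_sum_residues hm n (fun k => ξ n k ω)] at hω'
      by_contra hcon
      simp only [Set.mem_iUnion, Set.mem_ofPred_eq, not_exists, not_lt] at hcon
      have := Finset.sum_le_sum fun c hc => hcon c hc
      rw [Finset.sum_const, Finset.card_range, nsmul_eq_mul, mul_div_cancel₀ _ hm0.ne'] at this
      linarith
    refine (measureReal_mono hsub (measure_ne_top _ _)).trans ((measureReal_biUnion_finset_le _ _).trans
      ((Finset.sum_le_sum hclass).trans (le_of_eq ?_)))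
    simp
  rw [hLexp]
  calc 1 / Real.exp (-(L n)) * P.real {ω | γ n * δ < ∑ k ∈ Finset.Icc 1 n, ξ n (k : ℤ) ω}
      ≤ 1 / Real.exp (-(L n)) * (m * Real.exp (-(3 / 2 * L n))) := by gcongr
    _ = m * Real.exp (-(L n / 2)) := by
        rw [one_div, ← Real.exp_neg, neg_neg, mul_left_comm, ← Real.exp_add]
        congr 2; ring

end RCLP

/-! ### Independence of blocks and of windows of an i.i.d. sequence -/

namespace RCLP

variable {Ω : Type*} [MeasurableSpace Ω]

/-- Disjoint blocks of independent variables are independent. -/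
theorem iIndepFun_blocks {P : Measure Ω} [IsProbabilityMeasure P] {ι κ 𝒳 : Type*}
    [MeasurableSpace 𝒳] {X : ι → κ → Ω → 𝒳} (hX : ∀ i j, Measurable (X i j))
    (h : iIndepFun (fun p : ι × κ => X p.1 p.2) P) : iIndepFun (fun i ω j => X i j ω) P := by
  have h1 := (iIndepFun_iff_map_fun_eq_infinitePi_map (fun p : ι × κ => hX p.1 p.2)).1 h
  have hp : ∀ i j, IsProbabilityMeasure (P.map (X i j)) := fun i j =>
    Measure.isProbabilityMeasure_map (hX i j).aemeasurable
  rw [iIndepFun_iff_map_fun_eq_infinitePi_map (fun i => measurable_pi_iff.2 fun j => hX i j)]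
  have h2 : ∀ i, P.map (fun ω j => X i j ω) = Measure.infinitePi fun j => P.map (X i j) := fun i =>
    (iIndepFun_iff_map_fun_eq_infinitePi_map (fun j => hX i j)).1
      (h.precomp (g := fun j : κ => (i, j)) fun a b hab => (Prod.mk.inj hab).2)
  simp_rw [h2]
  rw [← Measure.infinitePi_map_curry (fun i j => P.map (X i j)), ← h1,
    Measure.map_map (by fun_prop) (measurable_pi_iff.2 fun p : ι × κ => hX p.1 p.2)]
  rfl

theorem iIndepFun_bool {P : Measure Ω} [IsProbabilityMeasure P] {𝒳 : Type*} [MeasurableSpace 𝒳]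
    {X : Bool → Ω → 𝒳} (h : IndepFun (X false) (X true) P) : iIndepFun X P := by
  rw [iIndepFun_iff_measure_inter_preimage_eq_mul]
  intro S s hs
  have h0 := indepFun_iff_measure_inter_preimage_eq_mul.1 h
  classical
  by_cases hf : false ∈ S <;> by_cases ht : true ∈ S
  · have : S = {false, true} := by ext b; cases b <;> simp [hf, ht]
    subst this
    have e : (⋂ i ∈ ({false, true} : Finset Bool), X i ⁻¹' s i) =
        X false ⁻¹' s false ∩ X true ⁻¹' s true := by
      ext ω; simp
    rw [e, h0 _ _ (hs false hf) (hs true ht)]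
    simp
  · have : S = {false} := by ext b; cases b <;> simp [hf, ht]
    subst this; simp
  · have : S = {true} := by ext b; cases b <;> simp [hf, ht]
    subst this; simp
  · have : S = ∅ := by ext b; cases b <;> simp [hf, ht]
    subst this; simp

/-- Two independent sequences of independent variables form an independent sequence of pairs. -/
theorem iIndepFun_prodMk {P : Measure Ω} [IsProbabilityMeasure P] {ι 𝒳 𝒴 : Type*}
    [MeasurableSpace 𝒳] [MeasurableSpace 𝒴] [Inhabited 𝒳] [Inhabited 𝒴]
    {A : ι → Ω → 𝒳} {Z : ι → Ω → 𝒴} (hA : ∀ i, Measurable (A i)) (hZ : ∀ i, Measurable (Z i))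
    (hAi : iIndepFun A P) (hZi : iIndepFun Z P)
    (hAZ : IndepFun (fun ω i => A i ω) (fun ω i => Z i ω) P) :
    iIndepFun (fun i ω => (A i ω, Z i ω)) P := by
  -- Padding with default values gives both sequences the same value type. They then form one
  -- independent family over `Bool × ι`, which can be regrouped by i.
  set X : Bool → ι → Ω → 𝒳 × 𝒴 := fun b i ω =>
    if b then ((default : 𝒳), Z i ω) else (A i ω, (default : 𝒴)) with hX
  have hXm : ∀ b i, Measurable (X b i) := by
    intro b i
    cases b
    · simpa [hX] using (hA i).prodMk measurable_const
    · simpa [hX] using measurable_const.prodMk (hZ i)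
  have h1 : iIndepFun (fun b ω => (X b · ω)) P := by
    refine iIndepFun_bool ?_
    exact hAZ.comp (φ := fun a i => (a i, (default : 𝒴))) (ψ := fun z i => ((default : 𝒳), z i))
      (by fun_prop) (by fun_prop)
  have h2 : ∀ b, iIndepFun (X b) P := by
    intro b
    cases b
    · exact hAi.comp (fun _ a => (a, (default : 𝒴))) fun _ => by fun_prop
    · exact hZi.comp (fun _ z => ((default : 𝒳), z)) fun _ => by fun_prop
  have h3 := iIndepFun_uncurry' hXm h1 h2
  have h4 : iIndepFun (fun p : ι × Bool => X p.2 p.1) P :=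
    h3.precomp (g := fun p : ι × Bool => (p.2, p.1)) Prod.swap_injective
  have h5 := iIndepFun_blocks (X := fun i b => X b i) (fun i b => hXm b i) h4
  exact h5.comp (fun _ x => ((x false).1, (x true).2)) fun _ => by fun_prop

section Window

variable {P : Measure Ω} [IsProbabilityMeasure P] {𝒰 E : Type*} [MeasurableSpace 𝒰]
  [MeasurableSpace E] {U : ℤ → Ω → 𝒰} {H : (ℤ → 𝒰) → E}

/-- Every shift of an i.i.d. sequence has the same product law, so any measurable functional of the
shifted sequence is stationary in k. -/
theorem identDistrib_shift (hU : ∀ k, Measurable (U k)) (hind : iIndepFun U P)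
    (hid : ∀ k, IdentDistrib (U k) (U 0) P P) (hH : Measurable H) (k : ℤ) :
    IdentDistrib (fun ω => H (fun i => U (k + i) ω)) (fun ω => H (fun i => U (0 + i) ω)) P P := by
  have hlaw : ∀ k : ℤ, P.map (fun ω i => U (k + i) ω) =
      Measure.infinitePi fun _ : ℤ => P.map (U 0) := by
    intro k
    have h1 : iIndepFun (fun i => U (k + i)) P := hind.precomp (add_right_injective k)
    rw [(iIndepFun_iff_map_fun_eq_infinitePi_map (fun i => hU (k + i))).1 h1]
    congr 1
    ext1 i
    exact (hid (k + i)).map_eq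
  have hm : ∀ k : ℤ, Measurable fun ω i => U (k + i) ω := fun k =>
    measurable_pi_iff.2 fun i => hU (k + i)
  exact IdentDistrib.comp (f := fun ω i => U (k + i) ω) (g := fun ω i => U (0 + i) ω)
    ⟨(hm k).aemeasurable, (hm 0).aemeasurable, by rw [hlaw, hlaw]⟩ hH

/-- Distinct indices in one class modulo 2M + 1 are at least 2M + 1 apart, so their windows of
radius M are disjoint blocks of the sequence. -/
theorem iIndepFun_shift_residue [Inhabited 𝒰] (hU : ∀ k, Measurable (U k)) (hind : iIndepFun U P)
    (hH : Measurable H) (M : ℕ)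
    (hdep : ∀ x y : ℤ → 𝒰, (∀ j, |j| ≤ (M:ℤ) → x j = y j) → H x = H y) (c : ℤ) :
    iIndepFun (fun (k : {k : ℤ // k % ((2 * M + 1 : ℕ) : ℤ) = c}) ω => H (fun i => U (k + i) ω)) P := by
  set κ := {k : ℤ // k % ((2 * M + 1 : ℕ) : ℤ) = c}
  set J := {j : ℤ // |j| ≤ (M:ℤ)}
  have hinj : Function.Injective fun p : κ × J => (p.1 : ℤ) + p.2 := by
    rintro ⟨⟨k, hk⟩, ⟨j, hj⟩⟩ ⟨⟨k', hk'⟩, ⟨j', hj'⟩⟩ h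
    simp only at h
    rw [abs_le] at hj hj'
    have h1 : ((2 * M + 1 : ℕ) : ℤ) ∣ k - k' := by
      refine Int.ModEq.dvd (Eq.symm ?_)
      rw [hk, hk']
    obtain ⟨q, hq⟩ := h1
    have h2 : q = 0 := by
      push_cast at hq
      have ha : |q| < 1 := by
        by_contra hcon
        rcases abs_cases q with ⟨e, _⟩ | ⟨e, _⟩ <;> rw [e] at hcon <;> nlinarith
      rcases abs_lt.1 ha with ⟨_, _⟩; omega
    rw [h2, mul_zero] at hq
    have h3 : k = k' := by omega
    have h4 : j = j' := by omega
    subst h3; subst h4; rfl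
  have h1 : iIndepFun (fun p : κ × J => U (p.1 + p.2)) P := hind.precomp hinj
  have h2 := iIndepFun_blocks (X := fun (k : κ) (j : J) => U (k + j)) (fun k j => hU _) h1
  classical
  -- Values off the window are irrelevant to H, so filling them with a constant turns H into a
  -- function of the block.
  set ext : (J → 𝒰) → ℤ → 𝒰 := fun x i => if h : |i| ≤ (M:ℤ) then x ⟨i, h⟩ else default with hext
  have hextm : Measurable ext := by
    refine measurable_pi_iff.2 fun i => ?_
    by_cases h : |i| ≤ (M:ℤ)
    · simpa [hext, h] using measurable_pi_apply (⟨i, h⟩ : J)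
    · simp [hext, h]
  have h3 := h2.comp (fun _ x => H (ext x)) fun _ => hH.comp hextm
  convert h3 using 2 with k
  ext ω
  refine hdep _ _ fun j hj => ?_
  simp [hext, hj]

end Window

end RCLP

/-! ### Stability of tail bounds, and truncated second moments -/

namespace RCLP

variable {Ω : Type*} [MeasurableSpace Ω]

/-- Multiplication by an independent factor with a finite moment preserves power type tail
bounds. -/
theorem tail_mul_le {P : Measure Ω} [IsProbabilityMeasure P] {m R : Ω → ℝ} (hm : Measurable m)
    (hR : Measurable R) (hmR : IndepFun m R P) (hm1 : ∀ ω, 1 ≤ m ω) {a x D K : ℝ}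
    (hD : 0 ≤ D) (hK : 0 ≤ K) (hint : ∫⁻ ω, ENNReal.ofReal (m ω ^ a) ∂P ≤ ENNReal.ofReal K)
    (hx : ∀ s, 1 ≤ s → P.real {ω | x / s < R ω} ≤ D * s ^ a) {s : ℝ} (hs : 1 ≤ s) :
    P.real {ω | x / s < m ω * R ω} ≤ D * s ^ a * K := by
  have hs0 : 0 < s := by linarith
  have hS : MeasurableSet {q : ℝ × ℝ | x / s < q.1 * q.2} :=
    measurableSet_lt measurable_const (by fun_prop)
  have h1 : P {ω | x / s < m ω * R ω} = ∫⁻ ω, P {ω' | x / s < m ω * R ω'} ∂P := by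
    have e : P {ω | x / s < m ω * R ω} = P.map (fun ω => (m ω, R ω)) {q : ℝ × ℝ | x / s < q.1 * q.2} := by
      rw [Measure.map_apply (by fun_prop) hS]; rfl
    rw [e, (indepFun_iff_map_prod_eq_prod_map_map hm.aemeasurable hR.aemeasurable).1 hmR,
      Measure.prod_apply hS, lintegral_map (measurable_measure_prodMk_left hS) hm]
    refine lintegral_congr fun ω => ?_
    rw [Measure.map_apply hR (measurable_prodMk_left hS)]
    rfl
  have h2 : P {ω | x / s < m ω * R ω} ≤ ENNReal.ofReal (D * s ^ a * K) := by
    rw [h1, ENNReal.ofReal_mul (by positivity)]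
    refine le_trans (lintegral_mono (g := fun ω => ENNReal.ofReal (D * s ^ a) *
      ENNReal.ofReal (m ω ^ a)) fun ω => ?_) ?_
    · have hmω : 0 < m ω := by linarith [hm1 ω]
      -- With m frozen, the event reads R > x/(s m). The condition m ≥ 1 keeps s m in the admissible
      -- range, and the extra factor m^a integrates to at most K.
      have h3 := hx (s * m ω) (by nlinarith [hm1 ω])
      have e : {ω' | x / s < m ω * R ω'} = {ω' | x / (s * m ω) < R ω'} := by
        ext ω'
        change x / s < m ω * R ω' ↔ x / (s * m ω) < R ω'
        rw [← div_div, div_lt_iff₀ hmω, mul_comm]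
      change P {ω' | x / s < m ω * R ω'} ≤ ENNReal.ofReal (D * s ^ a) * ENNReal.ofReal (m ω ^ a)
      rw [e, ← ENNReal.ofReal_mul (by positivity), mul_assoc, ← Real.mul_rpow hs0.le hmω.le]
      exact (ENNReal.le_ofReal_iff_toReal_le (measure_ne_top _ _)
        (measureReal_nonneg.trans h3)).2 h3
    · rw [lintegral_const_mul' _ _ ENNReal.ofReal_ne_top]
      exact mul_le_mul_right hint _
  exact ENNReal.toReal_le_of_le_ofReal (by positivity) h2

theorem TailBound.indep_mul {P : Measure Ω} [IsProbabilityMeasure P] {V : ℝ → ℝ} {a : ℝ}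
    {m R : Ω → ℝ} (hV : ∀ u, 0 < V u) (h : TailBound P V a R) (hm : Measurable m)
    (hR : Measurable R) (hmR : IndepFun m R P) (hm1 : ∀ ω, 1 ≤ m ω)
    (hint : ∫⁻ ω, ENNReal.ofReal (m ω ^ a) ∂P < ∞) : TailBound P V a (fun ω => m ω * R ω) := by
  obtain ⟨C, x₀, hC, hx₀, h⟩ := h
  set K := max 1 (∫⁻ ω, ENNReal.ofReal (m ω ^ a) ∂P).toReal with hK
  have hK1 : 1 ≤ K := le_max_left _ _
  refine ⟨C * K, x₀, by nlinarith, hx₀, fun x hx s hs => ?_⟩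
  have hVx := hV x
  have := tail_mul_le hm hR hmR hm1 (a := a) (x := x) (D := C * V x) (K := K) (by positivity)
    (by positivity) (by
      rw [← ENNReal.ofReal_toReal hint.ne]
      exact ENNReal.ofReal_le_ofReal (le_max_right _ _))
    (fun s hs => (h x hx s hs).trans (le_of_eq (by ring))) hs
  exact this.trans (le_of_eq (by ring))

theorem TailBound.mono {P : Measure Ω} [IsProbabilityMeasure P] {V : ℝ → ℝ} {a : ℝ} {R R' : Ω → ℝ}
    (h : TailBound P V a R) (hR : ∀ᵐ ω ∂P, R' ω ≤ R ω) : TailBound P V a R' := by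
  obtain ⟨C, x₀, hC, hx₀, h⟩ := h
  refine ⟨C, x₀, hC, hx₀, fun x hx s hs => le_trans ?_ (h x hx s hs)⟩
  refine ENNReal.toReal_mono (measure_ne_top _ _) (measure_mono_ae ?_)
  filter_upwards [hR] with ω hω h1
  exact lt_of_lt_of_le h1 hω

theorem TailBound.exponent_mono {P : Measure Ω} {V : ℝ → ℝ} {a a' : ℝ} {R : Ω → ℝ}
    (hV : ∀ u, 0 < V u) (h : TailBound P V a R) (haa : a ≤ a') : TailBound P V a' R := by
  obtain ⟨C, x₀, hC, hx₀, h⟩ := h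
  refine ⟨C, x₀, hC, hx₀, fun x hx s hs => (h x hx s hs).trans ?_⟩
  have := hV x
  have := Real.rpow_le_rpow_of_exponent_le hs haa
  gcongr

theorem TailBound.add {P : Measure Ω} [IsProbabilityMeasure P] {V : ℝ → ℝ} {a : ℝ} {R R' : Ω → ℝ}
    (ha : 0 ≤ a) (h : TailBound P V a R) (h' : TailBound P V a R') :
    TailBound P V a (fun ω => R ω + R' ω) := by
  obtain ⟨C, x₀, hC, hx₀, h⟩ := h
  obtain ⟨C', x₀', hC', hx₀', h'⟩ := h'
  have h2 : 1 ≤ (2:ℝ) ^ a := Real.one_le_rpow (by norm_num) ha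
  refine ⟨2 ^ a * (C + C'), max x₀ x₀', by nlinarith, hx₀.trans (le_max_left _ _),
    fun x hx s hs => ?_⟩
  have h3 := h x ((le_max_left _ _).trans hx) (2 * s) (by linarith)
  have h4 := h' x ((le_max_right _ _).trans hx) (2 * s) (by linarith)
  have hsub : {ω | x / s < R ω + R' ω} ⊆ {ω | x / (2 * s) < R ω} ∪ {ω | x / (2 * s) < R' ω} := by
    intro ω hω
    by_contra hcon
    simp only [Set.mem_union, Set.mem_ofPred_eq, not_or, not_lt] at hcon
    have hω' : x / s < R ω + R' ω := hω
    have : x / s = x / (2 * s) + x / (2 * s) := by field_simp; norm_num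
    linarith [hcon.1, hcon.2]
  refine (measureReal_mono hsub).trans ((measureReal_union_le _ _).trans
    ((add_le_add h3 h4).trans (le_of_eq ?_)))
  rw [Real.mul_rpow (by norm_num) (by linarith)]
  ring

/-- Tail domination by a regularly varying tail of index `-α`, with Potter bounds. -/
def HasTail (P : Measure Ω) (V : ℝ → ℝ) (α : ℝ) (R : Ω → ℝ) : Prop :=
  ∀ a, α < a → TailBound P V a R

section HasTail

variable {P : Measure Ω} [IsProbabilityMeasure P] {V : ℝ → ℝ} {α : ℝ} {R R' : Ω → ℝ}

/-- A constant exceeds x/s only if s is of order x or larger, and then s^a V(x) is bounded below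
because V decays more slowly than x^(-a). -/
theorem hasTail_const (hV : RVTail V α) (c : ℝ) : HasTail P V α (fun _ => c) := by
  intro a ha
  have ha0 : 0 < a := hV.index_pos.trans ha
  obtain ⟨k, x₀, hk, hx₀, h⟩ := hV.rpow_le ha
  set c' := max 1 c with hc'
  have hc'1 : 1 ≤ c' := le_max_left _ _
  refine ⟨max 1 (c' ^ a / k), x₀, le_max_left _ _, hx₀, fun x hx s hs => ?_⟩
  have hx0 : 0 < x := by linarith
  have hs0 : 0 < s := by linarith
  have hVx := hV.pos x
  by_cases hcase : x / s < c
  · refine measureReal_le_one.trans ?_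
    have h1 : x ≤ s * c' := by
      rw [div_lt_iff₀ hs0] at hcase
      have := le_max_right 1 c
      nlinarith
    have h2 : x ^ a ≤ s ^ a * c' ^ a := by
      rw [← Real.mul_rpow hs0.le (by linarith)]
      exact Real.rpow_le_rpow hx0.le h1 ha0.le
    have h3 := h x hx
    have h4 : 1 ≤ c' ^ a / k * s ^ a * V x := by
      calc (1:ℝ) = x ^ a / k * (k * x ^ (-a)) := by
            rw [Real.rpow_neg hx0.le]; field_simp
        _ ≤ (s ^ a * c' ^ a) / k * V x := by gcongr
        _ = c' ^ a / k * s ^ a * V x := by ring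
    refine h4.trans ?_
    gcongr
    exact le_max_right _ _
  · have : {ω : Ω | x / s < c} = ∅ := by ext; simp [hcase]
    rw [this]
    simp only [measureReal_empty]
    positivity

theorem HasTail.add (hV : RVTail V α) (h : HasTail P V α R) (h' : HasTail P V α R') :
    HasTail P V α (fun ω => R ω + R' ω) := fun a ha =>
  (h a ha).add (hV.index_pos.trans ha).le (h' a ha)

theorem HasTail.mono (h : HasTail P V α R) (hR : ∀ᵐ ω ∂P, R' ω ≤ R ω) : HasTail P V α R' :=
  fun a ha => (h a ha).mono hR

theorem HasTail.sum {ι : Type*} (hV : RVTail V α) (s : Finset ι) {R : ι → Ω → ℝ}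
    (h : ∀ i ∈ s, HasTail P V α (R i)) : HasTail P V α (fun ω => ∑ i ∈ s, R i ω) := by
  classical
  induction s using Finset.induction_on with
  | empty => simpa using hasTail_const hV 0
  | insert i s hi ih =>
    simp_rw [Finset.sum_insert hi]
    exact (h i (Finset.mem_insert_self _ _)).add hV
      (ih fun j hj => h j (Finset.mem_insert_of_mem hj))

/-- One moment order q > α serves every a > α: for a ≤ q it dominates m^a because m ≥ 1, and for a >
q the bound with exponent q is already stronger. -/
theorem HasTail.indep_mul (hV : RVTail V α) (h : HasTail P V α R) {m : Ω → ℝ} (hm : Measurable m)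
    (hR : Measurable R) (hmR : IndepFun m R P) (hm1 : ∀ ω, 1 ≤ m ω) {q : ℝ} (hq : α < q)
    (hint : ∫⁻ ω, ENNReal.ofReal (m ω ^ q) ∂P < ∞) : HasTail P V α (fun ω => m ω * R ω) := by
  have key : ∀ a, α < a → a ≤ q → TailBound P V a (fun ω => m ω * R ω) := fun a ha haq =>
    (h a ha).indep_mul hV.pos hm hR hmR hm1 (lt_of_le_of_lt (lintegral_mono fun ω =>
      ENNReal.ofReal_le_ofReal (Real.rpow_le_rpow_of_exponent_le (hm1 ω) haq)) hint)
  intro a ha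
  rcases le_total a q with haq | haq
  · exact key a ha haq
  · exact (key q hq le_rfl).exponent_mono hV.pos haq

/-- Moments of order below the tail index are finite. -/
theorem HasTail.moment_lt_top (hV : RVTail V α) (h : HasTail P V α R) (hRm : Measurable R)
    (hR0 : ∀ ω, 0 ≤ R ω) {q : ℝ} (hq : 0 < q) (hqα : q < α) :
    ∫⁻ ω, ENNReal.ofReal (R ω ^ q) ∂P < ∞ := by
  obtain ⟨b, hqb, hbα⟩ := exists_between hqα
  obtain ⟨C, hC, hle⟩ := hV.le_rpow (hq.trans hqb) hbα
  -- Only s = 1 is used, so any exponent above α would do.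
  obtain ⟨C', x₀, hC', hx₀, hT⟩ := h (α + 1) (by linarith)
  have hx₀0 : 0 < x₀ := by linarith
  rw [lintegral_rpow_eq_lintegral_meas_lt_mul P (Eventually.of_forall hR0) hRm.aemeasurable hq]
  have e : Set.Ioi (0:ℝ) = Set.Ioc 0 x₀ ∪ Set.Ioi x₀ :=
    (Set.Ioc_union_Ioi_eq_Ioi hx₀0.le).symm
  refine ENNReal.mul_lt_top ENNReal.ofReal_lt_top ?_
  rw [e]
  refine (lintegral_union_le _ _ _).trans_lt (ENNReal.add_lt_top.2 ⟨?_, ?_⟩)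
  · refine lt_of_le_of_lt (setLIntegral_mono' measurableSet_Ioc
      (g := fun t => ENNReal.ofReal (t ^ (q - 1))) fun t ht => ?_) ?_
    · exact mul_le_of_le_one_left zero_le prob_le_one
    · rw [lintegral_rpow_Ioc hx₀0 (by linarith)]; exact ENNReal.ofReal_lt_top
  · refine lt_of_le_of_lt (setLIntegral_mono' measurableSet_Ioi
      (g := fun t => ENNReal.ofReal (C' * C) * ENNReal.ofReal (t ^ (q - 1 - b))) fun t ht => ?_) ?_
    · have ht0 : (0:ℝ) < t := hx₀0.trans ht
      have h1 : P {ω | t < R ω} ≤ ENNReal.ofReal (C' * C * t ^ (-b)) := by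
        rw [ENNReal.le_ofReal_iff_toReal_le (measure_ne_top _ _) (by positivity)]
        have h2 := hT t (le_of_lt ht) 1 le_rfl
        rw [div_one, Real.one_rpow, mul_one] at h2
        refine h2.trans ?_
        rw [mul_assoc]
        exact mul_le_mul_of_nonneg_left (hle t ht0) (by linarith)
      refine (mul_le_mul_left h1 _).trans ?_
      rw [← ENNReal.ofReal_mul (by positivity), ← ENNReal.ofReal_mul (by positivity)]
      refine ENNReal.ofReal_le_ofReal (le_of_eq ?_)
      rw [mul_assoc, ← Real.rpow_add ht0]; ring_nf
    · rw [lintegral_const_mul' _ _ ENNReal.ofReal_ne_top, lintegral_rpow_Ioi hx₀0 (by linarith)]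
      exact ENNReal.mul_lt_top ENNReal.ofReal_lt_top ENNReal.ofReal_lt_top

end HasTail

/-- The joint growth of the normalization and the tail that is used for truncated sums. -/
structure GammaTail (V : ℝ → ℝ) (α : ℝ) (γ : ℕ → ℝ) : Prop where
  rv : RVTail V α
  tendsto : Tendsto γ atTop atTop
  nV : Tendsto (fun n : ℕ => (n:ℝ) * V (γ n)) atTop (𝓝 0)
  two : α = 2 → ∃ ε : ℝ, 0 < ε ∧
    Tendsto (fun n : ℕ => γ n / Real.sqrt ((n : ℝ) ^ (1 + ε))) atTop atTop
  gt_two : 2 < α →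
    Tendsto (fun n : ℕ => γ n / Real.sqrt ((n : ℝ) * Real.log n)) atTop atTop

namespace GammaTail

variable {V : ℝ → ℝ} {α : ℝ} {γ : ℕ → ℝ}

theorem nV_pos (h : GammaTail V α γ) {n : ℕ} (hn : 1 ≤ n) : 0 < (n:ℝ) * V (γ n) :=
  mul_pos (by exact_mod_cast hn) (h.rv.pos _)

theorem log_nonneg (h : GammaTail V α γ) : ∀ᶠ n : ℕ in atTop, 0 ≤ -Real.log (n * V (γ n)) := by
  filter_upwards [eventually_ge_atTop 1, h.nV.eventually (gt_mem_nhds one_pos)] with n hn h1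
  have := Real.log_nonpos (h.nV_pos hn).le h1.le
  linarith

/-- Since n ≥ 1, the left-hand side is at most -log V(γ_n), and V(x) ≥ c x^(-(α+1)). One further
unit in K absorbs -log c. -/
theorem log_le (h : GammaTail V α γ) :
    ∃ K : ℝ, 0 < K ∧ ∀ᶠ n : ℕ in atTop, -Real.log (n * V (γ n)) ≤ K * Real.log (γ n) := by
  have hα := h.rv.index_pos
  obtain ⟨c, x₀, hc, hx₀, hle⟩ := h.rv.rpow_le (show α < α + 1 by linarith)
  refine ⟨α + 2, by linarith, ?_⟩
  filter_upwards [eventually_ge_atTop 1, h.tendsto.eventually_ge_atTop x₀,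
    (Real.tendsto_log_atTop.comp h.tendsto).eventually_ge_atTop (-Real.log c)] with n hn hx hl
  simp only [Function.comp] at hl
  have hg : 0 < γ n := by linarith
  have hn1 : (1:ℝ) ≤ n := by exact_mod_cast hn
  have h1 : c * γ n ^ (-(α + 1)) ≤ n * V (γ n) :=
    (hle _ hx).trans (le_mul_of_one_le_left (h.rv.pos _).le hn1)
  have h2 := Real.log_le_log (by positivity) h1
  rw [Real.log_mul hc.ne' (by positivity), Real.log_rpow hg] at h2
  linarith

/-- By `log_le` it suffices to bound log(γ_n) n/γ_n². If γ_n ≤ n, then log γ_n ≤ log n and the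
growth condition applies. If γ_n ≥ n, the quantity is at most log(γ_n)/γ_n. -/
theorem log_mul_div_sq (h : GammaTail V α γ) (hα : 2 < α) :
    Tendsto (fun n : ℕ => -Real.log (n * V (γ n)) * ((n:ℝ) / γ n ^ 2)) atTop (𝓝 0) := by
  obtain ⟨K, hK, hle⟩ := h.log_le
  have hρ := h.gt_two hα
  have h1 : Tendsto (fun n : ℕ => ((γ n / Real.sqrt ((n : ℝ) * Real.log n)) ^ 2)⁻¹) atTop (𝓝 0) :=
    (((tendsto_pow_atTop two_ne_zero).comp hρ)).inv_tendsto_atTop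
  have h2 : Tendsto (fun n : ℕ => Real.log (γ n) / γ n) atTop (𝓝 0) :=
    (Real.isLittleO_log_id_atTop.tendsto_div_nhds_zero).comp h.tendsto
  have h3 := (h1.add h2).const_mul K
  rw [add_zero, mul_zero] at h3
  refine squeeze_zero' ?_ ?_ h3
  · filter_upwards [h.log_nonneg] with n hn
    exact mul_nonneg hn (by positivity)
  · filter_upwards [hle, h.tendsto.eventually_ge_atTop 1, eventually_ge_atTop 2] with n hn hg hn2
    have hn2' : (2:ℝ) ≤ n := by exact_mod_cast hn2
    have hln : 0 < Real.log n := Real.log_pos (by linarith)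
    have hlg : 0 ≤ Real.log (γ n) := Real.log_nonneg hg
    refine (mul_le_mul_of_nonneg_right hn (by positivity)).trans ?_
    rw [mul_assoc]
    refine mul_le_mul_of_nonneg_left ?_ hK.le
    have e1 : ((γ n / Real.sqrt ((n : ℝ) * Real.log n)) ^ 2)⁻¹ = n * Real.log n / γ n ^ 2 := by
      rw [div_pow, Real.sq_sqrt (by positivity), inv_div]
    rw [e1]
    rcases le_total (γ n) n with hc | hc
    · have : Real.log (γ n) * (n / γ n ^ 2) ≤ n * Real.log n / γ n ^ 2 := by
        rw [mul_div_assoc', mul_comm]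
        have := Real.log_le_log (by linarith) hc
        gcongr
      have : 0 ≤ Real.log (γ n) / γ n := by positivity
      linarith
    · have : Real.log (γ n) * (n / γ n ^ 2) ≤ Real.log (γ n) / γ n := by
        rw [mul_div_assoc', div_le_div_iff₀ (by positivity) (by linarith)]
        have : n * γ n ≤ γ n ^ 2 := by nlinarith
        nlinarith
      have : 0 ≤ n * Real.log n / γ n ^ 2 := by positivity
      linarith

/-- Truncated second moments are negligible on the large deviation scale. -/
theorem truncated_sq (h : GammaTail V α γ) {P : Measure Ω} [IsProbabilityMeasure P] {R : Ω → ℝ}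
    (hR : HasTail P V α R) (hRm : Measurable R) (hR0 : ∀ ω, 0 ≤ R ω) :
    Tendsto (fun n : ℕ => -Real.log (n * V (γ n)) *
      ((n:ℝ) / γ n ^ 2 * ∫ ω, min (R ω) (γ n) ^ 2 ∂P)) atTop (𝓝 0) := by
  have hα := h.rv.index_pos
  have hnn : ∀ n : ℕ, 0 ≤ ∫ ω, min (R ω) (γ n) ^ 2 ∂P := fun n =>
    integral_nonneg fun ω => sq_nonneg _
  have hlow : ∀ᶠ n : ℕ in atTop, 0 ≤ -Real.log (n * V (γ n)) *
      ((n:ℝ) / γ n ^ 2 * ∫ ω, min (R ω) (γ n) ^ 2 ∂P) := by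
    filter_upwards [h.log_nonneg] with n hn
    have := hnn n
    positivity
  have hmom : ∀ b, 0 < b → b < α → b ≤ 2 → ∃ K : ℝ, 0 ≤ K ∧ ∀ᶠ n : ℕ in atTop,
      ∫ ω, min (R ω) (γ n) ^ 2 ∂P ≤ K * γ n ^ (2 - b) := by
    intro b hb0 hbα hb2
    have hfin := hR.moment_lt_top h.rv hRm hR0 hb0 hbα
    have hi : Integrable (fun ω => R ω ^ b) P := by
      refine ⟨(hRm.pow_const b).aestronglyMeasurable, ?_⟩
      rw [hasFiniteIntegral_iff_ofReal (Eventually.of_forall fun ω => Real.rpow_nonneg (hR0 ω) b)]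
      exact hfin
    refine ⟨∫ ω, R ω ^ b ∂P, integral_nonneg fun ω => Real.rpow_nonneg (hR0 ω) b, ?_⟩
    filter_upwards [h.tendsto.eventually_gt_atTop 0] with n hg
    rw [← integral_mul_const]
    refine integral_mono_of_nonneg (Eventually.of_forall fun ω => sq_nonneg _) (hi.mul_const _)
      (Eventually.of_forall fun ω => ?_)
    have h0 : 0 ≤ min (R ω) (γ n) := le_min (hR0 ω) hg.le
    change min (R ω) (γ n) ^ 2 ≤ R ω ^ b * γ n ^ (2 - b)
    rw [← Real.rpow_two, show (2:ℝ) = b + (2 - b) by ring, Real.rpow_add_of_nonneg h0 hb0.le (by linarith),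
      show b + (2 - b) - b = 2 - b by ring]
    exact mul_le_mul (Real.rpow_le_rpow h0 (min_le_left _ _) hb0.le)
      (Real.rpow_le_rpow h0 (min_le_right _ _) (by linarith)) (by positivity)
      (Real.rpow_nonneg (hR0 ω) b)
  -- For α < 2 the truncated square is O(γ² V(γ)), which leaves x log x at x = n V(γ_n). For α = 2
  -- it is at most a small power of γ_n, beaten by the polynomial growth condition. For α > 2 the
  -- second moment is finite.
  rcases lt_trichotomy α 2 with h2 | h2 | h2
  · obtain ⟨a, ha, ha2⟩ := exists_between h2
    obtain ⟨C, x₀, hC, hx₀, hle⟩ := (hR a ha).trunc_moment h.rv.pos hRm hR0 two_pos ha2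
    have h1 : Tendsto (fun n : ℕ => C * -(Real.log (n * V (γ n)) * (n * V (γ n)))) atTop
        (𝓝 (C * -0)) := by
      have h0 : Tendsto (fun x : ℝ => Real.log x * x) (𝓝[>] 0) (𝓝 0) := by
        simpa only [Real.rpow_one] using tendsto_log_mul_rpow_nhdsGT_zero zero_lt_one
      refine ((h0.comp (tendsto_nhdsWithin_iff.2 ⟨h.nV, ?_⟩)).neg).const_mul C
      filter_upwards [eventually_ge_atTop 1] with n hn using h.nV_pos hn
    rw [neg_zero, mul_zero] at h1
    refine squeeze_zero' hlow ?_ h1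
    filter_upwards [h.log_nonneg, h.tendsto.eventually_ge_atTop x₀] with n hn hg
    have hg0 : 0 < γ n := by linarith
    have h3 := hle (γ n) hg
    simp only [Real.rpow_two] at h3
    calc -Real.log (n * V (γ n)) * ((n:ℝ) / γ n ^ 2 * ∫ ω, min (R ω) (γ n) ^ 2 ∂P)
        ≤ -Real.log (n * V (γ n)) * ((n:ℝ) / γ n ^ 2 * (C * γ n ^ 2 * V (γ n))) := by gcongr
      _ = _ := by field_simp
  · obtain ⟨ε, hε, hgr⟩ := h.two h2
    obtain ⟨K, hK, hlog⟩ := h.log_le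
    -- The growth condition says n ≤ γ_n^(2/(1+ε)) eventually. A moment order b between 2/(1+ε) and
    -- 2 leaves log γ_n divided by a positive power of γ_n.
    have h3 : 2 / (1 + ε) < 2 := by rw [div_lt_iff₀ (by linarith)]; linarith
    obtain ⟨b, hb, hb2⟩ := exists_between h3
    have hb0 : 0 < b := lt_trans (by positivity) hb
    obtain ⟨K', hK', hm⟩ := hmom b hb0 (by linarith) hb2.le
    have h4 : Tendsto (fun n : ℕ => K * K' * (Real.log (γ n) / γ n ^ (b - 2 / (1 + ε)))) atTop
        (𝓝 (K * K' * 0)) :=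
      ((isLittleO_log_rpow_atTop (by linarith)).tendsto_div_nhds_zero.comp h.tendsto).const_mul _
    rw [mul_zero] at h4
    refine squeeze_zero' hlow ?_ h4
    filter_upwards [hlog, hm, h.tendsto.eventually_ge_atTop 1, hgr.eventually_ge_atTop 1,
      eventually_ge_atTop 1] with n hl hm hg hgr hn
    have hg0 : 0 < γ n := by linarith
    have hn0 : (0:ℝ) < n := by exact_mod_cast hn
    have hlg : 0 ≤ Real.log (γ n) := Real.log_nonneg hg
    have h5 : (n:ℝ) ≤ γ n ^ (2 / (1 + ε)) := by
      rw [one_le_div (by positivity)] at hgr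
      rw [Real.sqrt_le_left hg0.le] at hgr
      have h6 := Real.rpow_le_rpow (by positivity) hgr (show 0 ≤ 1 / (1 + ε) by positivity)
      rw [← Real.rpow_mul hn0.le, ← Real.rpow_two, ← Real.rpow_mul hg0.le] at h6
      rw [mul_one_div_cancel (by linarith), Real.rpow_one] at h6
      refine h6.trans (le_of_eq ?_)
      congr 1; ring
    calc -Real.log (n * V (γ n)) * ((n:ℝ) / γ n ^ 2 * ∫ ω, min (R ω) (γ n) ^ 2 ∂P)
        ≤ (K * Real.log (γ n)) * (γ n ^ (2 / (1 + ε)) / γ n ^ 2 * (K' * γ n ^ (2 - b))) := by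
          have := hnn n
          gcongr
      _ = K * K' * (Real.log (γ n) * (γ n ^ (2 / (1 + ε)) * γ n ^ (2 - b) / γ n ^ (2:ℝ))) := by
          rw [Real.rpow_two]; ring
      _ = K * K' * (Real.log (γ n) / γ n ^ (b - 2 / (1 + ε))) := by
          rw [← Real.rpow_add hg0, ← Real.rpow_sub hg0, div_eq_mul_inv (Real.log (γ n)),
            ← Real.rpow_neg hg0.le]
          congr 3; ring
  · obtain ⟨K', hK', hm⟩ := hmom 2 two_pos h2 le_rfl
    have h1 := (h.log_mul_div_sq h2).mul_const K'
    rw [zero_mul] at h1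
    refine squeeze_zero' hlow ?_ h1
    filter_upwards [h.log_nonneg, hm] with n hn hm
    rw [sub_self, Real.rpow_zero, mul_one] at hm
    rw [mul_assoc]
    gcongr

end GammaTail

end RCLP

/-! ### Small jumps of stationary m-dependent sequences -/

namespace RCLP

variable {Ω : Type*} [MeasurableSpace Ω]

theorem measurable_mat_apply {d p : ℕ} {C : Ω → Mat d p} {Y : Ω → Vec p} (hC : Measurable C)
    (hY : Measurable Y) : Measurable fun ω => C ω (Y ω) :=
  (isBoundedBilinearMap_apply (𝕜 := ℝ) (E := Vec p) (F := Vec d)).continuous.measurable.comp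
    (hC.prodMk hY)

/-- Domination by min(R, γ_n) supplies both the square condition and the tail condition of
`tendsto_truncated_sum`, which is applied to ξ and to -ξ. -/
theorem GammaTail.tendsto_abs_sum {P : Measure Ω} [IsProbabilityMeasure P] {V : ℝ → ℝ} {α : ℝ}
    {γ : ℕ → ℝ} (hG : GammaTail V α γ) {ξ : ℕ → ℤ → Ω → ℝ} {m : ℕ} (hm : 0 < m)
    (hmeas : ∀ n k, Measurable (ξ n k))
    (hind : ∀ n, ∀ c : ℤ, iIndepFun (fun k : {k : ℤ // k % (m : ℤ) = c} => ξ n k) P)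
    (hid : ∀ n k, IdentDistrib (ξ n k) (ξ n 0) P P)
    {R : Ω → ℝ} (hR : HasTail P V α R) (hRm : Measurable R) (hR0 : ∀ ω, 0 ≤ R ω)
    (hξR : ∀ᶠ n in atTop, ∀ ω, |ξ n 0 ω| ≤ min (R ω) (γ n))
    {y δ : ℝ} (hδ : 0 < δ) (hy : 4 * m * y ≤ δ)
    (hbd : ∀ᶠ n in atTop, ∀ k ω, |ξ n k ω| ≤ y * γ n)
    (hmean : Tendsto (fun n : ℕ => (n:ℝ) / γ n * ∫ ω, ξ n 0 ω ∂P) atTop (𝓝 0)) :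
    Tendsto (fun n : ℕ => 1 / (n * V (γ n)) *
      P.real {ω | γ n * δ < |∑ k ∈ Finset.Icc 1 n, ξ n (k : ℤ) ω|}) atTop (𝓝 0) := by
  have hsq : Tendsto (fun n : ℕ => -Real.log (n * V (γ n)) *
      ((n:ℝ) / γ n ^ 2 * ∫ ω, ξ n 0 ω ^ 2 ∂P)) atTop (𝓝 0) := by
    refine squeeze_zero' ?_ ?_ (hG.truncated_sq hR hRm hR0)
    · filter_upwards [hG.log_nonneg] with n hn
      have : 0 ≤ ∫ ω, ξ n 0 ω ^ 2 ∂P := integral_nonneg fun ω => sq_nonneg _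
      positivity
    · filter_upwards [hG.log_nonneg, hξR, hG.tendsto.eventually_gt_atTop 0] with n hn hb hg
      refine mul_le_mul_of_nonneg_left (mul_le_mul_of_nonneg_left ?_ (by positivity)) hn
      refine integral_mono_of_nonneg (Eventually.of_forall fun ω => sq_nonneg _) ?_
        (Eventually.of_forall fun ω => ?_)
      · refine (integrable_const (γ n ^ 2)).mono'
          ((hRm.min measurable_const).pow_const 2).aestronglyMeasurable
          (Eventually.of_forall fun ω => ?_)
        rw [Real.norm_of_nonneg (sq_nonneg _)]
        exact pow_le_pow_left₀ (le_min (hR0 ω) hg.le) (min_le_right _ _) 2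
      · change ξ n 0 ω ^ 2 ≤ min (R ω) (γ n) ^ 2
        rw [← sq_abs]
        exact pow_le_pow_left₀ (abs_nonneg _) (hb ω) 2
  obtain ⟨C, x₀, hC, hx₀, hT⟩ := hR (α + 1) (by linarith)
  have htail : ∀ᶠ n in atTop, ∀ s, 1 ≤ s →
      P.real {ω | γ n / s < |ξ n 0 ω|} ≤ C * s ^ (α + 1) * V (γ n) := by
    filter_upwards [hξR, hG.tendsto.eventually_ge_atTop x₀] with n hb hg s hs
    refine (measureReal_mono fun ω hω => ?_).trans (hT (γ n) hg s hs)
    exact lt_of_lt_of_le hω ((hb ω).trans (min_le_left _ _))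
  have h1 := tendsto_truncated_sum hm hmeas hind hid hG.rv.pos hG.tendsto hG.nV hδ hy hbd hmean
    hsq htail
  have h2 := tendsto_truncated_sum (ξ := fun n k ω => -ξ n k ω) hm (fun n k => (hmeas n k).neg)
    (fun n c => (hind n c).comp (fun _ x => -x) fun _ => measurable_neg)
    (fun n k => (hid n k).comp measurable_neg)
    hG.rv.pos hG.tendsto hG.nV hδ hy (by simpa using hbd)
    (by simpa [integral_neg] using hmean.neg) (by simpa using hsq) (by simpa using htail)
  have h3 := h1.add h2
  rw [add_zero] at h3
  refine squeeze_zero' (Eventually.of_forall fun n => ?_) (Eventually.of_forall fun n => ?_) h3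
  · have := (hG.rv.pos (γ n)).le
    positivity
  · rw [← mul_add]
    have := (hG.rv.pos (γ n)).le
    refine mul_le_mul_of_nonneg_left ?_ (by positivity)
    refine (measureReal_mono fun ω hω => ?_).trans (measureReal_union_le _ _)
    rcases lt_abs.1 (show γ n * δ < |∑ k ∈ Finset.Icc 1 n, ξ n (k : ℤ) ω| from hω) with h | h
    · exact Or.inl h
    · refine Or.inr ?_
      change γ n * δ < ∑ k ∈ Finset.Icc 1 n, -ξ n (k : ℤ) ω
      rwa [Finset.sum_neg_distrib]

/-- Small jumps of a stationary `m`-dependent vector sequence are negligible. -/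
theorem GammaTail.tendsto_norm_sum {P : Measure Ω} [IsProbabilityMeasure P] {V : ℝ → ℝ} {α : ℝ}
    {γ : ℕ → ℝ} (hG : GammaTail V α γ) {d : ℕ} {W : ℤ → Ω → Vec d} {m : ℕ} (hm : 0 < m)
    (hmeas : ∀ k, Measurable (W k))
    (hind : ∀ c : ℤ, iIndepFun (fun k : {k : ℤ // k % (m : ℤ) = c} => W k) P)
    (hid : ∀ k, IdentDistrib (W k) (W 0) P P)
    (hR : HasTail P V α (fun ω => ‖W 0 ω‖))
    (hmean : ∀ y : ℝ, 0 < y → y ≤ 1 → Tendsto (fun n : ℕ => ((n:ℝ) / γ n) •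
      ∫ ω, (if ‖W 0 ω‖ ≤ γ n * y then W 0 ω else 0) ∂P) atTop (𝓝 0))
    {δ : ℝ} (hδ : 0 < δ) :
    ∃ ε₀ : ℝ, 0 < ε₀ ∧ ∀ ε, 0 < ε → ε < ε₀ → Tendsto (fun n : ℕ => 1 / (n * V (γ n)) *
      P.real {ω | γ n * δ < ‖∑ k ∈ Finset.Icc 1 n,
        if ‖W (k : ℤ) ω‖ ≤ γ n * ε then W (k : ℤ) ω else 0‖}) atTop (𝓝 0) := by
  have hm0 : (0:ℝ) < m := by exact_mod_cast hm
  -- The sum is treated coordinate by coordinate. A norm above γδ forces some coordinate above γδ',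
  -- and d + 1 also covers d = 0.
  set δ' := δ / (d + 1) with hδ'
  have hδ'0 : 0 < δ' := by positivity
  refine ⟨min 1 (δ' / (4 * m)), by positivity, fun ε hε hεlt => ?_⟩
  have hε1 : ε ≤ 1 := (hεlt.trans_le (min_le_left _ _)).le
  have hε2 : 4 * m * ε ≤ δ' := by
    have := (hεlt.trans_le (min_le_right _ _)).le
    rw [le_div_iff₀ (by positivity)] at this
    linarith
  set τ : ℕ → Vec d → Vec d := fun n x => if ‖x‖ ≤ γ n * ε then x else 0 with hτ
  have hτm : ∀ n, Measurable (τ n) := fun n =>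
    Measurable.ite (measurableSet_le measurable_norm measurable_const) measurable_id measurable_const
  have hτb : ∀ n, 0 ≤ γ n → ∀ x, ‖τ n x‖ ≤ min ‖x‖ (γ n * ε) := by
    intro n hn x
    simp only [hτ]
    split_ifs with h
    · exact le_min le_rfl h
    · rw [norm_zero]; exact le_min (norm_nonneg _) (by positivity)
  have hco : ∀ i : Fin d, Measurable fun x : Vec d => x i := fun i => by fun_prop
  have hcoord : ∀ i : Fin d, Tendsto (fun n : ℕ => 1 / (n * V (γ n)) *
      P.real {ω | γ n * δ' < |∑ k ∈ Finset.Icc 1 n, τ n (W (k : ℤ) ω) i|}) atTop (𝓝 0) := by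
    intro i
    refine hG.tendsto_abs_sum (ξ := fun n k ω => τ n (W k ω) i) hm
      (fun n k => (hco i).comp ((hτm n).comp (hmeas k)))
      (fun n c => (hind c).comp (fun _ x => τ n x i) fun _ => (hco i).comp (hτm n))
      (fun n k => (hid k).comp ((hco i).comp (hτm n))) hR (hmeas 0).norm (fun ω => norm_nonneg _)
      ?_ hδ'0 hε2 ?_ ?_
    · filter_upwards [hG.tendsto.eventually_ge_atTop 0] with n hn ω
      refine (abs_apply_le_norm _ i).trans ((hτb n hn _).trans (min_le_min le_rfl ?_))
      exact mul_le_of_le_one_right hn hε1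
    · filter_upwards [hG.tendsto.eventually_ge_atTop 0] with n hn k ω
      refine (abs_apply_le_norm _ i).trans ((hτb n hn _).trans ((min_le_right _ _).trans ?_))
      rw [mul_comm]
    · have h1 := ((EuclideanSpace.proj i : Vec d →L[ℝ] ℝ).continuous.tendsto 0).comp
        (hmean ε hε hε1)
      rw [map_zero] at h1
      refine h1.congr' ?_
      filter_upwards [hG.tendsto.eventually_ge_atTop 0] with n hn
      have hint : Integrable (fun ω => τ n (W 0 ω)) P :=
        (integrable_const (γ n * ε)).mono' ((hτm n).comp (hmeas 0)).aestronglyMeasurable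
          (Eventually.of_forall fun ω => (hτb n hn _).trans (min_le_right _ _))
      have h2 : ∫ ω, τ n (W 0 ω) i ∂P = (∫ ω, τ n (W 0 ω) ∂P) i :=
        (EuclideanSpace.proj i : Vec d →L[ℝ] ℝ).integral_comp_comm hint
      rw [h2]
      rfl
  have hsum := tendsto_finsetSum Finset.univ fun i _ => hcoord i
  rw [Finset.sum_const_zero] at hsum
  refine squeeze_zero' (Eventually.of_forall fun n => ?_) ?_ hsum
  · have := (hG.rv.pos (γ n)).le
    positivity
  filter_upwards [hG.tendsto.eventually_gt_atTop 0] with n hg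
  have := (hG.rv.pos (γ n)).le
  rw [← Finset.mul_sum]
  refine mul_le_mul_of_nonneg_left ?_ (by positivity)
  refine (measureReal_mono ?_ (measure_ne_top _ _)).trans (measureReal_iUnion_fintype_le _)
  intro ω hω
  have hω' : γ n * δ < ‖∑ k ∈ Finset.Icc 1 n, τ n (W (k : ℤ) ω)‖ := hω
  have h2 : (d:ℝ) * (γ n * δ') < ‖∑ k ∈ Finset.Icc 1 n, τ n (W (k : ℤ) ω)‖ := by
    refine lt_of_le_of_lt ?_ hω'
    rw [mul_left_comm]
    refine mul_le_mul_of_nonneg_left ?_ hg.le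
    rw [hδ', mul_div_assoc', div_le_iff₀ (by positivity)]
    nlinarith
  obtain ⟨i, hi⟩ := exists_abs_apply_gt h2
  refine Set.mem_iUnion.2 ⟨i, ?_⟩
  simpa using hi

/-- Truncated absolute means for tail index smaller than one. -/
theorem GammaTail.truncated_mean_of_lt_one {P : Measure Ω} [IsProbabilityMeasure P] {V : ℝ → ℝ}
    {α : ℝ} {γ : ℕ → ℝ} (hG : GammaTail V α γ) (hα : α < 1) {R : Ω → ℝ} (hR : HasTail P V α R)
    (hRm : Measurable R) (hR0 : ∀ ω, 0 ≤ R ω) :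
    Tendsto (fun n : ℕ => (n:ℝ) / γ n * ∫ ω, min (R ω) (γ n) ∂P) atTop (𝓝 0) := by
  obtain ⟨a, ha, ha1⟩ := exists_between hα
  obtain ⟨C, x₀, hC, hx₀, hle⟩ := (hR a ha).trunc_moment hG.rv.pos hRm hR0 one_pos ha1
  have h1 := hG.nV.const_mul C
  rw [mul_zero] at h1
  refine squeeze_zero' ?_ ?_ h1
  · filter_upwards [hG.tendsto.eventually_gt_atTop 0] with n hg
    have : 0 ≤ ∫ ω, min (R ω) (γ n) ∂P := integral_nonneg fun ω => le_min (hR0 ω) hg.le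
    positivity
  · filter_upwards [hG.tendsto.eventually_ge_atTop x₀] with n hg
    have hg0 : 0 < γ n := by linarith
    have h2 := hle (γ n) hg
    simp only [Real.rpow_one] at h2
    calc (n:ℝ) / γ n * ∫ ω, min (R ω) (γ n) ∂P ≤ n / γ n * (C * γ n * V (γ n)) := by gcongr
      _ = C * (n * V (γ n)) := by field_simp

end RCLP

/-! ### Truncated means of random linear combinations -/

namespace RCLP

variable {Ω : Type*} [MeasurableSpace Ω]

/-- Random coefficients `C_i` with a moment of order `q`, and vectors `Y_j` with norm tail `V`,
each `C_i` being independent of each `Y_j`. -/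
structure Coeffs (P : Measure Ω) (V : ℝ → ℝ) (q : ℝ) {d p : ℕ} {ι : Type*} (C : ι → Ω → Mat d p)
    (Y : ι → Ω → Vec p) : Prop where
  measC : ∀ i, Measurable (C i)
  measY : ∀ i, Measurable (Y i)
  indep : ∀ i j, IndepFun (C i) (Y j) P
  tail : ∀ j u, P.real {ω | u < ‖Y j ω‖} = V u
  moment : ∀ i, ∫⁻ ω, ‖C i ω‖ₑ ^ q ∂P < ∞

theorem enorm_rpow_eq_ofReal {E : Type*} [NormedAddCommGroup E] (x : E) {q : ℝ} (hq : 0 ≤ q) :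
    ‖x‖ₑ ^ q = ENNReal.ofReal (‖x‖ ^ q) := by
  rw [← ofReal_norm, ENNReal.ofReal_rpow_of_nonneg (norm_nonneg _) hq]

/-- Compares truncating the sum with truncating each vector. If all |z_j| ≤ x, the two differ only
when u = ∑ ‖c_j‖|z_j| exceeds xy; then u ≤ (xy)^(1-q) u^q, and the power mean inequality splits u^q.
If some |z_k| > x, the crude bound x + ∑ ‖c_j‖ x is charged to that k. -/
theorem norm_truncation_diff_le {d p : ℕ} {ι : Type*} (F : Finset ι) (c : ι → Mat d p)
    (z : ι → Vec p) {x y q : ℝ} (hx : 0 < x) (hy0 : 0 < y) (hy1 : y ≤ 1) (hq : 1 ≤ q) :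
    ‖(if ‖∑ j ∈ F, c j (z j)‖ ≤ x * y then ∑ j ∈ F, c j (z j) else 0) -
      ∑ j ∈ F, c j (if ‖z j‖ ≤ x then z j else 0)‖ ≤
    ∑ k ∈ F, ∑ j ∈ F, (1 + ‖c j‖) * x * (if x < ‖z k‖ then 1 else 0) +
      (x * y) ^ (1 - q) * (F.card : ℝ) ^ (q - 1) * ∑ j ∈ F, ‖c j‖ ^ q * (min ‖z j‖ x) ^ q := by
  have hxy : 0 < x * y := by positivity
  have hA0 : 0 ≤ ∑ k ∈ F, ∑ j ∈ F, (1 + ‖c j‖) * x * (if x < ‖z k‖ then (1:ℝ) else 0) :=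
    Finset.sum_nonneg fun k _ => Finset.sum_nonneg fun j _ => by positivity
  have hmin : ∀ j, 0 ≤ min ‖z j‖ x := fun j => le_min (norm_nonneg _) hx.le
  have hB0 : 0 ≤ (x * y) ^ (1 - q) * (F.card : ℝ) ^ (q - 1) *
      ∑ j ∈ F, ‖c j‖ ^ q * (min ‖z j‖ x) ^ q :=
    mul_nonneg (by positivity) (Finset.sum_nonneg fun j _ =>
      mul_nonneg (by positivity) (Real.rpow_nonneg (hmin j) _))
  by_cases hall : ∀ j ∈ F, ‖z j‖ ≤ x
  · have e1 : ∑ j ∈ F, c j (if ‖z j‖ ≤ x then z j else 0) = ∑ j ∈ F, c j (z j) :=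
      Finset.sum_congr rfl fun j hj => by rw [if_pos (hall j hj)]
    rw [e1]
    split_ifs with h
    · rw [sub_self, norm_zero]; positivity
    · rw [zero_sub, norm_neg]
      refine le_trans ?_ (le_add_of_nonneg_left hA0)
      set u := ∑ j ∈ F, ‖c j‖ * ‖z j‖ with hu
      have hWu : ‖∑ j ∈ F, c j (z j)‖ ≤ u :=
        (norm_sum_le _ _).trans (Finset.sum_le_sum fun j _ => (c j).le_opNorm _)
      have hxu : x * y < u := (not_le.1 h).trans_le hWu
      have hu0 : 0 < u := hxy.trans hxu
      have h1 : u ^ q ≤ (F.card : ℝ) ^ (q - 1) * ∑ j ∈ F, (‖c j‖ * ‖z j‖) ^ q :=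
        Real.rpow_sum_le_const_mul_sum_rpow_of_nonneg F hq fun j _ => by positivity
      have h2 : ∑ j ∈ F, (‖c j‖ * ‖z j‖) ^ q = ∑ j ∈ F, ‖c j‖ ^ q * (min ‖z j‖ x) ^ q :=
        Finset.sum_congr rfl fun j hj => by
          rw [min_eq_left (hall j hj), Real.mul_rpow (norm_nonneg _) (norm_nonneg _)]
      rw [h2] at h1
      calc ‖∑ j ∈ F, c j (z j)‖ ≤ u := hWu
        _ = u ^ (1 - q) * u ^ q := by rw [← Real.rpow_add hu0]; norm_num
        _ ≤ (x * y) ^ (1 - q) * u ^ q := by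
            refine mul_le_mul_of_nonneg_right ?_ (by positivity)
            exact Real.rpow_le_rpow_of_nonpos hxy hxu.le (by linarith)
        _ ≤ _ := by rw [mul_assoc]; gcongr
  · push Not at hall
    obtain ⟨k, hk, hzk⟩ := hall
    refine le_trans ?_ (le_add_of_nonneg_right hB0)
    have h1 : ‖(if ‖∑ j ∈ F, c j (z j)‖ ≤ x * y then ∑ j ∈ F, c j (z j) else 0)‖ ≤ x := by
      split_ifs with h
      · exact h.trans (mul_le_of_le_one_right hx.le hy1)
      · rw [norm_zero]; exact hx.le
    have h2 : ‖∑ j ∈ F, c j (if ‖z j‖ ≤ x then z j else 0)‖ ≤ ∑ j ∈ F, ‖c j‖ * x := by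
      refine (norm_sum_le _ _).trans (Finset.sum_le_sum fun j _ => ((c j).le_opNorm _).trans ?_)
      refine mul_le_mul_of_nonneg_left ?_ (norm_nonneg _)
      split_ifs with h
      · exact h
      · rw [norm_zero]; exact hx.le
    have h3 : x + ∑ j ∈ F, ‖c j‖ * x ≤ ∑ j ∈ F, (1 + ‖c j‖) * x := by
      have : ∑ j ∈ F, (1 + ‖c j‖) * x = F.card * x + ∑ j ∈ F, ‖c j‖ * x := by
        simp [add_mul, Finset.sum_add_distrib]
      rw [this]
      have : (1:ℝ) ≤ F.card := by exact_mod_cast Finset.card_pos.2 ⟨k, hk⟩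
      nlinarith
    have h4 : ∑ j ∈ F, (1 + ‖c j‖) * x ≤
        ∑ k ∈ F, ∑ j ∈ F, (1 + ‖c j‖) * x * (if x < ‖z k‖ then (1:ℝ) else 0) := by
      refine le_trans (le_of_eq ?_) (Finset.single_le_sum (f := fun k => ∑ j ∈ F,
        (1 + ‖c j‖) * x * (if x < ‖z k‖ then (1:ℝ) else 0))
        (fun k _ => Finset.sum_nonneg fun j _ => by positivity) hk)
      simp [hzk]
    exact (norm_sub_le _ _).trans ((add_le_add h1 h2).trans (h3.trans h4))

namespace Coeffs

variable {P : Measure Ω} {V : ℝ → ℝ} {α q : ℝ} {d p : ℕ} {ι : Type*}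
  {C : ι → Ω → Mat d p} {Y : ι → Ω → Vec p} {γ : ℕ → ℝ}

theorem measurable_sum (h : Coeffs P V q C Y) (F : Finset ι) :
    Measurable fun ω => ∑ j ∈ F, C j ω (Y j ω) :=
  Finset.measurable_sum _ fun j _ => measurable_mat_apply (h.measC j) (h.measY j)

theorem integrable_rpow (h : Coeffs P V q C Y) (hq : 0 ≤ q) (j : ι) :
    Integrable (fun ω => ‖C j ω‖ ^ q) P := by
  refine ⟨((h.measC j).norm.pow_const q).aestronglyMeasurable, ?_⟩
  rw [hasFiniteIntegral_iff_ofReal (Eventually.of_forall fun ω => by positivity)]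
  simpa only [enorm_rpow_eq_ofReal _ hq] using h.moment j

variable [IsProbabilityMeasure P]

theorem integrable (h : Coeffs P V q C Y) (hq : 1 ≤ q) (j : ι) : Integrable (C j) P := by
  refine ((integrable_const 1).add (h.integrable_rpow (by linarith) j)).mono'
    (h.measC j).aestronglyMeasurable (Eventually.of_forall fun ω => ?_)
  simp only [Pi.add_apply]
  rcases le_total ‖C j ω‖ 1 with hc | hc
  · have : 0 ≤ ‖C j ω‖ ^ q := by positivity
    linarith
  · have := Real.rpow_le_rpow_of_exponent_le hc hq
    rw [Real.rpow_one] at this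
    linarith

theorem hasTail_norm (h : Coeffs P V q C Y) (hV : RVTail V α) (hq : α < q) (F : Finset ι) :
    HasTail P V α (fun ω => ‖∑ j ∈ F, C j ω (Y j ω)‖) := by
  have hq0 : 0 < q := hV.index_pos.trans hq
  -- The product rule for tails requires a factor that is at least 1.
  have h1 : ∀ j ∈ F, HasTail P V α (fun ω => max 1 ‖C j ω‖ * ‖Y j ω‖) := by
    intro j _
    have hY : HasTail P V α (fun ω => ‖Y j ω‖) := fun a ha => hV.tailBound (h.tail j) ha
    refine hY.indep_mul hV (measurable_const.max (h.measC j).norm) (h.measY j).norm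
      ((h.indep j j).comp (φ := fun c => max 1 ‖c‖) (ψ := fun z => ‖z‖)
        (measurable_const.max measurable_norm) measurable_norm) (fun ω => le_max_left _ _) hq ?_
    refine lt_of_le_of_lt (lintegral_mono (g := fun ω => 1 + ‖C j ω‖ₑ ^ q) fun ω => ?_) ?_
    · rcases le_total ‖C j ω‖ 1 with hc | hc
      · simp [max_eq_left hc]
      · rw [max_eq_right hc, ← enorm_rpow_eq_ofReal _ hq0.le]
        exact le_add_self
    · rw [lintegral_add_left measurable_const, lintegral_const, measure_univ, mul_one]
      exact ENNReal.add_lt_top.2 ⟨ENNReal.one_lt_top, h.moment j⟩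
  refine (HasTail.sum hV F h1).mono (Eventually.of_forall fun ω => ?_)
  refine (norm_sum_le _ _).trans (Finset.sum_le_sum fun j _ => ((C j ω).le_opNorm _).trans ?_)
  exact mul_le_mul_of_nonneg_right (le_max_right _ _) (norm_nonneg _)

theorem trunc_norm_le {m : ℕ} (w : Vec m) {x y : ℝ} (hx : 0 ≤ x) (hy : y ≤ 1) :
    ‖(if ‖w‖ ≤ x * y then w else 0)‖ ≤ min ‖w‖ x := by
  split_ifs with h
  · exact le_min le_rfl (h.trans (mul_le_of_le_one_right hx hy))
  · rw [norm_zero]; exact le_min (norm_nonneg _) hx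

theorem measurable_trunc {m : ℕ} {W : Ω → Vec m} (hW : Measurable W) (x : ℝ) :
    Measurable fun ω => (if ‖W ω‖ ≤ x then W ω else 0) :=
  Measurable.ite (measurableSet_le hW.norm measurable_const) hW measurable_const

/-- For α < 1 no cancellation is needed, since the truncated absolute mean is already O(γ_n V(γ_n)).
-/
theorem mean_of_lt_one (h : Coeffs P V q C Y) (hG : GammaTail V α γ) (hα : α < 1) (hq : α < q)
    (F : Finset ι) {y : ℝ} (hy1 : y ≤ 1) :
    Tendsto (fun n : ℕ => ((n:ℝ) / γ n) • ∫ ω, (if ‖∑ j ∈ F, C j ω (Y j ω)‖ ≤ γ n * y then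
      ∑ j ∈ F, C j ω (Y j ω) else 0) ∂P) atTop (𝓝 0) := by
  have hW := h.measurable_sum F
  refine squeeze_zero_norm' ?_ (hG.truncated_mean_of_lt_one hα (h.hasTail_norm hG.rv hq F) hW.norm
    fun ω => norm_nonneg _)
  filter_upwards [hG.tendsto.eventually_gt_atTop 0] with n hg
  rw [norm_smul, Real.norm_of_nonneg (by positivity)]
  refine mul_le_mul_of_nonneg_left ((norm_integral_le_integral_norm _).trans ?_) (by positivity)
  refine integral_mono_of_nonneg (Eventually.of_forall fun ω => norm_nonneg _) ?_
    (Eventually.of_forall fun ω => trunc_norm_le _ hg.le hy1)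
  refine (integrable_const (γ n)).mono' (hW.norm.min measurable_const).aestronglyMeasurable
    (Eventually.of_forall fun ω => ?_)
  rw [Real.norm_of_nonneg (le_min (norm_nonneg _) hg.le)]
  exact min_le_right _ _

/-- If each Y_j is truncated instead of the sum, independence gives the mean ∑ E[C_j] E[truncated
Y_j], which is negligible by assumption. By `norm_truncation_diff_le` the change of truncation costs
O(γ_n V(γ_n)), and n/γ_n times this tends to 0. -/
theorem mean_of_one_le (h : Coeffs P V q C Y) (hG : GammaTail V α γ) (hα : 1 ≤ α) (hq : α < q)
    (hY : ∀ j, Tendsto (fun n : ℕ => ((n:ℝ) / γ n) •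
      ∫ ω, (if ‖Y j ω‖ ≤ γ n then Y j ω else 0) ∂P) atTop (𝓝 0))
    (F : Finset ι) {y : ℝ} (hy0 : 0 < y) (hy1 : y ≤ 1) :
    Tendsto (fun n : ℕ => ((n:ℝ) / γ n) • ∫ ω, (if ‖∑ j ∈ F, C j ω (Y j ω)‖ ≤ γ n * y then
      ∑ j ∈ F, C j ω (Y j ω) else 0) ∂P) atTop (𝓝 0) := by
  have hW := h.measurable_sum F
  have hq1 : 1 ≤ q := by linarith
  have hq0 : 0 < q := by linarith
  have hτi : ∀ n : ℕ, 0 < γ n → ∀ j, Integrable (fun ω => if ‖Y j ω‖ ≤ γ n then Y j ω else 0) P := by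
    intro n hg j
    refine (integrable_const (γ n)).mono' (measurable_trunc (h.measY j) _).aestronglyMeasurable
      (Eventually.of_forall fun ω => ?_)
    split_ifs with hc
    · exact hc
    · rw [norm_zero]; exact hg.le
  have hind : ∀ n : ℕ, ∀ j, IndepFun (C j) (fun ω => if ‖Y j ω‖ ≤ γ n then Y j ω else 0) P :=
    fun n j => (h.indep j j).comp (φ := id) (ψ := fun z => if ‖z‖ ≤ γ n then z else 0) measurable_id
      (Measurable.ite (measurableSet_le measurable_norm measurable_const) measurable_id
        measurable_const)
  have hsi : ∀ n : ℕ, 0 < γ n → ∀ j,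
      Integrable (fun ω => C j ω (if ‖Y j ω‖ ≤ γ n then Y j ω else 0)) P := by
    intro n hg j
    refine ((h.integrable hq1 j).norm.mul_const (γ n)).mono'
      (measurable_mat_apply (h.measC j) (measurable_trunc (h.measY j) _)).aestronglyMeasurable
      (Eventually.of_forall fun ω => ((C j ω).le_opNorm _).trans ?_)
    refine mul_le_mul_of_nonneg_left ?_ (norm_nonneg _)
    split_ifs with hc
    · exact hc
    · rw [norm_zero]; exact hg.le
  have hmain : Tendsto (fun n : ℕ => ((n:ℝ) / γ n) •
      ∫ ω, ∑ j ∈ F, C j ω (if ‖Y j ω‖ ≤ γ n then Y j ω else 0) ∂P) atTop (𝓝 0) := by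
    have h1 : Tendsto (fun n : ℕ => ∑ j ∈ F, (∫ ω, C j ω ∂P) (((n:ℝ) / γ n) •
        ∫ ω, (if ‖Y j ω‖ ≤ γ n then Y j ω else 0) ∂P)) atTop (𝓝 (∑ j ∈ F, (∫ ω, C j ω ∂P) 0)) :=
      tendsto_finsetSum _ fun j _ => ((∫ ω, C j ω ∂P).continuous.tendsto 0).comp (hY j)
    simp only [map_zero, Finset.sum_const_zero] at h1
    refine h1.congr' ?_
    filter_upwards [hG.tendsto.eventually_gt_atTop 0] with n hg
    rw [integral_finsetSum _ fun j _ => hsi n hg j, Finset.smul_sum]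
    refine Finset.sum_congr rfl fun j _ => ?_
    rw [map_smul]
    congr 1
    exact ((hind n j).integral_bilin (h.integrable hq1 j) (hτi n hg j)
      (ContinuousLinearMap.id ℝ (Mat d p))).symm
  -- An exponent strictly between α and q makes the q-th truncated moment of Y_j of order γ_n^q
  -- V(γ_n).
  have hYtail : ∀ j, TailBound P V ((α + q) / 2) (fun ω => ‖Y j ω‖) := fun j =>
    hG.rv.tailBound (h.tail j) (by linarith)
  choose K x₀ hK hx₀ hle using fun j => (hYtail j).trunc_moment hG.rv.pos (h.measY j).norm
    (fun ω => norm_nonneg _) hq0 (by linarith)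
  set B : ℝ := ∑ k ∈ F, ∑ j ∈ F, (1 + ∫ ω, ‖C j ω‖ ∂P) +
    y ^ (1 - q) * (F.card : ℝ) ^ (q - 1) * ∑ j ∈ F, (∫ ω, ‖C j ω‖ ^ q ∂P) * K j with hB
  have herr : ∀ᶠ n : ℕ in atTop, ‖∫ ω, (if ‖∑ j ∈ F, C j ω (Y j ω)‖ ≤ γ n * y then
      ∑ j ∈ F, C j ω (Y j ω) else 0) ∂P -
      ∫ ω, ∑ j ∈ F, C j ω (if ‖Y j ω‖ ≤ γ n then Y j ω else 0) ∂P‖ ≤ B * (γ n * V (γ n)) := by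
    have hall : ∀ᶠ n in atTop, ∀ j ∈ F, x₀ j ≤ γ n :=
      (Finset.eventually_all F).2 fun j _ => hG.tendsto.eventually_ge_atTop _
    filter_upwards [hG.tendsto.eventually_gt_atTop 0, hall] with n hg hall
    have hVg := hG.rv.pos (γ n)
    have hWi : Integrable (fun ω => (if ‖∑ j ∈ F, C j ω (Y j ω)‖ ≤ γ n * y then
        ∑ j ∈ F, C j ω (Y j ω) else 0)) P :=
      (integrable_const (γ n)).mono' (measurable_trunc hW _).aestronglyMeasurable
        (Eventually.of_forall fun ω => (trunc_norm_le _ hg.le hy1).trans (min_le_right _ _))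
    have hms : ∀ k, MeasurableSet {ω | γ n < ‖Y k ω‖} := fun k =>
      measurableSet_lt measurable_const (h.measY k).norm
    have hI1 : ∀ k, Integrable (fun ω => if γ n < ‖Y k ω‖ then (1:ℝ) else 0) P := fun k =>
      (integrable_const (1:ℝ)).mono' (Measurable.ite (hms k) measurable_const
        measurable_const).aestronglyMeasurable (Eventually.of_forall fun ω => by
          split_ifs <;> simp)
    have hC1 : ∀ j, Integrable (fun ω => (1 + ‖C j ω‖) * γ n) P := fun j =>
      ((integrable_const 1).add (h.integrable hq1 j).norm).mul_const _
    have hi1 : ∀ k j, IndepFun (fun ω => (1 + ‖C j ω‖) * γ n)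
        (fun ω => if γ n < ‖Y k ω‖ then (1:ℝ) else 0) P := fun k j =>
      (h.indep j k).comp (φ := fun c => (1 + ‖c‖) * γ n)
        (ψ := fun z => if γ n < ‖z‖ then (1:ℝ) else 0) (by fun_prop)
        (Measurable.ite (measurableSet_lt measurable_const measurable_norm) measurable_const
          measurable_const)
    have hM : ∀ j, Measurable fun ω => min ‖Y j ω‖ (γ n) ^ q := fun j =>
      ((h.measY j).norm.min measurable_const).pow_const q
    have hmin : ∀ j ω, 0 ≤ min ‖Y j ω‖ (γ n) := fun j ω => le_min (norm_nonneg _) hg.le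
    have hI2 : ∀ j, Integrable (fun ω => min ‖Y j ω‖ (γ n) ^ q) P := fun j =>
      (integrable_const (γ n ^ q)).mono' (hM j).aestronglyMeasurable (Eventually.of_forall fun ω => by
        rw [Real.norm_of_nonneg (Real.rpow_nonneg (hmin j ω) _)]
        exact Real.rpow_le_rpow (hmin j ω) (min_le_right _ _) hq0.le)
    have hi2 : ∀ j, IndepFun (fun ω => ‖C j ω‖ ^ q) (fun ω => min ‖Y j ω‖ (γ n) ^ q) P := fun j =>
      (h.indep j j).comp (φ := fun c => ‖c‖ ^ q) (ψ := fun z => min ‖z‖ (γ n) ^ q) (by fun_prop)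
        ((measurable_norm.min measurable_const).pow_const q)
    have hp1 : ∀ k j, Integrable (fun ω => (1 + ‖C j ω‖) * γ n *
        (if γ n < ‖Y k ω‖ then (1:ℝ) else 0)) P := fun k j => (hi1 k j).integrable_mul (hC1 j) (hI1 k)
    have hp2 : ∀ j, Integrable (fun ω => ‖C j ω‖ ^ q * min ‖Y j ω‖ (γ n) ^ q) P := fun j =>
      (hi2 j).integrable_mul (h.integrable_rpow hq0.le j) (hI2 j)
    have hs1 : Integrable (fun ω => ∑ k ∈ F, ∑ j ∈ F, (1 + ‖C j ω‖) * γ n *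
        (if γ n < ‖Y k ω‖ then (1:ℝ) else 0)) P :=
      integrable_finsetSum _ fun k _ => integrable_finsetSum _ fun j _ => hp1 k j
    have hs2 : Integrable (fun ω => (γ n * y) ^ (1 - q) * (F.card : ℝ) ^ (q - 1) *
        ∑ j ∈ F, ‖C j ω‖ ^ q * min ‖Y j ω‖ (γ n) ^ q) P :=
      (integrable_finsetSum _ fun j _ => hp2 j).const_mul _
    rw [← integral_sub hWi (integrable_finsetSum _ fun j _ => hsi n hg j)]
    refine (norm_integral_le_integral_norm _).trans ((integral_mono_of_nonneg
      (Eventually.of_forall fun ω => norm_nonneg _) (hs1.add hs2) (Eventually.of_forall fun ω =>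
        norm_truncation_diff_le F (fun j => C j ω) (fun j => Y j ω) hg hy0 hy1 hq1)).trans ?_)
    rw [integral_add' hs1 hs2, integral_const_mul, integral_finsetSum _ fun k _ =>
      integrable_finsetSum _ fun j _ => hp1 k j, integral_finsetSum _ fun j _ => hp2 j]
    have e1 : ∀ k, ∫ ω, ∑ j ∈ F, (1 + ‖C j ω‖) * γ n * (if γ n < ‖Y k ω‖ then (1:ℝ) else 0) ∂P =
        (∑ j ∈ F, (1 + ∫ ω, ‖C j ω‖ ∂P)) * (γ n * V (γ n)) := by
      intro k
      rw [integral_finsetSum _ fun j _ => hp1 k j, Finset.sum_mul]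
      refine Finset.sum_congr rfl fun j _ => ?_
      have h1 := (hi1 k j).integral_fun_mul_eq_mul_integral (hC1 j).aestronglyMeasurable
        (hI1 k).aestronglyMeasurable
      have h2 : ∫ ω, (if γ n < ‖Y k ω‖ then (1:ℝ) else 0) ∂P = V (γ n) := by
        rw [← h.tail k, ← integral_indicator_one (hms k)]
        rfl
      rw [h1, h2, integral_mul_const, integral_add (integrable_const _) (h.integrable hq1 j).norm]
      simp; ring
    have e2 : ∀ j ∈ F, ∫ ω, ‖C j ω‖ ^ q * min ‖Y j ω‖ (γ n) ^ q ∂P ≤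
        (∫ ω, ‖C j ω‖ ^ q ∂P) * K j * (γ n ^ q * V (γ n)) := by
      intro j hj
      have h1 := (hi2 j).integral_fun_mul_eq_mul_integral
        (h.integrable_rpow hq0.le j).aestronglyMeasurable (hI2 j).aestronglyMeasurable
      rw [h1, mul_assoc, ← mul_assoc (K j)]
      exact mul_le_mul_of_nonneg_left (hle j (γ n) (hall j hj))
        (integral_nonneg fun ω => by positivity)
    rw [Finset.sum_congr rfl fun k _ => e1 k, ← Finset.sum_mul, hB, add_mul]
    refine add_le_add le_rfl ((mul_le_mul_of_nonneg_left (Finset.sum_le_sum e2)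
      (by positivity)).trans (le_of_eq ?_))
    rw [← Finset.sum_mul, Real.mul_rpow hg.le hy0.le]
    have : γ n ^ (1 - q) * γ n ^ q = γ n := by rw [← Real.rpow_add hg]; norm_num
    linear_combination (y ^ (1 - q) * (F.card : ℝ) ^ (q - 1) *
      (∑ j ∈ F, (∫ ω, ‖C j ω‖ ^ q ∂P) * K j) * V (γ n)) * this
  have hB1 : Tendsto (fun n : ℕ => B * (n * V (γ n))) atTop (𝓝 0) := by
    simpa using hG.nV.const_mul B
  have hdiff : Tendsto (fun n : ℕ => ((n:ℝ) / γ n) • (∫ ω, (if ‖∑ j ∈ F, C j ω (Y j ω)‖ ≤ γ n * y then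
      ∑ j ∈ F, C j ω (Y j ω) else 0) ∂P -
      ∫ ω, ∑ j ∈ F, C j ω (if ‖Y j ω‖ ≤ γ n then Y j ω else 0) ∂P)) atTop (𝓝 0) := by
    refine squeeze_zero_norm' ?_ hB1
    filter_upwards [herr, hG.tendsto.eventually_gt_atTop 0] with n he hg
    rw [norm_smul, Real.norm_of_nonneg (by positivity)]
    refine (mul_le_mul_of_nonneg_left he (by positivity)).trans (le_of_eq ?_)
    field_simp
  have := hdiff.add hmain
  simpa [smul_sub] using this

/-- Truncated absolute means, from those of the vectors `Y_j`. -/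
theorem abs_mean_of_one_le (h : Coeffs P V q C Y) (hG : GammaTail V α γ) (hα : 1 ≤ α) (hq : α < q)
    (hY : ∀ j, Tendsto (fun n : ℕ => (n:ℝ) / γ n *
      ∫ ω, (if ‖Y j ω‖ ≤ γ n then ‖Y j ω‖ else 0) ∂P) atTop (𝓝 0))
    (F : Finset ι) {y : ℝ} (hy1 : y ≤ 1) :
    Tendsto (fun n : ℕ => (n:ℝ) / γ n * ∫ ω, (if ‖∑ j ∈ F, C j ω (Y j ω)‖ ≤ γ n * y then
      ‖∑ j ∈ F, C j ω (Y j ω)‖ else 0) ∂P) atTop (𝓝 0) := by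
  have hq1 : 1 ≤ q := by linarith
  have hlim : Tendsto (fun n : ℕ => ∑ j ∈ F, ((n * V (γ n)) + (∫ ω, ‖C j ω‖ ∂P) * ((n:ℝ) / γ n *
      ∫ ω, (if ‖Y j ω‖ ≤ γ n then ‖Y j ω‖ else 0) ∂P))) atTop (𝓝 0) := by
    have := tendsto_finsetSum F fun j _ => hG.nV.add ((hY j).const_mul (∫ ω, ‖C j ω‖ ∂P))
    simpa using this
  have hnn0 : ∀ {n : ℕ} (ω : Ω), 0 ≤ (if ‖∑ j ∈ F, C j ω (Y j ω)‖ ≤ γ n * y then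
      ‖∑ j ∈ F, C j ω (Y j ω)‖ else 0) := fun ω => by split_ifs <;> positivity
  refine squeeze_zero' ?_ ?_ hlim
  · filter_upwards [hG.tendsto.eventually_gt_atTop 0] with n hg
    exact mul_nonneg (by positivity) (integral_nonneg hnn0)
  filter_upwards [hG.tendsto.eventually_gt_atTop 0] with n hg
  have hms : ∀ k, MeasurableSet {ω | γ n < ‖Y k ω‖} := fun k =>
    measurableSet_lt measurable_const (h.measY k).norm
  have hI1 : ∀ k, Integrable (fun ω => if γ n < ‖Y k ω‖ then γ n else 0) P := fun k =>
    (integrable_const (γ n)).mono' (Measurable.ite (hms k) measurable_const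
      measurable_const).aestronglyMeasurable (Eventually.of_forall fun ω => by
        split_ifs <;> simp [abs_of_pos hg, hg.le])
  have hI2 : ∀ j, Integrable (fun ω => if ‖Y j ω‖ ≤ γ n then ‖Y j ω‖ else 0) P := fun j =>
    (integrable_const (γ n)).mono' (Measurable.ite (measurableSet_le (h.measY j).norm
      measurable_const) (h.measY j).norm measurable_const).aestronglyMeasurable
      (Eventually.of_forall fun ω => by
        split_ifs with hc
        · simpa using hc
        · simpa using hg.le)
  have hi : ∀ j, IndepFun (fun ω => ‖C j ω‖) (fun ω => if ‖Y j ω‖ ≤ γ n then ‖Y j ω‖ else 0) P :=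
    fun j => (h.indep j j).comp (φ := fun c => ‖c‖) (ψ := fun z => if ‖z‖ ≤ γ n then ‖z‖ else 0)
      measurable_norm (Measurable.ite (measurableSet_le measurable_norm measurable_const)
        measurable_norm measurable_const)
  have hp : ∀ j, Integrable (fun ω => ‖C j ω‖ * (if ‖Y j ω‖ ≤ γ n then ‖Y j ω‖ else 0)) P :=
    fun j => (hi j).integrable_mul (h.integrable hq1 j).norm (hI2 j)
  -- If some |Y_k| exceeds γ_n, the truncated norm is at most γ_n and is charged to that k.
  -- Otherwise the triangle inequality applies with all Y_j untruncated.
  have hpt : ∀ ω, (if ‖∑ j ∈ F, C j ω (Y j ω)‖ ≤ γ n * y then ‖∑ j ∈ F, C j ω (Y j ω)‖ else 0) ≤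
      ∑ j ∈ F, ((if γ n < ‖Y j ω‖ then γ n else 0) +
        ‖C j ω‖ * (if ‖Y j ω‖ ≤ γ n then ‖Y j ω‖ else 0)) := by
    intro ω
    have hnn : ∀ j ∈ F, 0 ≤ (if γ n < ‖Y j ω‖ then γ n else 0) +
        ‖C j ω‖ * (if ‖Y j ω‖ ≤ γ n then ‖Y j ω‖ else 0) := fun j _ => by positivity
    split_ifs with hc
    · by_cases hall : ∀ j ∈ F, ‖Y j ω‖ ≤ γ n
      · refine (norm_sum_le _ _).trans (Finset.sum_le_sum fun j hj => ((C j ω).le_opNorm _).trans ?_)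
        rw [if_pos (hall j hj), if_neg (not_lt.2 (hall j hj)), zero_add]
      · push Not at hall
        obtain ⟨k, hk, hYk⟩ := hall
        refine le_trans ?_ (Finset.single_le_sum hnn hk)
        rw [if_pos hYk]
        have h1 := hc.trans (mul_le_of_le_one_right hg.le hy1)
        refine h1.trans (le_add_of_nonneg_right (by positivity))
    · exact Finset.sum_nonneg hnn
  have h1 : ∫ ω, (if ‖∑ j ∈ F, C j ω (Y j ω)‖ ≤ γ n * y then
      ‖∑ j ∈ F, C j ω (Y j ω)‖ else 0) ∂P ≤ ∑ j ∈ F, (γ n * V (γ n) + (∫ ω, ‖C j ω‖ ∂P) *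
        ∫ ω, (if ‖Y j ω‖ ≤ γ n then ‖Y j ω‖ else 0) ∂P) := by
    refine (integral_mono_of_nonneg (Eventually.of_forall fun ω => ?_)
      (integrable_finsetSum _ fun j _ => (hI1 j).add (hp j)) (Eventually.of_forall hpt)).trans
      (le_of_eq ?_)
    · exact hnn0 ω
    · rw [integral_finsetSum _ fun j _ => (hI1 j).add (hp j)]
      refine Finset.sum_congr rfl fun j _ => ?_
      rw [integral_add' (hI1 j) (hp j)]
      have h2 : ∫ ω, (if γ n < ‖Y j ω‖ then γ n else 0) ∂P = γ n * V (γ n) := by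
        have := integral_indicator_const (μ := P) (γ n) (hms j)
        rw [h.tail j, smul_eq_mul, mul_comm] at this
        rw [← this]; rfl
      rw [h2, (hi j).integral_fun_mul_eq_mul_integral (h.integrable hq1 j).norm.aestronglyMeasurable
        (hI2 j).aestronglyMeasurable]
  refine (mul_le_mul_of_nonneg_left h1 (by positivity)).trans (le_of_eq ?_)
  rw [Finset.mul_sum]
  refine Finset.sum_congr rfl fun j _ => ?_
  field_simp

end Coeffs

end RCLP

/-! ### From the hypotheses to i.i.d. pairs of coefficient rows and noise -/

namespace RCLP

variable {Ω : Type*} [MeasurableSpace Ω] {d p : ℕ}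

/-- The index window `{-M, …, M}`. -/
noncomputable abbrev window (M : ℕ) : Finset ℤ := Finset.Icc (-(M : ℤ)) M

theorem mem_window {M : ℕ} {j : ℤ} : j ∈ window M ↔ |j| ≤ (M:ℤ) := by
  rw [Finset.mem_Icc, abs_le]

/-- The properties of the coefficients and the noise that the limit theorems rest on. -/
structure Setup (P : Measure Ω) (A : ℤ → ℤ → Ω → Mat d p) (Z : ℤ → Ω → Vec p) (V : ℝ → ℝ)
    (α q : ℝ) (γ : ℕ → ℝ) : Prop where
  growth : GammaTail V α γ
  lt_q : α < q
  measA : ∀ k j, Measurable (A k j)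
  measZ : ∀ k, Measurable (Z k)
  tail : ∀ k u, P.real {ω | u < ‖Z k ω‖} = V u
  indepZ : iIndepFun Z P
  indepAZ : IndepFun (fun ω k j => A k j ω) (fun ω k => Z k ω) P
  indepU : iIndepFun (fun (k : ℤ) ω => ((fun j => A k j ω : ℤ → Mat d p), Z k ω)) P
  identU : ∀ k : ℤ, IdentDistrib (fun ω => ((fun j => A k j ω : ℤ → Mat d p), Z k ω))
    (fun ω => ((fun j => A 0 j ω : ℤ → Mat d p), Z 0 ω)) P P
  moment : ∀ k j, ∫⁻ ω, ‖A k j ω‖ₑ ^ q ∂P < ∞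
  mean : 1 ≤ α → ∀ k, Tendsto (fun n : ℕ => ((n:ℝ) / γ n) •
    ∫ ω, (if ‖Z k ω‖ ≤ γ n then Z k ω else 0) ∂P) atTop (𝓝 0)

/-- Comparison with the largest term handles q < 1 and q ≥ 1 alike. -/
theorem ENNReal_sum_rpow_le {ι : Type*} (F : Finset ι) (a : ι → ℝ≥0∞) {q : ℝ} (hq : 0 < q) :
    (∑ j ∈ F, a j) ^ q ≤ (F.card : ℝ≥0∞) ^ q * ∑ j ∈ F, a j ^ q := by
  rcases F.eq_empty_or_nonempty with rfl | hF
  · simp [hq]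
  obtain ⟨k, hk, hmax⟩ := F.exists_max_image a hF
  have h1 : ∑ j ∈ F, a j ≤ F.card * a k := by
    simpa using Finset.sum_le_card_nsmul F a (a k) hmax
  refine (ENNReal.rpow_le_rpow h1 hq.le).trans ?_
  rw [ENNReal.mul_rpow_of_nonneg _ _ hq.le]
  exact mul_le_mul_right (Finset.single_le_sum (f := fun j => a j ^ q) (fun j _ => zero_le) hk) _

theorem lintegral_sum_rpow_lt_top {P : Measure Ω} {ι : Type*} (F : Finset ι)
    {a : ι → Ω → ℝ≥0∞} (ha : ∀ j, Measurable (a j)) {q : ℝ} (hq : 0 < q)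
    (h : ∀ j, ∫⁻ ω, a j ω ^ q ∂P < ∞) : ∫⁻ ω, (∑ j ∈ F, a j ω) ^ q ∂P < ∞ := by
  refine lt_of_le_of_lt (lintegral_mono fun ω => ENNReal_sum_rpow_le F (fun j => a j ω) hq) ?_
  rw [lintegral_const_mul' _ _ (ENNReal.rpow_ne_top_of_nonneg hq.le (ENNReal.natCast_ne_top _)),
    lintegral_finsetSum _ fun j _ => (ha j).pow_const q]
  exact ENNReal.mul_lt_top (ENNReal.rpow_lt_top_of_nonneg hq.le (ENNReal.natCast_ne_top _))
    (ENNReal.sum_lt_top.2 fun j _ => h j)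

theorem ENNReal_rpow_le_one_add {x : ℝ≥0∞} {a q : ℝ} (ha : 0 ≤ a) (haq : a ≤ q) :
    x ^ a ≤ 1 + x ^ q := by
  rcases le_total x 1 with hx | hx
  · exact (ENNReal.rpow_le_one hx ha).trans le_self_add
  · exact (ENNReal.rpow_le_rpow_of_exponent_le hx haq).trans le_add_self

theorem lintegral_rpow_lt_top_of_le {P : Measure Ω} [IsProbabilityMeasure P] {f : Ω → ℝ≥0∞} {a q : ℝ}
    (ha : 0 ≤ a) (haq : a ≤ q) (h : ∫⁻ ω, f ω ^ q ∂P < ∞) : ∫⁻ ω, f ω ^ a ∂P < ∞ := by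
  refine lt_of_le_of_lt (lintegral_mono fun ω => ENNReal_rpow_le_one_add ha haq) ?_
  rw [lintegral_add_left measurable_const, lintegral_const, measure_univ, mul_one]
  exact ENNReal.add_lt_top.2 ⟨ENNReal.one_lt_top, h⟩

theorem Model.identDistrib_row {P : Measure Ω} {A : ℤ → ℤ → Ω → Mat d p} {Z : ℤ → Ω → Vec p}
    (h : Model P A Z) (k : ℤ) :
    IdentDistrib (fun ω j => A k j ω) (fun ω j => A 0 j ω) P P := by
  have := (h.stationary_A k).comp (u := fun x : ℤ → ℤ → Mat d p => x 0) (measurable_pi_apply 0)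
  simpa [Function.comp_def] using this

theorem Model.identDistrib_entry {P : Measure Ω} {A : ℤ → ℤ → Ω → Mat d p} {Z : ℤ → Ω → Vec p}
    (h : Model P A Z) (k j : ℤ) : IdentDistrib (A k j) (A 0 j) P P :=
  (h.identDistrib_row k).comp (u := fun x : ℤ → Mat d p => x j) (measurable_pi_apply j)

/-- In all cases the moment condition yields a moment of order larger than `α` of each
coefficient. -/
theorem Hyp.exists_moment {P : Measure Ω} {A : ℤ → ℤ → Ω → Mat d p}
    {Z : ℤ → Ω → Vec p} {μ : Measure (Vec p)} {α : ℝ} {γ : ℕ → ℝ} (h : Hyp P A Z μ α γ) :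
    ∃ q : ℝ, α < q ∧ ∀ k j, ∫⁻ ω, ‖A k j ω‖ₑ ^ q ∂P < ∞ := by
  obtain ⟨ε, hε, hεα, h1, h2, h3⟩ := h.moment
  refine ⟨α + ε, by linarith, fun k j => ?_⟩
  have hα := h.regVar.index_pos
  have hid := ((h.model.identDistrib_entry k j).comp (u := fun x : Mat d p => ‖x‖ₑ ^ (α + ε))
    (by fun_prop)).lintegral_eq
  change ∫⁻ ω, ‖A k j ω‖ₑ ^ (α + ε) ∂P = ∫⁻ ω, ‖A 0 j ω‖ₑ ^ (α + ε) ∂P at hid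
  rw [hid]
  rcases lt_trichotomy α 2 with hlt | heq | hgt
  · by_cases hone : α = 1
    · refine lt_of_le_of_lt (lintegral_mono fun ω => ?_) (h2 (Or.inl hone))
      -- One summand is at most the whole sum, and the outer power turns its exponent α - ε into α +
      -- ε.
      have hle := ENNReal.le_tsum (f := fun j : ℤ => ‖A 0 j ω‖ₑ ^ (α - ε)) j
      refine le_trans (le_of_eq ?_) (ENNReal.rpow_le_rpow hle
        (show 0 ≤ (α + ε) / (α - ε) from div_nonneg (by linarith) (by linarith)))
      rw [← ENNReal.rpow_mul, mul_div_cancel₀ _ (by linarith)]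
    · exact lt_of_le_of_lt (ENNReal.le_tsum (f := fun j : ℤ => ∫⁻ ω, ‖A 0 j ω‖ₑ ^ (α + ε) ∂P) j)
        (h1 hlt hone).2
  · refine lt_of_le_of_lt (lintegral_mono fun ω => ?_) (h2 (Or.inr heq))
    have hle := ENNReal.le_tsum (f := fun j : ℤ => ‖A 0 j ω‖ₑ ^ (α - ε)) j
    refine le_trans (le_of_eq ?_) (ENNReal.rpow_le_rpow hle
      (show 0 ≤ (α + ε) / (α - ε) from div_nonneg (by linarith) (by linarith)))
    rw [← ENNReal.rpow_mul, mul_div_cancel₀ _ (by linarith)]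
  · refine lt_of_le_of_lt (lintegral_mono fun ω => ?_) (h3 hgt)
    have hle := ENNReal.le_tsum (f := fun j : ℤ => ‖A 0 j ω‖ₑ ^ (2:ℝ)) j
    refine le_trans (le_of_eq ?_) (ENNReal.rpow_le_rpow hle
      (show 0 ≤ (α + ε) / 2 from div_nonneg (by linarith) (by linarith)))
    rw [← ENNReal.rpow_mul, mul_div_cancel₀ _ (by norm_num)]

theorem Hyp.tail_eq {P : Measure Ω} {A : ℤ → ℤ → Ω → Mat d p}
    {Z : ℤ → Ω → Vec p} {μ : Measure (Vec p)} {α : ℝ} {γ : ℕ → ℝ} (h : Hyp P A Z μ α γ) (k : ℤ)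
    (u : ℝ) : P.real {ω | u < ‖Z k ω‖} = P.real {ω | u < ‖Z 0 ω‖} :=
  congrArg ENNReal.toReal ((h.model.ident_Z k).measure_mem_eq (measurableSet_norm_gt u))

theorem Hyp.gammaTail {P : Measure Ω} [IsProbabilityMeasure P] {A : ℤ → ℤ → Ω → Mat d p}
    {Z : ℤ → Ω → Vec p} {μ : Measure (Vec p)} {α : ℝ} {γ : ℕ → ℝ} (h : Hyp P A Z μ α γ) :
    GammaTail (fun u => P.real {ω | u < ‖Z 0 ω‖}) α γ := by
  have hV := h.regVar.rvTail (h.model.meas_Z 0)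
  obtain ⟨h1, h2⟩ := weakLaw_consequences hV h.tail_eq h.model.meas_Z h.model.indep_Z
    h.model.ident_Z h.gamma.pos h.gamma.tendsto_zero
  exact ⟨hV, h1, h2, h.gamma.two, h.gamma.gt_two⟩

theorem integrable_trunc {P : Measure Ω} [IsProbabilityMeasure P] {m : ℕ} {W : Ω → Vec m}
    (hW : Measurable W) (x : ℝ) : Integrable (fun ω => if ‖W ω‖ ≤ x then W ω else 0) P := by
  refine (integrable_const |x|).mono' (Coeffs.measurable_trunc hW _).aestronglyMeasurable
    (Eventually.of_forall fun ω => ?_)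
  split_ifs with hc
  · exact hc.trans (le_abs_self x)
  · rw [norm_zero]; exact abs_nonneg x

/-- For α = 1 the weak law controls each coordinate. For α > 1 centring turns the truncated mean
into minus the mean over {|Z| > γ_n}, which is O(γ_n V(γ_n)). -/
theorem Hyp.tendsto_truncated_mean {P : Measure Ω} [IsProbabilityMeasure P]
    {A : ℤ → ℤ → Ω → Mat d p} {Z : ℤ → Ω → Vec p} {μ : Measure (Vec p)} {α : ℝ} {γ : ℕ → ℝ}
    (h : Hyp P A Z μ α γ) (hα : 1 ≤ α) :
    Tendsto (fun n : ℕ => ((n:ℝ) / γ n) • ∫ ω, (if ‖Z 0 ω‖ ≤ γ n then Z 0 ω else 0) ∂P)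
      atTop (𝓝 0) := by
  have hG := h.gammaTail
  have hm := h.model.meas_Z
  rcases hα.eq_or_lt with hα1 | hα1
  · have hco : ∀ i : Fin p, Measurable fun x : Vec p => x i := fun i => by fun_prop
    have hi : ∀ i : Fin p, Tendsto (fun n : ℕ =>
        |(n:ℝ) / γ n * ∫ ω, (if ‖Z 0 ω‖ ≤ γ n then Z 0 ω i else 0) ∂P|) atTop (𝓝 0) := by
      intro i
      have := RCLP.tendsto_truncated_mean hG.rv (by linarith) h.tail_eq hm h.model.indep_Z
        h.model.ident_Z hG.tendsto hG.nV (hco i) (fun z => abs_apply_le_norm z i) (fun e he => by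
          refine squeeze_zero (fun _ => measureReal_nonneg) (fun n => measureReal_mono ?_)
            (tendstoInMeasure_real h.gamma.tendsto_zero he)
          intro ω hω
          have h1 : e ≤ |(γ n)⁻¹ * ∑ k ∈ Finset.Icc 1 n, Z (k : ℤ) ω i| := hω
          refine h1.trans ?_
          have := abs_apply_le_norm ((γ n)⁻¹ • ∑ k ∈ Finset.Icc 1 n, Z (k : ℤ) ω) i
          simpa using this)
      simpa using this.abs
    have hsum := tendsto_finsetSum Finset.univ fun i _ => hi i
    rw [Finset.sum_const_zero] at hsum
    refine squeeze_zero_norm (fun n => ?_) hsum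
    refine (norm_le_sum_abs _).trans (le_of_eq (Finset.sum_congr rfl fun i _ => ?_))
    have h2 : ∫ ω, (if ‖Z 0 ω‖ ≤ γ n then Z 0 ω else 0) i ∂P =
        (∫ ω, (if ‖Z 0 ω‖ ≤ γ n then Z 0 ω else 0) ∂P) i :=
      (EuclideanSpace.proj i : Vec p →L[ℝ] ℝ).integral_comp_comm (integrable_trunc (hm 0) (γ n))
    have h3 : ∀ ω, (if ‖Z 0 ω‖ ≤ γ n then Z 0 ω else 0) i =
        if ‖Z 0 ω‖ ≤ γ n then Z 0 ω i else 0 := fun ω => by split_ifs <;> rfl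
    simp only [h3] at h2
    rw [h2]
    rfl
  · obtain ⟨hint, hzero⟩ := h.centered hα1
    obtain ⟨C, x₀, hC, hx₀, hle⟩ := hG.rv.integral_gt_le hα1 (hm 0).norm
      (fun ω => norm_nonneg _) (h.tail_eq 0)
    have h1 := hG.nV.const_mul C
    rw [mul_zero] at h1
    refine squeeze_zero_norm' ?_ h1
    filter_upwards [hG.tendsto.eventually_ge_atTop x₀] with n hg
    have hg0 : 0 < γ n := by linarith
    have hms : MeasurableSet {ω | γ n < ‖Z 0 ω‖} := measurableSet_lt measurable_const (hm 0).norm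
    have e1 : ∫ ω, (if ‖Z 0 ω‖ ≤ γ n then Z 0 ω else 0) ∂P =
        -∫ ω, Set.indicator {ω | γ n < ‖Z 0 ω‖} (Z 0) ω ∂P := by
      rw [eq_neg_iff_add_eq_zero, ← integral_add (integrable_trunc (hm 0) _) (hint.indicator hms)]
      refine Eq.trans ?_ hzero
      refine integral_congr_ae (Eventually.of_forall fun ω => ?_)
      by_cases hc : ‖Z 0 ω‖ ≤ γ n
      · simp [hc]
      · simp [hc, Set.indicator_of_mem (show ω ∈ {ω | γ n < ‖Z 0 ω‖} from not_le.1 hc)]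
    rw [e1, norm_smul, norm_neg, Real.norm_of_nonneg (by positivity)]
    have h2 : ‖∫ ω, Set.indicator {ω | γ n < ‖Z 0 ω‖} (Z 0) ω ∂P‖ ≤ C * γ n * P.real {ω | γ n < ‖Z 0 ω‖} := by
      refine (norm_integral_le_integral_norm _).trans (le_trans (le_of_eq ?_) (hle (γ n) hg))
      refine integral_congr_ae (Eventually.of_forall fun ω => ?_)
      exact norm_indicator_eq_indicator_norm _ _
    refine (mul_le_mul_of_nonneg_left h2 (by positivity)).trans (le_of_eq ?_)
    field_simp

/-- Independence of the rows, joined to that of the noise, makes the pairs (𝐀_k, Z_k) i.i.d.;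
stationarity and independence of the two sequences identify their common law as a product. -/
theorem Hyp.setup {P : Measure Ω} [IsProbabilityMeasure P] {A : ℤ → ℤ → Ω → Mat d p}
    {Z : ℤ → Ω → Vec p} {μ : Measure (Vec p)} {α : ℝ} {γ : ℕ → ℝ} (h : Hyp P A Z μ α γ)
    (hA : iIndepFun (fun (k : ℤ) ω (j : ℤ) => A k j ω) P) :
    ∃ q, Setup P A Z (fun u => P.real {ω | u < ‖Z 0 ω‖}) α q γ := by
  obtain ⟨q, hq, hmom⟩ := h.exists_moment
  have hmA : ∀ k, Measurable fun ω (j : ℤ) => A k j ω := fun k =>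
    measurable_pi_iff.2 fun j => h.model.meas_A k j
  have hmZ := h.model.meas_Z
  refine ⟨q, h.gammaTail, hq, h.model.meas_A, hmZ, h.tail_eq, h.model.indep_Z, h.model.indep_A_Z,
    iIndepFun_prodMk hmA hmZ hA h.model.indep_Z h.model.indep_A_Z, fun k => ?_, hmom,
    fun hα k => ?_⟩
  · have hlaw : ∀ k, P.map (fun ω => ((fun j => A k j ω : ℤ → Mat d p), Z k ω)) =
        (P.map fun ω j => A k j ω).prod (P.map (Z k)) := fun k =>
      (indepFun_iff_map_prod_eq_prod_map_map (hmA k).aemeasurable (hmZ k).aemeasurable).1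
        (h.model.indep_A_Z.comp (φ := fun x : ℤ → ℤ → Mat d p => x k) (ψ := fun z : ℤ → Vec p => z k)
          (measurable_pi_apply k) (measurable_pi_apply k))
    refine ⟨((hmA k).prodMk (hmZ k)).aemeasurable, ((hmA 0).prodMk (hmZ 0)).aemeasurable, ?_⟩
    rw [hlaw, hlaw, (h.model.identDistrib_row k).map_eq, (h.model.ident_Z k).map_eq]
  · refine (h.tendsto_truncated_mean hα).congr fun n => ?_
    congr 1
    exact ((h.model.ident_Z k).comp (u := fun z => if ‖z‖ ≤ γ n then z else 0)
      (Coeffs.measurable_trunc measurable_id (γ n))).integral_eq.symm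

namespace Setup

variable {P : Measure Ω} {A : ℤ → ℤ → Ω → Mat d p}
    {Z : ℤ → Ω → Vec p} {V : ℝ → ℝ} {α q : ℝ} {γ : ℕ → ℝ}

theorem q_pos (h : Setup P A Z V α q γ) : 0 < q := h.growth.rv.index_pos.trans h.lt_q

theorem coeffs_row (h : Setup P A Z V α q γ) (k : ℤ) :
    Coeffs P V q (fun j => A k j) (fun j => Z (k - j)) where
  measC := h.measA k
  measY j := h.measZ (k - j)
  indep i j := h.indepAZ.comp (φ := fun x : ℤ → ℤ → Mat d p => x k i)
    (ψ := fun z : ℤ → Vec p => z (k - j)) (by fun_prop) (by fun_prop)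
  tail j u := h.tail (k - j) u
  moment := h.moment k

/-- The total weight of the noise vector `Z_i`. -/
noncomputable def weight (A : ℤ → ℤ → Ω → Mat d p) (M : ℕ) (i : ℤ) (ω : Ω) : Mat d p :=
  ∑ j ∈ window M, A (i + j) j ω

theorem measurable_weight (h : Setup P A Z V α q γ) (M : ℕ) (i : ℤ) : Measurable (weight A M i) :=
  Finset.measurable_sum _ fun j _ => h.measA (i + j) j

theorem lintegral_weight_lt_top (h : Setup P A Z V α q γ) (M : ℕ) (i : ℤ) :
    ∫⁻ ω, ‖weight A M i ω‖ₑ ^ q ∂P < ∞ := by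
  have hle : ∀ ω, ‖weight A M i ω‖ₑ ≤ ∑ j ∈ window M, ‖A (i + j) j ω‖ₑ := fun ω => by
    rw [weight]; exact enorm_sum_le (window M) fun j => A (i + j) j ω
  exact lt_of_le_of_lt (lintegral_mono fun ω => ENNReal.rpow_le_rpow (hle ω) h.q_pos.le)
    (lintegral_sum_rpow_lt_top (window M) (a := fun j ω => ‖A (i + j) j ω‖ₑ)
      (fun j => (h.measA (i + j) j).enorm) h.q_pos fun j => h.moment (i + j) j)

/-- A one-point index type turns the single product W_i Z_i into a sum to which the results on
random linear combinations apply. -/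
theorem coeffs_weight (h : Setup P A Z V α q γ) (M : ℕ) (i : ℤ) :
    Coeffs P V q (fun _ : Unit => weight A M i) (fun _ => Z i) where
  measC _ := h.measurable_weight M i
  measY _ := h.measZ i
  indep _ _ := h.indepAZ.comp (φ := fun x : ℤ → ℤ → Mat d p => ∑ j ∈ window M, x (i + j) j)
    (ψ := fun z : ℤ → Vec p => z i) (Finset.measurable_sum _ fun j _ => by fun_prop) (by fun_prop)
  tail _ u := h.tail i u
  moment _ := h.lintegral_weight_lt_top M i

variable [IsProbabilityMeasure P]

/-- The truncated linear process and its `2M`-dependence. -/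
theorem linear_window (h : Setup P A Z V α q γ) (M : ℕ) :
    (∀ c : ℤ, iIndepFun (fun (k : {k : ℤ // k % ((2 * M + 1 : ℕ) : ℤ) = c}) ω =>
      ∑ j ∈ window M, A k j ω (Z (k - j) ω)) P) ∧
    ∀ k : ℤ, IdentDistrib (fun ω => ∑ j ∈ window M, A k j ω (Z (k - j) ω))
      (fun ω => ∑ j ∈ window M, A 0 j ω (Z (0 - j) ω)) P P := by
  set U : ℤ → Ω → (ℤ → Mat d p) × Vec p := fun k ω => (fun j => A k j ω, Z k ω) with hU
  -- Seen from time k, the coefficients come from offset 0 and the noise from the offsets -j with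
  -- |j| ≤ M.
  set H : (ℤ → (ℤ → Mat d p) × Vec p) → Vec d := fun x =>
    ∑ j ∈ window M, (x 0).1 j ((x (-j)).2) with hH
  have hUm : ∀ k, Measurable (U k) := fun k =>
    (measurable_pi_iff.2 fun j => h.measA k j).prodMk (h.measZ k)
  have hHm : Measurable H := Finset.measurable_sum _ fun j _ =>
    measurable_mat_apply (by fun_prop) (by fun_prop)
  have e : ∀ k : ℤ, (fun ω => H (fun i => U (k + i) ω)) =
      fun ω => ∑ j ∈ window M, A k j ω (Z (k - j) ω) := by
    intro k; ext1 ω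
    simp [hH, hU, sub_eq_add_neg]
  constructor
  · intro c
    have := iIndepFun_shift_residue hUm h.indepU hHm M (fun x y hxy => ?_) c
    · rwa [show (fun (k : {k : ℤ // k % ((2 * M + 1 : ℕ) : ℤ) = c}) ω =>
        H (fun i => U ((k : ℤ) + i) ω)) = _ from funext fun k => e k] at this
    · simp only [hH]
      refine Finset.sum_congr rfl fun j hj => ?_
      have hj' := mem_window.1 hj
      rw [hxy 0 (by simp), hxy (-j) (by simpa using hj')]
  · intro k
    have := identDistrib_shift hUm h.indepU h.identU hHm k
    rw [e, e] at this
    exact this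

/-- W_k uses the rows k - M, ..., k + M and the noise enters at k only, so the jumps are functionals
of the same windows as the process itself. -/
theorem weight_window (h : Setup P A Z V α q γ) (M : ℕ) :
    (∀ c : ℤ, iIndepFun (fun (k : {k : ℤ // k % ((2 * M + 1 : ℕ) : ℤ) = c}) ω =>
      weight A M k ω (Z k ω)) P) ∧
    ∀ k : ℤ, IdentDistrib (fun ω => weight A M k ω (Z k ω))
      (fun ω => weight A M 0 ω (Z 0 ω)) P P := by
  set U : ℤ → Ω → (ℤ → Mat d p) × Vec p := fun k ω => (fun j => A k j ω, Z k ω) with hU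
  set H : (ℤ → (ℤ → Mat d p) × Vec p) → Vec d := fun x =>
    (∑ j ∈ window M, (x j).1 j) ((x 0).2) with hH
  have hUm : ∀ k, Measurable (U k) := fun k =>
    (measurable_pi_iff.2 fun j => h.measA k j).prodMk (h.measZ k)
  have hHm : Measurable H := measurable_mat_apply
    (Finset.measurable_sum _ fun j _ => by fun_prop) (by fun_prop)
  have e : ∀ k : ℤ, (fun ω => H (fun i => U (k + i) ω)) = fun ω => weight A M k ω (Z k ω) := by
    intro k; ext1 ω
    simp [hH, hU, weight]
  constructor
  · intro c
    have := iIndepFun_shift_residue hUm h.indepU hHm M (fun x y hxy => ?_) c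
    · rwa [show (fun (k : {k : ℤ // k % ((2 * M + 1 : ℕ) : ℤ) = c}) ω =>
        H (fun i => U ((k : ℤ) + i) ω)) = _ from funext fun k => e k] at this
    · simp only [hH]
      rw [hxy 0 (by simp), Finset.sum_congr rfl fun j hj => by rw [hxy j (mem_window.1 hj)]]
  · intro k
    have := identDistrib_shift hUm h.indepU h.identU hHm k
    rw [e, e] at this
    exact this

end Setup

end RCLP

/-! ### Small-jump statements and summability of the coefficients -/

namespace RCLP

variable {Ω : Type*} [MeasurableSpace Ω] {d p : ℕ}

/-- The limit in n is 0 for each fixed small ε, so the outer limit is that of a function vanishing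
near 0. Events matter only up to null sets, which lets a finite sum replace the series X_k. -/
theorem tendsto_limsup_of_small {P : Measure Ω} [IsProbabilityMeasure P] {r : ℕ → ℝ}
    (hr : ∀ n, 0 ≤ r n) {E E' : ℝ → ℕ → Set Ω} {ε₀ : ℝ} (hε₀ : 0 < ε₀)
    (hE : ∀ ε, ∀ᶠ n in atTop, E ε n =ᵐ[P] E' ε n)
    (h : ∀ ε, 0 < ε → ε < ε₀ → Tendsto (fun n => r n * P.real (E' ε n)) atTop (𝓝 0)) :
    Tendsto (fun ε => limsup (fun n => ENNReal.ofReal (r n) * P (E ε n)) atTop)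
      (𝓝[>] 0) (𝓝 0) := by
  refine tendsto_const_nhds.congr' ?_
  filter_upwards [Ioo_mem_nhdsGT hε₀] with ε hε
  refine (Tendsto.limsup_eq ?_).symm
  have h1 := ENNReal.tendsto_ofReal (h ε hε.1 hε.2)
  rw [ENNReal.ofReal_zero] at h1
  refine h1.congr' ?_
  filter_upwards [hE ε] with n hn
  rw [measure_congr hn, ENNReal.ofReal_mul (hr n), ofReal_measureReal]

theorem r_nonneg (P : Measure Ω) (Z : ℤ → Ω → Vec p) (γ : ℕ → ℝ) (n : ℕ) : 0 ≤ r P Z γ n :=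
  div_nonneg zero_le_one (mul_nonneg n.cast_nonneg measureReal_nonneg)

/-- The linear process with coefficients restricted to the window `{-M, …, M}`. -/
noncomputable def linear (A : ℤ → ℤ → Ω → Mat d p) (Z : ℤ → Ω → Vec p) (M : ℕ) (k : ℤ) (ω : Ω) :
    Vec d :=
  ∑ j ∈ window M, A k j ω (Z (k - j) ω)

theorem ae_eq_zero_off_window {P : Measure Ω} {A : ℤ → ℤ → Ω → Mat d p} {M : ℕ}
    (hfin : ∀ k j : ℤ, (M : ℤ) < |j| → A k j =ᵐ[P] 0) :
    ∀ᵐ ω ∂P, ∀ k, ∀ j ∉ window M, A k j ω = 0 := by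
  refine ae_all_iff.2 fun k => ae_all_iff.2 fun j => ?_
  by_cases hj : j ∈ window M
  · exact Eventually.of_forall fun ω h => absurd hj h
  · filter_upwards [hfin k j (not_le.1 fun h => hj (mem_window.2 h))] with ω hω _ using hω

theorem ae_X_eq_linear {P : Measure Ω} {A : ℤ → ℤ → Ω → Mat d p} (Z : ℤ → Ω → Vec p) {M : ℕ}
    (hfin : ∀ k j : ℤ, (M : ℤ) < |j| → A k j =ᵐ[P] 0) :
    ∀ᵐ ω ∂P, ∀ k, X A Z k ω = linear A Z M k ω := by
  filter_upwards [ae_eq_zero_off_window hfin] with ω hω k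
  refine tsum_eq_sum fun j hj => ?_
  rw [hω k j hj]
  rfl

/-- Truncation of `|W| - E|W|` at a level tending to infinity is asymptotically centred. -/
theorem tendsto_integral_centred_trunc {P : Measure Ω} [IsProbabilityMeasure P] {W : Ω → Vec d}
    (hW : Integrable W P) {ε : ℝ} (hε : 0 < ε) :
    Tendsto (fun n : ℕ => ∫ ω, (if ‖W ω‖ ≤ n * ε then ‖W ω‖ - ∫ ω', ‖W ω'‖ ∂P else 0) ∂P) atTop
      (𝓝 0) := by
  set c := ∫ ω', ‖W ω'‖ ∂P with hc
  have hc0 : 0 ≤ c := integral_nonneg fun ω => norm_nonneg _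
  clear_value c
  have hnε : Tendsto (fun n : ℕ => (n:ℝ) * ε) atTop atTop :=
    tendsto_natCast_atTop_atTop.atTop_mul_const hε
  have hlim : Tendsto (fun n : ℕ => ∫ ω, (if ‖W ω‖ ≤ n * ε then ‖W ω‖ - c else 0) ∂P) atTop
      (𝓝 (∫ ω, (‖W ω‖ - c) ∂P)) := by
    refine tendsto_integral_of_dominated_convergence (fun ω => ‖W ω‖ + c)
      (fun n => ?_) (hW.norm.add (integrable_const c)) (fun n => Eventually.of_forall fun ω => ?_)
      (Eventually.of_forall fun ω => ?_)
    · have hφ : Measurable fun x : ℝ => if x ≤ n * ε then x - c else 0 :=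
        Measurable.ite measurableSet_Iic (measurable_id.sub measurable_const) measurable_const
      exact (hφ.comp_aemeasurable hW.norm.1.aemeasurable).aestronglyMeasurable
    · have := norm_nonneg (W ω)
      rw [Real.norm_eq_abs]
      split_ifs
      · rw [abs_le]; constructor <;> linarith
      · rw [abs_zero]; positivity
    · refine tendsto_const_nhds.congr' ?_
      filter_upwards [hnε.eventually_ge_atTop ‖W ω‖] with n hn
      rw [if_pos hn]
  rwa [integral_sub hW.norm (integrable_const c), integral_const, probReal_univ, one_smul,
    ← hc, sub_self] at hlim

namespace Setup

section

variable {P : Measure Ω} {A : ℤ → ℤ → Ω → Mat d p}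
    {Z : ℤ → Ω → Vec p} {V : ℝ → ℝ} {α q : ℝ} {γ : ℕ → ℝ}

theorem measurable_linear (h : Setup P A Z V α q γ) (M : ℕ) (k : ℤ) :
    Measurable (linear A Z M k) :=
  (h.coeffs_row k).measurable_sum (window M)

variable [IsProbabilityMeasure P]

theorem hasTail_linear (h : Setup P A Z V α q γ) (M : ℕ) :
    HasTail P V α (fun ω => ‖linear A Z M 0 ω‖) :=
  (h.coeffs_row 0).hasTail_norm h.growth.rv h.lt_q (window M)

theorem integrable_linear (h : Setup P A Z V α q γ) (hα : 1 < α) (M : ℕ) :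
    Integrable (linear A Z M 0) P := by
  refine ⟨(h.measurable_linear M 0).aestronglyMeasurable, ?_⟩
  have := (h.hasTail_linear M).moment_lt_top h.growth.rv (h.measurable_linear M 0).norm
    (fun ω => norm_nonneg _) one_pos hα
  simpa [hasFiniteIntegral_iff_norm] using this

/-- Sums of uniformly small centred functionals of the linear process are negligible. -/
theorem tendsto_abs_sum_linear (h : Setup P A Z V α q γ) (M : ℕ) {φ : ℕ → Vec d → ℝ}
    (hφ : ∀ n, Measurable (φ n)) {c : ℝ} (hc : 0 ≤ c)
    (hφR : ∀ᶠ n in atTop, ∀ x, |φ n x| ≤ min (‖x‖ + c) (γ n)) {y δ : ℝ} (hδ : 0 < δ)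
    (hy : 4 * (2 * M + 1 : ℕ) * y ≤ δ) (hbd : ∀ᶠ n in atTop, ∀ x, |φ n x| ≤ y * γ n)
    (hmean : Tendsto (fun n : ℕ => (n:ℝ) / γ n * ∫ ω, φ n (linear A Z M 0 ω) ∂P) atTop (𝓝 0)) :
    Tendsto (fun n : ℕ => 1 / (n * V (γ n)) * P.real {ω | γ n * δ <
      |∑ k ∈ Finset.Icc 1 n, φ n (linear A Z M (k : ℤ) ω)|}) atTop (𝓝 0) := by
  obtain ⟨hind, hid⟩ := h.linear_window M
  refine h.growth.tendsto_abs_sum (ξ := fun n k ω => φ n (linear A Z M k ω))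
    (R := fun ω => ‖linear A Z M 0 ω‖ + c) (m := 2 * M + 1) (by omega)
    (fun n k => (hφ n).comp (h.measurable_linear M k))
    (fun n c => (hind c).comp (fun _ x => φ n x) fun _ => hφ n)
    (fun n k => (hid k).comp (hφ n)) ((h.hasTail_linear M).add h.growth.rv
      (hasTail_const h.growth.rv c)) ((h.measurable_linear M 0).norm.add_const c)
    (fun ω => by positivity) ?_ hδ hy ?_ hmean
  · filter_upwards [hφR] with n hn ω using hn _
  · filter_upwards [hbd] with n hn k ω using hn _

/-- Truncated absolute means of the linear process vanish under the conditions on `γ`. -/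
theorem abs_mean_linear (h : Setup P A Z V α q γ) (hidZ : ∀ k, IdentDistrib (Z k) (Z 0) P P)
    (M : ℕ) (hcase : α < 1 ∨
      (α = 1 ∧ TendstoInMeasure P
        (fun (n : ℕ) ω => (γ n)⁻¹ * ∑ k ∈ Finset.Icc 1 n, ‖Z (k : ℤ) ω‖)
        atTop (fun _ => (0 : ℝ))) ∨
      (1 < α ∧ Tendsto (fun n : ℕ => (n : ℝ) / γ n) atTop (𝓝 0))) {y : ℝ} (hy : y ≤ 1) :
    Tendsto (fun n : ℕ => (n:ℝ) / γ n * ∫ ω, (if ‖linear A Z M 0 ω‖ ≤ γ n * y then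
      ‖linear A Z M 0 ω‖ else 0) ∂P) atTop (𝓝 0) := by
  have hG := h.growth
  have hm := h.measurable_linear M 0
  have hτ : ∀ n, 0 < γ n → ∀ ω, (if ‖linear A Z M 0 ω‖ ≤ γ n * y then
      ‖linear A Z M 0 ω‖ else 0) ≤ min ‖linear A Z M 0 ω‖ (γ n) := by
    intro n hn ω
    split_ifs with hc
    · exact le_min le_rfl (hc.trans (mul_le_of_le_one_right hn.le hy))
    · exact le_min (norm_nonneg _) hn.le
  have hτ0 : ∀ n ω, 0 ≤ (if ‖linear A Z M 0 ω‖ ≤ γ n * y then ‖linear A Z M 0 ω‖ else 0) := by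
    intro n ω
    split_ifs <;> positivity
  rcases hcase with hα | ⟨hα, hS⟩ | ⟨hα, hn⟩
  · refine squeeze_zero' ?_ ?_
      (hG.truncated_mean_of_lt_one hα (h.hasTail_linear M) hm.norm fun ω => norm_nonneg _)
    · filter_upwards [hG.tendsto.eventually_gt_atTop 0] with n hg
      exact mul_nonneg (by positivity) (integral_nonneg (hτ0 n))
    · filter_upwards [hG.tendsto.eventually_gt_atTop 0] with n hg
      refine mul_le_mul_of_nonneg_left ?_ (by positivity)
      refine integral_mono_of_nonneg (Eventually.of_forall (hτ0 n)) ?_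
        (Eventually.of_forall (hτ n hg))
      refine (integrable_const (γ n)).mono' (hm.norm.min measurable_const).aestronglyMeasurable
        (Eventually.of_forall fun ω => ?_)
      rw [Real.norm_of_nonneg (le_min (norm_nonneg _) hg.le)]
      exact min_le_right _ _
  · refine (h.coeffs_row 0).abs_mean_of_one_le hG hα.ge h.lt_q (fun j => ?_) (window M) hy
    have h0 := RCLP.tendsto_truncated_mean hG.rv (by linarith) h.tail h.measZ h.indepZ hidZ
      hG.tendsto hG.nV measurable_norm (fun z => (abs_norm z).le)
      fun e he => tendstoInMeasure_real hS he
    refine h0.congr fun n => ?_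
    congr 1
    exact ((hidZ (0 - j)).comp (u := fun z => if ‖z‖ ≤ γ n then ‖z‖ else 0)
      (Measurable.ite (measurableSet_le measurable_norm measurable_const) measurable_norm
        measurable_const)).integral_eq.symm
  -- For α > 1 the truncated means are bounded by a fixed finite mean, and n/γ_n → 0 does the rest.
  · have hint := (h.integrable_linear hα M).norm
    have h1 := hn.mul_const (∫ ω, ‖linear A Z M 0 ω‖ ∂P)
    rw [zero_mul] at h1
    refine squeeze_zero' ?_ ?_ h1
    · filter_upwards [hG.tendsto.eventually_gt_atTop 0] with n hg
      exact mul_nonneg (by positivity) (integral_nonneg (hτ0 n))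
    · filter_upwards [hG.tendsto.eventually_gt_atTop 0] with n hg
      refine mul_le_mul_of_nonneg_left ?_ (by positivity)
      exact integral_mono_of_nonneg (Eventually.of_forall (hτ0 n)) hint
        (Eventually.of_forall fun ω => (hτ n hg ω).trans (min_le_left _ _))

theorem sumAabs (h : Setup P A Z V α q γ) {M : ℕ}
    (hfin : ∀ k j : ℤ, (M : ℤ) < |j| → A k j =ᵐ[P] 0) : SumAabs P A α := by
  have hα := h.growth.rv.index_pos
  have h1 : ∫⁻ ω, (∑ j ∈ window M, ‖A j j ω‖ₑ) ^ α ∂P < ∞ :=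
    lintegral_rpow_lt_top_of_le hα.le h.lt_q.le
      (lintegral_sum_rpow_lt_top (window M) (a := fun j ω => ‖A j j ω‖ₑ)
        (fun j => (h.measA j j).enorm) h.q_pos fun j => h.moment j j)
  refine lt_of_le_of_lt (lintegral_mono_ae ?_) h1
  filter_upwards [ae_eq_zero_off_window hfin] with ω hω
  rw [tsum_eq_sum fun j hj => by rw [hω j j hj]; exact enorm_zero (E := Mat d p)]

theorem sumA (h : Setup P A Z V α q γ) {M : ℕ}
    (hfin : ∀ k j : ℤ, (M : ℤ) < |j| → A k j =ᵐ[P] 0) : SumA P A α := by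
  have hα := h.growth.rv.index_pos
  refine ⟨?_, ?_⟩
  · filter_upwards [ae_eq_zero_off_window hfin] with ω hω
    exact summable_of_ne_finset_zero fun j hj => hω j j hj
  · refine lt_of_le_of_lt (lintegral_mono fun ω => ?_) (h.sumAabs hfin)
    refine iSup_le fun J => ENNReal.rpow_le_rpow ?_ hα.le
    refine (enorm_tsum_le_tsum_enorm (f := fun j : J => A j j ω)).trans ?_
    exact ENNReal.tsum_comp_le_tsum_of_injective Subtype.val_injective fun j => ‖A j j ω‖ₑ

end

section

variable {P : Measure Ω} [IsProbabilityMeasure P] {A : ℤ → ℤ → Ω → Mat d p}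
    {Z : ℤ → Ω → Vec p} {α q : ℝ} {γ : ℕ → ℝ}

theorem smallJump (h : Setup P A Z (fun u => P.real {ω | u < ‖Z 0 ω‖}) α q γ) {M : ℕ}
    (hfin : ∀ k j : ℤ, (M : ℤ) < |j| → A k j =ᵐ[P] 0) : SmallJump P A Z γ := by
  intro δ hδ
  have hX := ae_X_eq_linear Z hfin
  obtain ⟨hind, hid⟩ := h.linear_window M
  obtain ⟨ε₀, hε₀, hlim⟩ := h.growth.tendsto_norm_sum (W := linear A Z M) (m := 2 * M + 1)
    (by omega) (h.measurable_linear M) hind hid (h.hasTail_linear M) (fun y hy0 hy1 => by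
      rcases lt_or_ge α 1 with hα | hα
      · exact (h.coeffs_row 0).mean_of_lt_one h.growth hα h.lt_q (window M) hy1
      · exact (h.coeffs_row 0).mean_of_one_le h.growth hα h.lt_q (fun j => h.mean hα (0 - j))
          (window M) hy0 hy1) hδ
  refine tendsto_limsup_of_small (r_nonneg P Z γ) hε₀
    (fun ε => Eventually.of_forall fun n => Filter.eventuallyEq_set.2 ?_) hlim
  filter_upwards [hX] with ω hω
  simp only [hω]

theorem smallJumpAbs1 (h : Setup P A Z (fun u => P.real {ω | u < ‖Z 0 ω‖}) α q γ)
    (hidZ : ∀ k, IdentDistrib (Z k) (Z 0) P P) {M : ℕ}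
    (hfin : ∀ k j : ℤ, (M : ℤ) < |j| → A k j =ᵐ[P] 0) (hcase : α < 1 ∨
      (α = 1 ∧ TendstoInMeasure P
        (fun (n : ℕ) ω => (γ n)⁻¹ * ∑ k ∈ Finset.Icc 1 n, ‖Z (k : ℤ) ω‖)
        atTop (fun _ => (0 : ℝ))) ∨
      (1 < α ∧ Tendsto (fun n : ℕ => (n : ℝ) / γ n) atTop (𝓝 0))) :
    SmallJumpAbs1 P A Z γ := by
  intro δ hδ
  have hG := h.growth
  have hX := ae_X_eq_linear Z hfin
  set ε₀ := min 1 (δ / (4 * (2 * M + 1 : ℕ))) with hε₀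
  have hM : (0:ℝ) < 4 * (2 * M + 1 : ℕ) := by positivity
  refine tendsto_limsup_of_small (r_nonneg P Z γ) (show 0 < ε₀ by positivity)
    -- The summands are nonnegative, so the absolute value changes nothing and the two-sided bound
    -- applies.
    (E' := fun ε n => {ω | γ n * δ < |∑ k ∈ Finset.Icc 1 n,
      if ‖linear A Z M (k : ℤ) ω‖ ≤ γ n * ε then ‖linear A Z M (k : ℤ) ω‖ else 0|})
    (fun ε => Eventually.of_forall fun n => Filter.eventuallyEq_set.2 ?_) fun ε hε hεlt => ?_
  · filter_upwards [hX] with ω hω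
    simp only [hω]
    rw [abs_of_nonneg]
    exact Finset.sum_nonneg fun k _ => by split_ifs <;> positivity
  · have hε1 : ε ≤ 1 := (hεlt.trans_le (min_le_left _ _)).le
    have hε2 : 4 * (2 * M + 1 : ℕ) * ε ≤ δ := by
      have := (hεlt.trans_le (min_le_right _ _)).le
      rw [le_div_iff₀ hM] at this
      linarith
    have hb : ∀ n, 0 ≤ γ n → ∀ x : Vec d,
        |if ‖x‖ ≤ γ n * ε then ‖x‖ else 0| ≤ min (‖x‖ + 0) (γ n * ε) := by
      intro n hn x
      split_ifs with hc
      · rw [abs_norm, add_zero]; exact le_min le_rfl hc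
      · rw [abs_zero]; exact le_min (by positivity) (by positivity)
    refine h.tendsto_abs_sum_linear M (φ := fun n x => if ‖x‖ ≤ γ n * ε then ‖x‖ else 0)
      (fun n => Measurable.ite (measurableSet_le measurable_norm measurable_const) measurable_norm
        measurable_const) le_rfl ?_ hδ hε2 ?_ (h.abs_mean_linear hidZ M hcase hε1)
    · filter_upwards [hG.tendsto.eventually_ge_atTop 0] with n hn x
      exact (hb n hn x).trans (min_le_min le_rfl (mul_le_of_le_one_right hn hε1))
    · filter_upwards [hG.tendsto.eventually_ge_atTop 0] with n hn x
      exact (hb n hn x).trans ((min_le_right _ _).trans (mul_comm _ _).le)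

theorem smallJumpAbs2 (h : Setup P A Z (fun u => P.real {ω | u < ‖Z 0 ω‖}) α q γ) {M : ℕ}
    (hfin : ∀ k j : ℤ, (M : ℤ) < |j| → A k j =ᵐ[P] 0) (hα : 1 < α)
    (hγ : ∀ n : ℕ, 1 ≤ n → γ n = n) : SmallJumpAbs2 P A Z γ := by
  have hX := ae_X_eq_linear Z hfin
  have hX0 : X A Z 0 =ᵐ[P] linear A Z M 0 := by filter_upwards [hX] with ω hω using hω 0
  have hint := h.integrable_linear hα M
  refine ⟨hint.congr hX0.symm, fun δ hδ => ?_⟩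
  have hG := h.growth
  set c := ∫ ω, ‖X A Z 0 ω‖ ∂P with hc
  have hc' : c = ∫ ω, ‖linear A Z M 0 ω‖ ∂P :=
    integral_congr_ae (by filter_upwards [hX0] with ω hω; rw [hω])
  have hc0 : 0 ≤ c := integral_nonneg fun ω => norm_nonneg _
  clear_value c
  set ε₀ := min 1 (δ / (4 * (2 * M + 1 : ℕ))) with hε₀
  have hM : (0:ℝ) < 4 * (2 * M + 1 : ℕ) := by positivity
  refine tendsto_limsup_of_small (r_nonneg P Z γ) (show 0 < ε₀ by positivity)
    (E' := fun ε n => {ω | γ n * δ < |∑ k ∈ Finset.Icc 1 n,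
      if ‖linear A Z M (k : ℤ) ω‖ ≤ n * ε then ‖linear A Z M (k : ℤ) ω‖ - c else 0|})
    (fun ε => ?_) fun ε hε hεlt => ?_
  -- Since γ is prescribed only for n ≥ 1, the two events need not agree at n = 0.
  · filter_upwards [eventually_ge_atTop 1] with n hn
    refine Filter.eventuallyEq_set.2 ?_
    filter_upwards [hX] with ω hω
    simp only [hω, hγ n hn]
  · have hε1 : ε ≤ 1 := (hεlt.trans_le (min_le_left _ _)).le
    have hε2 : 4 * (2 * M + 1 : ℕ) * ε ≤ δ := by
      have := (hεlt.trans_le (min_le_right _ _)).le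
      rw [le_div_iff₀ hM] at this
      linarith
    have hnε : Tendsto (fun n : ℕ => (n:ℝ) * ε) atTop atTop :=
      tendsto_natCast_atTop_atTop.atTop_mul_const hε
    have hφm : ∀ n : ℕ, Measurable fun x : Vec d => if ‖x‖ ≤ n * ε then ‖x‖ - c else 0 := fun n =>
      Measurable.ite (measurableSet_le measurable_norm measurable_const)
        (measurable_norm.sub_const c) measurable_const
    -- The condition c ≤ nε keeps the lower value -c within the truncation level.
    have hb : ∀ n : ℕ, c ≤ n * ε → ∀ x : Vec d,
        |if ‖x‖ ≤ n * ε then ‖x‖ - c else 0| ≤ min (‖x‖ + c) (n * ε) := by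
      intro n hn x
      have := norm_nonneg x
      split_ifs with hx
      · rw [abs_le]
        constructor
        · have : min (‖x‖ + c) (n * ε) ≥ c := le_min (by linarith) hn
          linarith
        · exact le_min (by linarith) (by linarith)
      · rw [abs_zero]; exact le_min (by positivity) (by positivity)
    refine h.tendsto_abs_sum_linear M (φ := fun n x => if ‖x‖ ≤ n * ε then ‖x‖ - c else 0)
      hφm hc0 ?_ hδ hε2 ?_ ?_
    · filter_upwards [hnε.eventually_ge_atTop c, eventually_ge_atTop 1] with n hn hn1 x
      refine (hb n hn x).trans (min_le_min le_rfl ?_)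
      rw [hγ n hn1]
      exact mul_le_of_le_one_right n.cast_nonneg hε1
    · filter_upwards [hnε.eventually_ge_atTop c, eventually_ge_atTop 1] with n hn hn1 x
      rw [hγ n hn1, mul_comm ε]
      exact (hb n hn x).trans (min_le_right _ _)
    -- Here n/γ_n = 1, so it is enough that the centred truncated mean tends to 0, without a rate.
    · have hlim := tendsto_integral_centred_trunc hint hε
      rw [← hc'] at hlim
      refine hlim.congr' ?_
      filter_upwards [eventually_ge_atTop 1] with n hn
      have : (n:ℝ) ≠ 0 := by positivity
      rw [hγ n hn, div_self this, one_mul]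

end

end Setup

end RCLP

/-! ### Jumps of single noise vectors; pairs of large jumps -/

namespace RCLP

variable {Ω : Type*} [MeasurableSpace Ω] {d p : ℕ}

/-- Windows of radius M about i and k are disjoint once |i - k| > 2M. Unlike the residue-class
version, this covers pairs that are not congruent. -/
theorem indepFun_shift {P : Measure Ω} [IsProbabilityMeasure P] {𝒰 E : Type*} [MeasurableSpace 𝒰]
    [MeasurableSpace E] [Inhabited 𝒰] {U : ℤ → Ω → 𝒰} {H : (ℤ → 𝒰) → E}
    (hU : ∀ k, Measurable (U k)) (hind : iIndepFun U P) (hH : Measurable H) (M : ℕ)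
    (hdep : ∀ x y : ℤ → 𝒰, (∀ j, |j| ≤ (M:ℤ) → x j = y j) → H x = H y) {i k : ℤ}
    (hik : 2 * (M:ℤ) < |i - k|) :
    IndepFun (fun ω => H (fun l => U (i + l) ω)) (fun ω => H (fun l => U (k + l) ω)) P := by
  set S : ℤ → Finset ℤ := fun i => Finset.Icc (i - M) (i + M) with hS
  have hdisj : Disjoint (S i) (S k) := by
    rw [Finset.disjoint_left]
    intro l h1 h2
    simp only [hS, Finset.mem_Icc] at h1 h2
    rcases lt_abs.1 hik with h | h <;> omega
  set e : ∀ i : ℤ, (S i → 𝒰) → ℤ → 𝒰 := fun i x l =>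
    if h : i + l ∈ S i then x ⟨i + l, h⟩ else default with he
  have hem : ∀ i, Measurable (e i) := by
    refine fun i => measurable_pi_iff.2 fun l => ?_
    by_cases h : i + l ∈ S i
    · simp only [he, h, dif_pos]
      exact measurable_pi_apply _
    · simp only [he, h, dif_neg, not_false_eq_true]
      exact measurable_const
  have heq : ∀ i : ℤ, (fun ω => H (fun l => U (i + l) ω)) =
      (H ∘ e i) ∘ fun ω (l : S i) => U l ω := by
    intro i
    ext1 ω
    refine hdep _ _ fun j hj => ?_
    have hmem : i + j ∈ S i := by
      rw [abs_le] at hj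
      simp only [hS, Finset.mem_Icc]
      omega
    simp [he, hmem]
  rw [heq i, heq k]
  exact (hind.indepFun_finset (S i) (S k) hdisj hU).comp (hH.comp (hem i)) (hH.comp (hem k))

/-- The total contribution of the noise vector `Z_i` to the partial sums. -/
noncomputable def jump (A : ℤ → ℤ → Ω → Mat d p) (Z : ℤ → Ω → Vec p) (M : ℕ) (i : ℤ) (ω : Ω) :
    Vec d :=
  Setup.weight A M i ω (Z i ω)

namespace Setup

variable {P : Measure Ω} {A : ℤ → ℤ → Ω → Mat d p}
    {Z : ℤ → Ω → Vec p} {V : ℝ → ℝ} {α q : ℝ} {γ : ℕ → ℝ}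

theorem measurable_jump (h : Setup P A Z V α q γ) (M : ℕ) (i : ℤ) : Measurable (jump A Z M i) :=
  measurable_mat_apply (h.measurable_weight M i) (h.measZ i)

variable [IsProbabilityMeasure P]

theorem hasTail_jump (h : Setup P A Z V α q γ) (M : ℕ) (i : ℤ) :
    HasTail P V α (fun ω => ‖jump A Z M i ω‖) := by
  simpa [jump] using (h.coeffs_weight M i).hasTail_norm h.growth.rv h.lt_q Finset.univ

theorem identDistrib_jump (h : Setup P A Z V α q γ) (M : ℕ) (i : ℤ) :
    IdentDistrib (jump A Z M i) (jump A Z M 0) P P :=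
  (h.weight_window M).2 i

theorem indepFun_jump (h : Setup P A Z V α q γ) (M : ℕ) {i k : ℤ} (hik : 2 * (M:ℤ) < |i - k|) :
    IndepFun (jump A Z M i) (jump A Z M k) P := by
  set U : ℤ → Ω → (ℤ → Mat d p) × Vec p := fun k ω => (fun j => A k j ω, Z k ω) with hU
  set H : (ℤ → (ℤ → Mat d p) × Vec p) → Vec d := fun x =>
    (∑ j ∈ window M, (x j).1 j) ((x 0).2) with hH
  have hUm : ∀ k, Measurable (U k) := fun k =>
    (measurable_pi_iff.2 fun j => h.measA k j).prodMk (h.measZ k)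
  have hHm : Measurable H := measurable_mat_apply
    (Finset.measurable_sum _ fun j _ => by fun_prop) (by fun_prop)
  have e : ∀ k : ℤ, (fun ω => H (fun i => U (k + i) ω)) = jump A Z M k := by
    intro k; ext1 ω
    simp [hH, hU, weight, jump]
  have := indepFun_shift hUm h.indepU hHm M (fun x y hxy => ?_) hik
  · rwa [e, e] at this
  · simp only [hH]
    rw [hxy 0 (by simp), Finset.sum_congr rfl fun j hj => by rw [hxy j (mem_window.1 hj)]]

theorem identDistrib_weight (h : Setup P A Z V α q γ) (M : ℕ) (i : ℤ) :
    IdentDistrib (weight A M i) (weight A M 0) P P := by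
  have := identDistrib_shift (U := fun k ω => ((fun j => A k j ω : ℤ → Mat d p), Z k ω))
    (H := fun x => ∑ j ∈ window M, (x j).1 j)
    (fun k => (measurable_pi_iff.2 fun j => h.measA k j).prodMk (h.measZ k)) h.indepU h.identU
    (Finset.measurable_sum _ fun j _ => by fun_prop) i
  exact this

/-- Two jumps are unlikely to be large simultaneously, however close they are. -/
theorem exists_two_jumps_le (h : Setup P A Z V α q γ) (M : ℕ) :
    ∃ C θ x₀ : ℝ, 0 < θ ∧ ∀ i k, i ≠ k → ∀ x, x₀ ≤ x → ∀ s, 1 ≤ s →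
      P.real {ω | x / s < ‖jump A Z M i ω‖ ∧ x / s < ‖jump A Z M k ω‖} ≤
        C * s ^ q * V x ^ (1 + θ) := by
  have hV := h.growth.rv
  have hq := h.q_pos
  -- Taking a in (max(α, q/2), q) and θ = q/a - 1 gives 0 < θ ≤ 1 and a(1 + θ) = q. Weakening V² to
  -- V^(1+θ) makes the Potter factor exactly s^q, the largest power that the moment of the weights
  -- supports.
  obtain ⟨a, ha1, ha2⟩ := exists_between (max_lt h.lt_q (half_lt_self hq))
  have haα : α < a := (le_max_left _ _).trans_lt ha1
  have haq : q / 2 < a := (le_max_right _ _).trans_lt ha1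
  have ha0 : 0 < a := by linarith
  obtain ⟨C, x₀, hC, hx₀, hle⟩ := hV.potter_lower haα
  set θ := q / a - 1 with hθ
  have hθ0 : 0 < θ := by rw [hθ, sub_pos, one_lt_div ha0]; exact ha2
  have hθ1 : θ ≤ 1 := by
    rw [hθ, sub_le_iff_le_add, div_le_iff₀ ha0]; linarith
  have hθq : a * (1 + θ) = q := by rw [hθ]; field_simp; ring
  set m₀ := ∫⁻ ω, ‖weight A M 0 ω‖ₑ ^ q ∂P with hm₀
  have hm₀t : m₀ < ∞ := h.lintegral_weight_lt_top M 0
  have hmi : ∀ i, ∫⁻ ω, ‖weight A M i ω‖ₑ ^ q ∂P = m₀ := fun i =>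
    ((h.identDistrib_weight M i).comp (u := fun x : Mat d p => ‖x‖ₑ ^ q)
      (by fun_prop)).lintegral_eq
  set K := (1 + m₀ + m₀).toReal with hK
  refine ⟨C ^ (1 + θ) * K, θ, x₀, hθ0, fun i k hik x hx s hs => ?_⟩
  -- The weights of nearby jumps may be dependent, so both are replaced by their maximum. The
  -- independent factor min(|Z_i|, |Z_k|) has tail V².
  set m : Ω → ℝ := fun ω => max 1 (max ‖weight A M i ω‖ ‖weight A M k ω‖) with hm
  set R : Ω → ℝ := fun ω => min ‖Z i ω‖ ‖Z k ω‖ with hR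
  have hwm := h.measurable_weight M
  have hmm : Measurable m := measurable_const.max ((hwm i).norm.max (hwm k).norm)
  have hRm : Measurable R := (h.measZ i).norm.min (h.measZ k).norm
  have hind : IndepFun m R P := h.indepAZ.comp
    (φ := fun x : ℤ → ℤ → Mat d p => max 1 (max ‖∑ j ∈ window M, x (i + j) j‖
      ‖∑ j ∈ window M, x (k + j) j‖)) (ψ := fun z : ℤ → Vec p => min ‖z i‖ ‖z k‖)
    (measurable_const.max ((Finset.measurable_sum _ fun j _ => by fun_prop).norm.max
      (Finset.measurable_sum _ fun j _ => by fun_prop).norm))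
    ((measurable_pi_apply i).norm.min (measurable_pi_apply k).norm)
  have hmq : ∫⁻ ω, ENNReal.ofReal (m ω ^ q) ∂P ≤ ENNReal.ofReal K := by
    rw [hK, ENNReal.ofReal_toReal (by
      exact (ENNReal.add_lt_top.2 ⟨ENNReal.add_lt_top.2 ⟨ENNReal.one_lt_top, hm₀t⟩, hm₀t⟩).ne)]
    have hb : ∀ ω, ENNReal.ofReal (m ω ^ q) ≤ 1 + ‖weight A M i ω‖ₑ ^ q + ‖weight A M k ω‖ₑ ^ q := by
      intro ω
      rw [enorm_rpow_eq_ofReal _ hq.le, enorm_rpow_eq_ofReal _ hq.le, ← ENNReal.ofReal_one,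
        ← ENNReal.ofReal_add (by positivity) (by positivity),
        ← ENNReal.ofReal_add (by positivity) (by positivity)]
      refine ENNReal.ofReal_le_ofReal ?_
      have h1 : 0 ≤ ‖weight A M i ω‖ ^ q := by positivity
      have h2 : 0 ≤ ‖weight A M k ω‖ ^ q := by positivity
      simp only [hm]
      rcases max_choice 1 (max ‖weight A M i ω‖ ‖weight A M k ω‖) with e | e <;> rw [e]
      · rw [Real.one_rpow]; linarith
      · rcases max_choice ‖weight A M i ω‖ ‖weight A M k ω‖ with e' | e' <;> rw [e'] <;> linarith
    refine (lintegral_mono hb).trans (le_of_eq ?_)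
    rw [lintegral_add_right _ ((hwm k).enorm.pow_const q),
      lintegral_add_left measurable_const, hmi, hmi, lintegral_const, measure_univ, mul_one]
  have hRt : ∀ u, P.real {ω | u < R ω} = V u ^ 2 := by
    intro u
    have e : {ω | u < R ω} = (Z i) ⁻¹' {z | u < ‖z‖} ∩ (Z k) ⁻¹' {z | u < ‖z‖} := by
      ext ω; exact lt_min_iff (a := u)
    rw [measureReal_def, e, (h.indepZ.indepFun hik).measure_inter_preimage_eq_mul _ _
      (measurableSet_norm_gt u) (measurableSet_norm_gt u), ENNReal.toReal_mul, sq]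
    have h1 := h.tail i u
    have h2 := h.tail k u
    rw [measureReal_def] at h1 h2
    exact congrArg₂ _ h1 h2
  have hx1 : ∀ s, 1 ≤ s → P.real {ω | x / s < R ω} ≤ C ^ (1 + θ) * V x ^ (1 + θ) * s ^ q := by
    intro s hs
    have hVs := hV.pos (x / s)
    have hVx := hV.pos x
    rw [hRt, ← Real.rpow_two]
    refine (Real.rpow_le_rpow_of_exponent_ge hVs (hV.le_one _)
      (by linarith : 1 + θ ≤ 2)).trans ?_
    refine (Real.rpow_le_rpow hVs.le (hle x hx s hs) (by linarith)).trans (le_of_eq ?_)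
    rw [Real.mul_rpow (by positivity) hVx.le, Real.mul_rpow (by positivity) (by positivity),
      ← Real.rpow_mul (by linarith), hθq]
    ring
  have hVx := hV.pos x
  refine (measureReal_mono ?_).trans ((tail_mul_le hmm hRm hind (fun ω => le_max_left _ _)
    (by positivity) ENNReal.toReal_nonneg hmq hx1 hs).trans (le_of_eq (by ring)))
  rintro ω ⟨h1, h2⟩
  have hR0 : 0 ≤ R ω := le_min (norm_nonneg _) (norm_nonneg _)
  have hwi : ‖weight A M i ω‖ ≤ m ω := (le_max_left _ _).trans (le_max_right _ _)
  have hwk : ‖weight A M k ω‖ ≤ m ω := (le_max_right _ _).trans (le_max_right _ _)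
  change x / s < m ω * min ‖Z i ω‖ ‖Z k ω‖
  rcases min_choice ‖Z i ω‖ ‖Z k ω‖ with e | e <;> rw [e]
  · exact h1.trans_le (((weight A M i ω).le_opNorm _).trans
      (mul_le_mul_of_nonneg_right hwi (norm_nonneg _)))
  · exact h2.trans_le (((weight A M k ω).le_opNorm _).trans
      (mul_le_mul_of_nonneg_right hwk (norm_nonneg _)))

/-- The expected number of pairs of large jumps is negligible. -/
theorem tendsto_pairs (h : Setup P A Z V α q γ) (M : ℕ) {ε : ℝ} (hε : 0 < ε) (hε1 : ε ≤ 1) :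
    Tendsto (fun n : ℕ => 1 / (n * V (γ n)) * ∑ i ∈ Finset.Icc 1 n, ∑ k ∈ Finset.Icc 1 n,
      if i ≠ k then P.real {ω | γ n * ε < ‖jump A Z M (i : ℤ) ω‖ ∧
        γ n * ε < ‖jump A Z M (k : ℤ) ω‖} else 0) atTop (𝓝 0) := by
  have hG := h.growth
  have hα := hG.rv.index_pos
  obtain ⟨C, θ, x₀, hθ, hnear⟩ := h.exists_two_jumps_le M
  obtain ⟨C', x₁, hC', hx₁, hT⟩ := h.hasTail_jump M 0 (α + 1) (by linarith)
  set D := |C| * ε⁻¹ ^ q with hD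
  set D' := C' * ε⁻¹ ^ (α + 1) with hD'
  have hs : 1 ≤ ε⁻¹ := (one_le_inv₀ hε).2 hε1
  -- Pairs at distance at most 2M, of which there are at most (4M + 1) n, have probability
  -- O(V^(1+θ)); the others are independent, with probability O(V²). Divided by n V(γ_n), the totals
  -- are O(V(γ_n)^θ) and O(n V(γ_n)).
  have hterm : ∀ n : ℕ, max x₀ x₁ ≤ γ n → ∀ i k : ℕ, (if i ≠ k then
      P.real {ω | γ n * ε < ‖jump A Z M (i : ℤ) ω‖ ∧ γ n * ε < ‖jump A Z M (k : ℤ) ω‖} else 0) ≤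
      (if |(i:ℤ) - k| ≤ 2 * M then D * V (γ n) ^ (1 + θ) else 0) + D' ^ 2 * V (γ n) ^ 2 := by
    intro n hn i k
    have hV := hG.rv.pos (γ n)
    have h1 : 0 ≤ D * V (γ n) ^ (1 + θ) := by positivity
    have h2 : 0 ≤ D' ^ 2 * V (γ n) ^ 2 := by positivity
    have hdiv : γ n * ε = γ n / ε⁻¹ := by rw [div_inv_eq_mul]
    split_ifs with hik hc hc
    · refine le_add_of_le_of_nonneg ?_ h2
      have := hnear i k (by exact_mod_cast hik) (γ n) ((le_max_left _ _).trans hn) ε⁻¹ hs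
      rw [hdiv]
      refine this.trans ?_
      rw [hD]
      gcongr
      exact le_abs_self C
    · rw [zero_add]
      have e : {ω | γ n * ε < ‖jump A Z M (i : ℤ) ω‖ ∧ γ n * ε < ‖jump A Z M (k : ℤ) ω‖} =
          (jump A Z M i) ⁻¹' {z | γ n * ε < ‖z‖} ∩ (jump A Z M k) ⁻¹' {z | γ n * ε < ‖z‖} := rfl
      have hone : ∀ i : ℤ, (P ((jump A Z M i) ⁻¹' {z | γ n * ε < ‖z‖})).toReal ≤
          D' * V (γ n) := by
        intro i
        have h3 := (h.identDistrib_jump M i).measure_mem_eq (measurableSet_norm_gt (γ n * ε))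
        have h4 := hT (γ n) ((le_max_right _ _).trans hn) ε⁻¹ hs
        rw [← hdiv] at h4
        exact (congrArg ENNReal.toReal h3).le.trans h4
      rw [measureReal_def, e, (h.indepFun_jump M (not_le.1 hc)).measure_inter_preimage_eq_mul _ _
        (measurableSet_norm_gt _) (measurableSet_norm_gt _), ENNReal.toReal_mul, ← mul_pow, sq]
      exact mul_le_mul (hone i) (hone k) ENNReal.toReal_nonneg (by positivity)
    · exact add_nonneg h1 h2
    · exact add_nonneg le_rfl h2
  have hlim : Tendsto (fun n : ℕ => (4 * M + 1) * D * V (γ n) ^ θ + D' ^ 2 * (n * V (γ n))) atTop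
      (𝓝 0) := by
    have h1 := ((hG.rv.tendsto_zero.comp hG.tendsto).rpow_const (p := θ) (Or.inr hθ.le)).const_mul
      ((4 * M + 1) * D)
    have h2 := hG.nV.const_mul (D' ^ 2)
    simpa [Real.zero_rpow hθ.ne'] using h1.add h2
  refine squeeze_zero' (Eventually.of_forall fun n => ?_) ?_ hlim
  · have := hG.rv.pos (γ n)
    refine mul_nonneg (by positivity) (Finset.sum_nonneg fun i _ => Finset.sum_nonneg fun k _ => ?_)
    split_ifs <;> positivity
  filter_upwards [eventually_ge_atTop 1, hG.tendsto.eventually_ge_atTop (max x₀ x₁)] with n hn hg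
  have hV := hG.rv.pos (γ n)
  have hn0 : (0:ℝ) < n := by exact_mod_cast hn
  have hcard : ∀ i : ℕ, (∑ k ∈ Finset.Icc 1 n,
      if |(i:ℤ) - k| ≤ 2 * M then D * V (γ n) ^ (1 + θ) else 0) ≤
      (4 * M + 1) * (D * V (γ n) ^ (1 + θ)) := by
    intro i
    rw [← Finset.sum_filter, Finset.sum_const, nsmul_eq_mul]
    refine mul_le_mul_of_nonneg_right ?_ (by positivity)
    have h1 : ((Finset.Icc 1 n).filter fun k : ℕ => |(i:ℤ) - k| ≤ 2 * M).card ≤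
        (Finset.Icc ((i:ℤ) - 2 * M) (i + 2 * M)).card := by
      refine Finset.card_le_card_of_injOn (fun k : ℕ => (k:ℤ)) (fun k hk => ?_)
        (fun a _ b _ hab => Nat.cast_injective hab)
      have := (Finset.mem_filter.1 hk).2
      rw [abs_le] at this
      simp only [Finset.coe_Icc, Set.mem_Icc]
      omega
    rw [Int.card_Icc] at h1
    have h2 : ((Finset.Icc 1 n).filter fun k : ℕ => |(i:ℤ) - k| ≤ 2 * M).card ≤ 4 * M + 1 := by
      omega
    exact_mod_cast h2
  have hsum : ∑ i ∈ Finset.Icc 1 n, ∑ k ∈ Finset.Icc 1 n, (if i ≠ k then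
      P.real {ω | γ n * ε < ‖jump A Z M (i : ℤ) ω‖ ∧ γ n * ε < ‖jump A Z M (k : ℤ) ω‖} else 0) ≤
      n * ((4 * M + 1) * (D * V (γ n) ^ (1 + θ)) + n * (D' ^ 2 * V (γ n) ^ 2)) := by
    refine (Finset.sum_le_card_nsmul _ _ _ fun i _ => (Finset.sum_le_sum fun k _ =>
      hterm n hg i k).trans ?_).trans (le_of_eq (by rw [nsmul_eq_mul, Nat.card_Icc, Nat.add_sub_cancel]))
    rw [Finset.sum_add_distrib]
    refine add_le_add (hcard i) (le_of_eq ?_)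
    rw [Finset.sum_const, nsmul_eq_mul, Nat.card_Icc, Nat.add_sub_cancel]
  refine (mul_le_mul_of_nonneg_left hsum (by positivity)).trans (le_of_eq ?_)
  rw [Real.rpow_add hV, Real.rpow_one]
  field_simp

end Setup

end RCLP

/-! ### Partial sums as sums of jumps, up to boundary terms -/

namespace RCLP

variable {Ω : Type*} [MeasurableSpace Ω] {d p : ℕ}

/-- The indices close to the end points of `{1, …, n}`. -/
noncomputable def boundary (M n : ℕ) : Finset ℤ :=
  Finset.Icc (1 - M : ℤ) M ∪ Finset.Icc (n + 1 - M : ℤ) (n + M)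

theorem card_boundary_le (M n : ℕ) : (boundary M n).card ≤ 4 * M := by
  refine (Finset.card_union_le _ _).trans ?_
  rw [Int.card_Icc, Int.card_Icc]
  omega

theorem sum_Icc_natCast {E : Type*} [AddCommMonoid E] (n : ℕ) (f : ℤ → E) :
    ∑ k ∈ Finset.Icc 1 n, f (k : ℤ) = ∑ k ∈ Finset.Icc (1:ℤ) n, f k := by
  refine Finset.sum_nbij (fun k : ℕ => (k:ℤ)) (fun k hk => ?_) (fun a _ b _ hab =>
    Nat.cast_injective hab) (fun k hk => ?_) fun _ _ => rfl
  · rw [Finset.mem_Icc] at hk ⊢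
    omega
  · simp only [Finset.coe_Icc, Set.mem_Icc] at hk
    refine ⟨k.toNat, ?_, ?_⟩
    · simp only [Finset.coe_Icc, Set.mem_Icc]
      omega
    · simp only
      omega

/-- Shifting the summation window changes a sum by boundary terms only. -/
theorem norm_sum_sub_sum_shift_le {E : Type*} [SeminormedAddCommGroup E] (M n : ℕ) {j : ℤ}
    (hj : j ∈ window M) (f : ℤ → E) :
    ‖∑ k ∈ Finset.Icc (1:ℤ) n, f k - ∑ i ∈ Finset.Icc (1:ℤ) n, f (i + j)‖ ≤
      2 * ∑ k ∈ boundary M n, ‖f k‖ := by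
  have hsh : ∑ i ∈ Finset.Icc (1:ℤ) n, f (i + j) = ∑ k ∈ Finset.Icc (1 + j) (n + j), f k := by
    rw [← Finset.map_add_right_Icc, Finset.sum_map]
    rfl
  have hj' := mem_window.1 hj
  rw [abs_le] at hj'
  rw [hsh, ← Finset.sum_sdiff_sub_sum_sdiff, two_mul]
  refine (norm_sub_le _ _).trans (add_le_add ?_ ?_) <;>
  · refine (norm_sum_le _ _).trans (Finset.sum_le_sum_of_subset_of_nonneg (fun k hk => ?_)
      fun _ _ _ => norm_nonneg _)
    simp only [Finset.mem_sdiff, Finset.mem_Icc, boundary, Finset.mem_union] at hk ⊢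
    omega

/-- The sum of the norms of the terms of `X_k`. -/
noncomputable def absLinear (A : ℤ → ℤ → Ω → Mat d p) (Z : ℤ → Ω → Vec p) (M : ℕ) (k : ℤ)
    (ω : Ω) : ℝ :=
  ∑ j ∈ window M, ‖A k j ω (Z (k - j) ω)‖

/-- For fixed j the terms A_{k,j} Z_{k-j} become those of the jumps after the shift k = i + j, and
|j| ≤ M confines the mismatch to the ends of {1, ..., n}. -/
theorem norm_sum_linear_sub_sum_jump_le {Ω : Type*} (A : ℤ → ℤ → Ω → Mat d p) (Z : ℤ → Ω → Vec p) (M n : ℕ)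
    (ω : Ω) :
    ‖∑ k ∈ Finset.Icc 1 n, linear A Z M (k : ℤ) ω - ∑ i ∈ Finset.Icc 1 n, jump A Z M (i : ℤ) ω‖ ≤
      2 * ∑ k ∈ boundary M n, absLinear A Z M k ω := by
  have e1 : ∑ k ∈ Finset.Icc 1 n, linear A Z M (k : ℤ) ω =
      ∑ j ∈ window M, ∑ k ∈ Finset.Icc (1:ℤ) n, A k j ω (Z (k - j) ω) := by
    rw [sum_Icc_natCast n (fun k => linear A Z M k ω), Finset.sum_comm]
    rfl
  have e2 : ∑ i ∈ Finset.Icc 1 n, jump A Z M (i : ℤ) ω =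
      ∑ j ∈ window M, ∑ i ∈ Finset.Icc (1:ℤ) n, A (i + j) j ω (Z (i + j - j) ω) := by
    rw [sum_Icc_natCast n (fun k => jump A Z M k ω), Finset.sum_comm]
    refine Finset.sum_congr rfl fun i _ => ?_
    simp only [jump, Setup.weight, add_sub_cancel_right, sum_apply]
  rw [e1, e2, ← Finset.sum_sub_distrib]
  have e3 : 2 * ∑ k ∈ boundary M n, absLinear A Z M k ω =
      ∑ j ∈ window M, 2 * ∑ k ∈ boundary M n, ‖A k j ω (Z (k - j) ω)‖ := by
    rw [← Finset.mul_sum, Finset.sum_comm]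
    rfl
  rw [e3]
  exact (norm_sum_le _ _).trans (Finset.sum_le_sum fun j hj =>
    norm_sum_sub_sum_shift_le M n hj fun k => A k j ω (Z (k - j) ω))

namespace Setup

variable {P : Measure Ω} [IsProbabilityMeasure P] {A : ℤ → ℤ → Ω → Mat d p}
    {Z : ℤ → Ω → Vec p} {V : ℝ → ℝ} {α q : ℝ} {γ : ℕ → ℝ}

theorem hasTail_absLinear (h : Setup P A Z V α q γ) (M : ℕ) :
    HasTail P V α (absLinear A Z M 0) := by
  refine HasTail.sum h.growth.rv (window M) fun j _ => ?_
  simpa using (h.coeffs_row 0).hasTail_norm h.growth.rv h.lt_q {j}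

theorem identDistrib_absLinear (h : Setup P A Z V α q γ) (M : ℕ) (k : ℤ) :
    IdentDistrib (absLinear A Z M k) (absLinear A Z M 0) P P := by
  have := identDistrib_shift (U := fun k ω => ((fun j => A k j ω : ℤ → Mat d p), Z k ω))
    (H := fun x => ∑ j ∈ window M, ‖(x 0).1 j ((x (-j)).2)‖)
    (fun k => (measurable_pi_iff.2 fun j => h.measA k j).prodMk (h.measZ k)) h.indepU h.identU
    (Finset.measurable_sum _ fun j _ => (measurable_mat_apply (by fun_prop) (by fun_prop)).norm) k
  have e : ∀ k : ℤ, (fun ω => ∑ j ∈ window M, ‖A (k + 0) j ω (Z (k + -j) ω)‖) =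
      absLinear A Z M k := by
    intro k
    ext1 ω
    simp [absLinear, sub_eq_add_neg]
  rw [← e k, ← e 0]
  exact this

/-- There are at most 4M boundary terms, each large with probability O(V(γ_n)), so the normalized
probability is O(1/n). -/
theorem tendsto_boundary (h : Setup P A Z V α q γ) (M : ℕ) {η : ℝ} (hη : 0 < η) :
    Tendsto (fun n : ℕ => 1 / (n * V (γ n)) *
      P.real {ω | γ n * η < 2 * ∑ k ∈ boundary M n, absLinear A Z M k ω}) atTop (𝓝 0) := by
  have hG := h.growth
  have hα := hG.rv.index_pos
  obtain ⟨C, x₀, hC, hx₀, hT⟩ := h.hasTail_absLinear M (α + 1) (by linarith)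
  -- Twice the sum of 4M terms of size at most γ/s stays below γη; the extra 1 keeps the quotient
  -- positive for M = 0.
  set s := max 1 ((8 * M + 1) / η) with hs
  have hs1 : 1 ≤ s := le_max_left _ _
  have hs0 : 0 < s := by linarith
  have hs2 : (8 * M + 1) / η ≤ s := le_max_right _ _
  have hlim : Tendsto (fun n : ℕ => (4 * M * (C * s ^ (α + 1))) * (n:ℝ)⁻¹) atTop (𝓝 0) := by
    simpa using (tendsto_inv_atTop_zero.comp tendsto_natCast_atTop_atTop).const_mul
      (4 * (M:ℝ) * (C * s ^ (α + 1)))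
  refine squeeze_zero' (Eventually.of_forall fun n => ?_) ?_ hlim
  · have := hG.rv.pos (γ n)
    positivity
  filter_upwards [eventually_ge_atTop 1, hG.tendsto.eventually_ge_atTop x₀] with n hn hg
  have hV := hG.rv.pos (γ n)
  have hn0 : (0:ℝ) < n := by exact_mod_cast hn
  have hg0 : 0 < γ n := by linarith
  have hP : P.real {ω | γ n * η < 2 * ∑ k ∈ boundary M n, absLinear A Z M k ω} ≤
      4 * M * (C * s ^ (α + 1) * V (γ n)) := by
    have hsub : {ω | γ n * η < 2 * ∑ k ∈ boundary M n, absLinear A Z M k ω} ⊆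
        ⋃ k ∈ boundary M n, {ω | γ n / s < absLinear A Z M k ω} := by
      intro ω hω
      by_contra hcon
      simp only [Set.mem_iUnion, Set.mem_ofPred_eq, not_exists, not_lt] at hcon
      have h1 := Finset.sum_le_card_nsmul _ _ _ hcon
      rw [nsmul_eq_mul] at h1
      have h2 : ((boundary M n).card : ℝ) ≤ 4 * M := by exact_mod_cast card_boundary_le M n
      have h3 : (8 * M + 1) * (γ n / s) ≤ γ n * η := by
        rw [div_le_iff₀ hη] at hs2
        rw [mul_div_assoc', div_le_iff₀ hs0]
        nlinarith
      have h4 : 0 < γ n / s := by positivity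
      have h5 : γ n * η < 2 * ∑ k ∈ boundary M n, absLinear A Z M k ω := hω
      nlinarith [mul_le_mul_of_nonneg_right h2 h4.le]
    refine (measureReal_mono hsub (measure_ne_top _ _)).trans
      ((measureReal_biUnion_finset_le _ _).trans ?_)
    have hone : ∀ k ∈ boundary M n, P.real {ω | γ n / s < absLinear A Z M k ω} ≤
        C * s ^ (α + 1) * V (γ n) := fun k _ =>
      (congrArg ENNReal.toReal ((h.identDistrib_absLinear M k).measure_mem_eq
        (measurableSet_Ioi (a := γ n / s)))).le.trans (hT (γ n) hg s hs1)
    refine (Finset.sum_le_card_nsmul _ _ _ hone).trans ?_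
    rw [nsmul_eq_mul]
    refine mul_le_mul_of_nonneg_right ?_ (by positivity)
    exact_mod_cast card_boundary_le M n
  refine (mul_le_mul_of_nonneg_left hP (by positivity)).trans (le_of_eq ?_)
  field_simp

/-- Outside the large jumps, the partial sums are negligible. -/
theorem exists_tendsto_remainder (h : Setup P A Z V α q γ) (M : ℕ) {η : ℝ} (hη : 0 < η) :
    ∃ ε₀ : ℝ, 0 < ε₀ ∧ ∀ ε, 0 < ε → ε < ε₀ → Tendsto (fun n : ℕ => 1 / (n * V (γ n)) *
      P.real {ω | γ n * η < ‖∑ k ∈ Finset.Icc 1 n, linear A Z M (k : ℤ) ω -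
        ∑ i ∈ Finset.Icc 1 n, if γ n * ε < ‖jump A Z M (i : ℤ) ω‖ then jump A Z M (i : ℤ) ω
          else 0‖}) atTop (𝓝 0) := by
  have hG := h.growth
  obtain ⟨hind, hid⟩ := h.weight_window M
  obtain ⟨ε₀, hε₀, hlim⟩ := hG.tendsto_norm_sum (W := jump A Z M) (m := 2 * M + 1)
    (by omega) (h.measurable_jump M) hind hid (h.hasTail_jump M 0) (fun y hy0 hy1 => by
      rcases lt_or_ge α 1 with hα | hα
      · have := (h.coeffs_weight M 0).mean_of_lt_one hG hα h.lt_q Finset.univ hy1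
        simp only [Finset.univ_unique, Finset.sum_singleton] at this
        exact this
      · have := (h.coeffs_weight M 0).mean_of_one_le hG hα h.lt_q
          (fun _ => h.mean hα 0) Finset.univ hy0 hy1
        simp only [Finset.univ_unique, Finset.sum_singleton] at this
        exact this) (half_pos hη)
  refine ⟨ε₀, hε₀, fun ε hε hεlt => ?_⟩
  have h3 := (h.tendsto_boundary M (half_pos hη)).add (hlim ε hε hεlt)
  rw [add_zero] at h3
  have hr : ∀ n : ℕ, 0 ≤ 1 / (n * V (γ n)) := fun n => by
    have := hG.rv.pos (γ n)
    positivity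
  refine squeeze_zero (fun n => mul_nonneg (hr n) measureReal_nonneg) (fun n => ?_) h3
  rw [← mul_add]
  refine mul_le_mul_of_nonneg_left ((measureReal_mono ?_).trans (measureReal_union_le _ _)) (hr n)
  intro ω hω
  by_contra hcon
  simp only [Set.mem_union, Set.mem_ofPred_eq, not_or, not_lt] at hcon hω
  obtain ⟨h1, h2⟩ := hcon
  have h4 := (norm_sum_linear_sub_sum_jump_le A Z M n ω).trans h1
  -- The remainder is the boundary error plus the sum of the small jumps, and each gets half of η.
  have e : ∑ k ∈ Finset.Icc 1 n, linear A Z M (k : ℤ) ω -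
      (∑ i ∈ Finset.Icc 1 n, if γ n * ε < ‖jump A Z M (i : ℤ) ω‖ then jump A Z M (i : ℤ) ω else 0) =
      (∑ k ∈ Finset.Icc 1 n, linear A Z M (k : ℤ) ω - ∑ i ∈ Finset.Icc 1 n, jump A Z M (i : ℤ) ω) +
      ∑ i ∈ Finset.Icc 1 n, if ‖jump A Z M (i : ℤ) ω‖ ≤ γ n * ε then jump A Z M (i : ℤ) ω else 0 := by
    have : ∑ i ∈ Finset.Icc 1 n, jump A Z M (i : ℤ) ω =
        (∑ i ∈ Finset.Icc 1 n, if γ n * ε < ‖jump A Z M (i : ℤ) ω‖ then jump A Z M (i : ℤ) ω else 0) +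
        ∑ i ∈ Finset.Icc 1 n, if ‖jump A Z M (i : ℤ) ω‖ ≤ γ n * ε then jump A Z M (i : ℤ) ω
          else 0 := by
      rw [← Finset.sum_add_distrib]
      refine Finset.sum_congr rfl fun i _ => ?_
      by_cases hc : γ n * ε < ‖jump A Z M (i : ℤ) ω‖
      · rw [if_pos hc, if_neg (not_le.2 hc), add_zero]
      · rw [if_neg hc, if_pos (not_lt.1 hc), zero_add]
    rw [this]
    abel
  rw [e] at hω
  have := norm_add_le (∑ k ∈ Finset.Icc 1 n, linear A Z M (k : ℤ) ω -
    ∑ i ∈ Finset.Icc 1 n, jump A Z M (i : ℤ) ω) (∑ i ∈ Finset.Icc 1 n,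
      if ‖jump A Z M (i : ℤ) ω‖ ≤ γ n * ε then jump A Z M (i : ℤ) ω else 0)
  linarith

end Setup

end RCLP

/-! ### The limit measure and Breiman's lemma -/

namespace RCLP

variable {Ω : Type*} [MeasurableSpace Ω] {d p : ℕ}

/-- The measure `E[μ{z : B z ∈ ·}]`. -/
noncomputable def limitMeasure (P : Measure Ω) (B : Ω → Mat d p) (μ : Measure (Vec p)) :
    Measure (Vec d) :=
  (P.prod μ).map fun x => B x.1 x.2

/-- Needed for Fubini on P ⊗ μ. The origin, not covered by finiteness in `InM0`, is added to the
exhausting sets at no cost because it is null. -/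
theorem RegVar.sigmaFinite {P : Measure Ω} {Y : Ω → Vec p} {μ : Measure (Vec p)} {α : ℝ}
    (h : RegVar P Y μ α) : SigmaFinite μ := by
  refine ⟨⟨⟨fun n : ℕ => {z | 1 / ((n:ℝ) + 1) ≤ ‖z‖} ∪ {0}, fun _ => trivial, fun n => ?_, ?_⟩⟩⟩
  · refine (measure_union_le _ _).trans_lt ?_
    rw [h.zero_null, add_zero]
    exact h.tendsto.2.1 _ (by positivity)
  · refine Set.eq_univ_of_forall fun z => ?_
    by_cases hz : z = 0
    · exact Set.mem_iUnion.2 ⟨0, Or.inr hz⟩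
    · obtain ⟨n, hn⟩ := exists_nat_one_div_lt (norm_pos_iff.2 hz)
      exact Set.mem_iUnion.2 ⟨n, Or.inl hn.le⟩

theorem measurable_mat_apply_prod {B : Ω → Mat d p} (hB : Measurable B) :
    Measurable fun x : Ω × Vec p => B x.1 x.2 :=
  measurable_mat_apply (hB.comp measurable_fst) measurable_snd

theorem limitMeasure_apply {P : Measure Ω} {B : Ω → Mat d p} (hB : Measurable B)
    {μ : Measure (Vec p)} [SigmaFinite μ] {s : Set (Vec d)} (hs : MeasurableSet s) :
    limitMeasure P B μ s = ∫⁻ ω, μ {z | B ω z ∈ s} ∂P := by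
  rw [limitMeasure, Measure.map_apply (measurable_mat_apply_prod hB) hs,
    Measure.prod_apply (measurable_mat_apply_prod hB hs)]
  rfl

/-- If |Bz| ≥ r then |z| is at least of order r/‖B‖, and homogeneity gives such z a mass
proportional to ‖B‖^α. -/
theorem inM0_limitMeasure {P : Measure Ω} {Y : Ω → Vec p} {μ : Measure (Vec p)} {α : ℝ}
    (h : RegVar P Y μ α) {B : Ω → Mat d p} (hB : Measurable B)
    (hm : ∫⁻ ω, ‖B ω‖ₑ ^ α ∂P < ∞) : InM0 (limitMeasure P B μ) := by
  intro r hr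
  have := h.sigmaFinite
  have hα := h.index_pos
  rw [limitMeasure_apply hB (measurableSet_le measurable_const measurable_norm)]
  set c := μ.real {x | 1 < ‖x‖} with hc
  have hc0 : 0 ≤ c := measureReal_nonneg
  have hle : ∀ ω, μ {z | B ω z ∈ {x | r ≤ ‖x‖}} ≤ ENNReal.ofReal ((2 / r) ^ α * c) * ‖B ω‖ₑ ^ α := by
    intro ω
    by_cases hB0 : B ω = 0
    · have : {z | B ω z ∈ {x : Vec d | r ≤ ‖x‖}} = ∅ := by
        refine Set.eq_empty_of_forall_notMem fun z hz => ?_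
        have hz' : r ≤ ‖B ω z‖ := hz
        rw [hB0] at hz'
        simp only [zero_apply, norm_zero] at hz'
        linarith
      rw [this, measure_empty]
      exact zero_le
    · have hBn : 0 < ‖B ω‖ := norm_pos_iff.2 hB0
      -- The factor 2 turns ≥ into the strict inequality for which the μ-tail is known.
      have ht : 0 < r / (2 * ‖B ω‖) := by positivity
      have hsub : {z | B ω z ∈ {x : Vec d | r ≤ ‖x‖}} ⊆ {z | r / (2 * ‖B ω‖) < ‖z‖} := by
        intro z hz
        have hz' : r ≤ ‖B ω z‖ := hz
        have h1 := hz'.trans ((B ω).le_opNorm z)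
        rw [Set.mem_ofPred_eq, div_lt_iff₀ (by positivity)]
        nlinarith
      refine (measure_mono hsub).trans (le_of_eq ?_)
      rw [← ENNReal.ofReal_toReal (h.tendsto.2.1.lt_top ht).ne, ← measureReal_def, h.real_gt ht,
        enorm_rpow_eq_ofReal _ hα.le, ← ENNReal.ofReal_mul (by positivity)]
      congr 1
      rw [Real.rpow_neg ht.le, ← Real.inv_rpow ht.le, inv_div, mul_right_comm,
        ← Real.mul_rpow (by positivity) hBn.le, mul_div_right_comm]
  refine (lintegral_mono hle).trans_lt ?_
  rw [lintegral_const_mul' _ _ ENNReal.ofReal_ne_top]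
  exact ENNReal.mul_lt_top ENNReal.ofReal_lt_top hm

theorem integral_limitMeasure {P : Measure Ω} [SFinite P] {B : Ω → Mat d p} (hB : Measurable B)
    {μ : Measure (Vec p)} [SigmaFinite μ] (f : Vec d →ᵇ ℝ)
    (hf : Integrable f (limitMeasure P B μ)) :
    ∫ x, f x ∂(limitMeasure P B μ) = ∫ ω, ∫ z, f (B ω z) ∂μ ∂P := by
  have hm := measurable_mat_apply_prod (d := d) (p := p) hB
  rw [limitMeasure, integral_map hm.aemeasurable f.continuous.aestronglyMeasurable]
  exact integral_prod _ ((integrable_map_measure f.continuous.aestronglyMeasurable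
    hm.aemeasurable).1 hf)

/-- Expectations of functions of an independent pair. -/
theorem integral_indep_apply {P : Measure Ω} [IsProbabilityMeasure P] {B : Ω → Mat d p}
    {Y : Ω → Vec p} (hB : Measurable B) (hY : Measurable Y) (hBY : IndepFun B Y P)
    (f : Vec d →ᵇ ℝ) (u : ℝ) :
    ∫ ω, f (u • B ω (Y ω)) ∂P = ∫ ω, ∫ ω', f (u • B ω (Y ω')) ∂P ∂P := by
  have hc : Continuous fun x : Mat d p × Vec p => f (u • x.1 x.2) :=
    f.continuous.comp ((isBoundedBilinearMap_apply (𝕜 := ℝ) (E := Vec p)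
      (F := Vec d)).continuous.const_smul u)
  have hpB : IsProbabilityMeasure (P.map B) := Measure.isProbabilityMeasure_map hB.aemeasurable
  have hpY : IsProbabilityMeasure (P.map Y) := Measure.isProbabilityMeasure_map hY.aemeasurable
  have h1 := integral_map (μ := P) (hB.prodMk hY).aemeasurable
    (f := fun x : Mat d p × Vec p => f (u • x.1 x.2)) hc.measurable.aestronglyMeasurable
  rw [(indepFun_iff_map_prod_eq_prod_map_map hB.aemeasurable hY.aemeasurable).1 hBY] at h1
  have hint : Integrable (fun x : Mat d p × Vec p => f (u • x.1 x.2))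
      ((P.map B).prod (P.map Y)) :=
    (integrable_const ‖f‖).mono' hc.measurable.aestronglyMeasurable
      (Eventually.of_forall fun x => f.norm_coe_le_norm _)
  rw [integral_prod _ hint] at h1
  rw [← h1, integral_map hB.aemeasurable
    (hc.measurable.stronglyMeasurable.integral_prod_right).aestronglyMeasurable]
  refine integral_congr_ae (Eventually.of_forall fun ω => ?_)
  have hcω : Continuous fun y : Vec p => f (u • B ω y) :=
    f.continuous.comp ((B ω).continuous.const_smul u)
  exact integral_map hY.aemeasurable hcω.aestronglyMeasurable

/-- Breiman's lemma: regular variation of a random linear image of a regularly varying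
vector. -/
theorem RegVar.tendsto_apply {P : Measure Ω} [IsProbabilityMeasure P] {B : Ω → Mat d p}
    {Y : Ω → Vec p} {μ : Measure (Vec p)} {α q : ℝ} (h : RegVar P Y μ α) (hB : Measurable B)
    (hY : Measurable Y) (hBY : IndepFun B Y P) (hq : α < q) (hm : ∫⁻ ω, ‖B ω‖ₑ ^ q ∂P < ∞)
    (f : Vec d →ᵇ ℝ) {ρ : ℝ} (hρ : 0 < ρ) (hf : ∀ x, ‖x‖ < ρ → f x = 0) :
    Tendsto (fun u : ℝ => 1 / P.real {ω | u < ‖Y ω‖} * ∫ ω, f (u⁻¹ • B ω (Y ω)) ∂P) atTop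
      (𝓝 (∫ x, f x ∂(limitMeasure P B μ))) := by
  have := h.sigmaFinite
  have hα := h.index_pos
  have hq0 : 0 < q := hα.trans hq
  have hV := h.rvTail hY
  obtain ⟨C, x₀, hC, hx₀, hle⟩ := hV.potter_lower hq
  rw [integral_limitMeasure hB f ((inM0_limitMeasure h hB
    (lintegral_rpow_lt_top_of_le hα.le hq.le hm)).integrable f hρ hf)]
  have e : ∀ u : ℝ, 1 / P.real {ω | u < ‖Y ω‖} * ∫ ω, f (u⁻¹ • B ω (Y ω)) ∂P =
      ∫ ω, 1 / P.real {ω | u < ‖Y ω‖} * ∫ ω', f (u⁻¹ • B ω (Y ω')) ∂P ∂P := fun u => by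
    rw [integral_indep_apply hB hY hBY, integral_const_mul]
  simp only [e]
  have hf0 : 0 ≤ ‖f‖ := norm_nonneg f
  -- Given B, convergence is the regular variation of Y tested with f ∘ B; the lower Potter bound
  -- with exponent q provides a majorant that is integrable by the moment of ‖B‖.
  refine tendsto_integral_filter_of_dominated_convergence
    (fun ω => ‖f‖ * C * (1 + (2 / ρ) ^ q * ‖B ω‖ ^ q)) ?_ ?_ ?_ ?_
  · refine Eventually.of_forall fun u => AEStronglyMeasurable.const_mul ?_ _
    have hc : Continuous fun x : Mat d p × Vec p => f (u⁻¹ • x.1 x.2) :=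
      f.continuous.comp ((isBoundedBilinearMap_apply (𝕜 := ℝ) (E := Vec p)
        (F := Vec d)).continuous.const_smul u⁻¹)
    have hmm : Measurable fun x : Ω × Ω => f (u⁻¹ • B x.1 (Y x.2)) :=
      hc.measurable.comp ((hB.comp measurable_fst).prodMk (hY.comp measurable_snd))
    exact hmm.stronglyMeasurable.integral_prod_right.aestronglyMeasurable
  · filter_upwards [eventually_ge_atTop x₀] with u hu
    refine Eventually.of_forall fun ω => ?_
    have hu0 : 0 < u := by linarith
    have hVu := hV.pos u
    -- If |Y| ≤ u/s then |BY|/u ≤ ρ/2 < ρ, where f vanishes.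
    set s := max 1 (2 / ρ * ‖B ω‖) with hs
    have hs1 : 1 ≤ s := le_max_left _ _
    have hs0 : 0 < s := by linarith
    have hsq : s ^ q ≤ 1 + (2 / ρ) ^ q * ‖B ω‖ ^ q := by
      rw [← Real.mul_rpow (by positivity) (by positivity)]
      have h1 : 0 ≤ (2 / ρ * ‖B ω‖) ^ q := by positivity
      rcases max_choice 1 (2 / ρ * ‖B ω‖) with e | e <;> rw [hs, e]
      · rw [Real.one_rpow]; linarith
      · linarith
    have hms : MeasurableSet {ω' | u / s < ‖Y ω'‖} := measurableSet_lt measurable_const hY.norm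
    have hint : ‖∫ ω', f (u⁻¹ • B ω (Y ω')) ∂P‖ ≤ ‖f‖ * P.real {ω' | u / s < ‖Y ω'‖} := by
      refine (norm_integral_le_of_norm_le (g := Set.indicator {ω' | u / s < ‖Y ω'‖}
        fun _ => ‖f‖) ((integrable_const _).indicator hms)
        (Eventually.of_forall fun ω' => ?_)).trans (le_of_eq ?_)
      · by_cases hω' : u / s < ‖Y ω'‖
        · rw [Set.indicator_of_mem (by exact hω')]
          exact f.norm_coe_le_norm _
        · rw [Set.indicator_of_notMem (by exact hω'), hf, norm_zero]
          rw [norm_smul, norm_inv, Real.norm_of_nonneg hu0.le, inv_mul_lt_iff₀ hu0]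
          refine ((B ω).le_opNorm _).trans_lt ?_
          have h1 : ‖B ω‖ ≤ ρ / 2 * s := by
            have : 2 / ρ * ‖B ω‖ ≤ s := le_max_right _ _
            rw [div_mul_eq_mul_div, div_le_iff₀ hρ] at this
            linarith
          have h2 : ‖Y ω'‖ ≤ u / s := not_lt.1 hω'
          calc ‖B ω‖ * ‖Y ω'‖ ≤ ρ / 2 * s * (u / s) := by gcongr
            _ = u * (ρ / 2) := by field_simp
            _ < u * ρ := by
              refine mul_lt_mul_of_pos_left ?_ hu0
              linarith
      · rw [integral_indicator_const _ hms, smul_eq_mul, mul_comm]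
    rw [norm_mul, Real.norm_of_nonneg (by positivity)]
    calc 1 / P.real {ω | u < ‖Y ω‖} * ‖∫ ω', f (u⁻¹ • B ω (Y ω')) ∂P‖
        ≤ 1 / P.real {ω | u < ‖Y ω‖} * (‖f‖ * (C * s ^ q * P.real {ω | u < ‖Y ω‖})) := by
          refine mul_le_mul_of_nonneg_left (hint.trans ?_) (by positivity)
          exact mul_le_mul_of_nonneg_left (hle u hu s hs1) hf0
      _ = ‖f‖ * C * s ^ q := by field_simp
      _ ≤ ‖f‖ * C * (1 + (2 / ρ) ^ q * ‖B ω‖ ^ q) :=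
          mul_le_mul_of_nonneg_left hsq (by positivity)
  · refine Integrable.const_mul ((integrable_const 1).add (Integrable.const_mul ?_ _)) _
    refine ⟨(hB.norm.pow_const q).aestronglyMeasurable, ?_⟩
    rw [hasFiniteIntegral_iff_ofReal (Eventually.of_forall fun ω => by positivity)]
    simpa only [enorm_rpow_eq_ofReal _ hq0.le] using hm
  · refine Eventually.of_forall fun ω => ?_
    have hb := h.tendsto.2.2 (f.compContinuous ⟨B ω, (B ω).continuous⟩)
      ⟨ρ / (‖B ω‖ + 1), by positivity, fun z hz => hf _ ?_⟩
    · refine hb.congr fun u => ?_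
      rw [integral_smul_map hY (by positivity) u _ (BoundedContinuousFunction.continuous _)]
      simp
    · rw [lt_div_iff₀ (by positivity)] at hz
      refine ((B ω).le_opNorm z).trans_lt ?_
      nlinarith [norm_nonneg z]

end RCLP

/-! ### Replacing a function of the sum by a sum over jumps -/

namespace RCLP

variable {Ω : Type*} [MeasurableSpace Ω] {d p : ℕ}

/-- If at most one of the vectors `y i` is large and the others contribute little to `L`, then
`f L` is close to `∑ f (y i)`; the right-hand side counts the exceptions. -/
theorem abs_apply_sub_sum_le {ι : Type*} [DecidableEq ι] (I : Finset ι) (y : ι → Vec d) (L : Vec d)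
    {f : Vec d → ℝ} {K ρ R w η ε : ℝ} (hK : ∀ x, |f x| ≤ K) (hf : ∀ x, ‖x‖ < ρ → f x = 0)
    (hερ : ε < ρ) (hη : η < ρ / 2) (hw : 0 ≤ w)
    (hc : ∀ x z, ‖x‖ ≤ R → ‖z - x‖ ≤ η → |f z - f x| ≤ w) :
    |f L - ∑ i ∈ I, f (y i)| ≤ w * ∑ i ∈ I, (if ρ / 2 < ‖y i‖ then 1 else 0) +
      2 * K * ∑ i ∈ I, (if R < ‖y i‖ then 1 else 0) +
      2 * K * (∑ i ∈ I, ∑ k ∈ I, (if i ≠ k then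
        (if ε < ‖y i‖ ∧ ε < ‖y k‖ then 1 else 0) else 0) +
      if η < ‖L - ∑ i ∈ I, if ε < ‖y i‖ then y i else 0‖ then 1 else 0) := by
  have hK0 : 0 ≤ K := (abs_nonneg _).trans (hK 0)
  set J := I.filter fun i => ε < ‖y i‖ with hJ
  set a := ∑ i ∈ I, (if ρ / 2 < ‖y i‖ then (1:ℝ) else 0) with ha
  set b := ∑ i ∈ I, (if R < ‖y i‖ then (1:ℝ) else 0) with hb
  set N := ∑ i ∈ I, ∑ k ∈ I, (if i ≠ k then
    (if ε < ‖y i‖ ∧ ε < ‖y k‖ then (1:ℝ) else 0) else 0) with hN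
  have ha0 : 0 ≤ a := Finset.sum_nonneg fun i _ => by split_ifs <;> norm_num
  have hb0 : 0 ≤ b := Finset.sum_nonneg fun i _ => by split_ifs <;> norm_num
  have hN0 : 0 ≤ N := Finset.sum_nonneg fun i _ => Finset.sum_nonneg fun k _ => by
    split_ifs <;> norm_num
  have hsumf : ∑ i ∈ I, f (y i) = ∑ i ∈ J, f (y i) := by
    rw [hJ, Finset.sum_filter]
    refine Finset.sum_congr rfl fun i _ => ?_
    split_ifs with h
    · rfl
    · exact hf _ ((not_lt.1 h).trans_lt hερ)
  have hsumy : (∑ i ∈ I, if ε < ‖y i‖ then y i else 0) = ∑ i ∈ J, y i := by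
    rw [hJ, Finset.sum_filter]
  rw [hsumf, hsumy]
  set T : ℝ := if η < ‖L - ∑ i ∈ J, y i‖ then 1 else 0 with hT
  have hT0 : 0 ≤ T := by rw [hT]; split_ifs <;> norm_num
  have hwa : 0 ≤ w * a := mul_nonneg hw ha0
  have hKb : 0 ≤ 2 * K * b := by positivity
  have hKN : 0 ≤ 2 * K * N := by positivity
  have hKT : 0 ≤ 2 * K * T := by positivity
  have habs : |f L - ∑ i ∈ J, f (y i)| ≤ K + K * J.card := by
    refine (abs_sub _ _).trans (add_le_add (hK L) ?_)
    refine (Finset.abs_sum_le_sum_abs _ _).trans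
      ((Finset.sum_le_card_nsmul _ _ K fun i _ => hK _).trans (le_of_eq ?_))
    rw [nsmul_eq_mul, mul_comm]
  -- With at most one large vector and remainder at most η: if there is none, or it is at most ρ/2
  -- in norm, both sides vanish because η < ρ/2. Otherwise the modulus w applies up to radius R, and
  -- the bound 2K beyond.
  rcases Nat.lt_or_ge J.card 2 with hcard | hcard
  · by_cases hE : η < ‖L - ∑ i ∈ J, y i‖
    · have hT1 : T = 1 := if_pos hE
      have : (J.card : ℝ) ≤ 1 := by exact_mod_cast Nat.lt_succ_iff.1 hcard
      rw [hT1]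
      nlinarith
    · have hE' := not_lt.1 hE
      have key : |f L - ∑ i ∈ J, f (y i)| ≤ w * a + 2 * K * b := by
        interval_cases hJc : J.card
        · rw [Finset.card_eq_zero] at hJc
          rw [hJc, Finset.sum_empty, sub_zero] at hE'
          have hρ : 0 ≤ ‖L‖ := norm_nonneg L
          rw [hJc, Finset.sum_empty, sub_zero, hf L (by linarith), abs_zero]
          linarith
        · obtain ⟨i, hi⟩ := Finset.card_eq_one.1 hJc
          rw [hi, Finset.sum_singleton] at hE' ⊢
          have hiI : i ∈ I := (Finset.mem_filter.1 (hi ▸ Finset.mem_singleton_self i)).1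
          have hL : ‖L‖ ≤ η + ‖y i‖ := by
            have := norm_add_le (L - y i) (y i)
            rw [sub_add_cancel] at this
            linarith
          by_cases h1 : ρ / 2 < ‖y i‖
          · by_cases h2 : R < ‖y i‖
            · have hb1 : 1 ≤ b := by
                have := Finset.single_le_sum (f := fun i => if R < ‖y i‖ then (1:ℝ) else 0)
                  (fun i _ => by split_ifs <;> norm_num) hiI
                rwa [if_pos h2] at this
              have := (abs_sub (f L) (f (y i))).trans (add_le_add (hK L) (hK (y i)))
              nlinarith
            · have ha1 : 1 ≤ a := by
                have := Finset.single_le_sum (f := fun i => if ρ / 2 < ‖y i‖ then (1:ℝ) else 0)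
                  (fun i _ => by split_ifs <;> norm_num) hiI
                rwa [if_pos h1] at this
              have := hc (y i) L (not_lt.1 h2) hE'
              nlinarith
          · have h1' := not_lt.1 h1
            have hη0 : 0 ≤ η := (norm_nonneg _).trans hE'
            rw [hf L (by linarith), hf (y i) (by linarith), sub_zero, abs_zero]
            linarith
      linarith
  -- Every large i has another large partner, so the number of pairs is at least |J| ≥ 2 and absorbs
  -- the trivial bound K + K|J|.
  · have hNc : (J.card : ℝ) ≤ N := by
      rw [hN]
      have h1 : (J.card : ℝ) = ∑ i ∈ I, if ε < ‖y i‖ then (1:ℝ) else 0 := by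
        rw [hJ, ← Finset.sum_filter, Finset.sum_const, nsmul_eq_mul, mul_one]
      rw [h1]
      refine Finset.sum_le_sum fun i hi => ?_
      have hnn : ∀ k ∈ I, 0 ≤ (if i ≠ k then (if ε < ‖y i‖ ∧ ε < ‖y k‖ then (1:ℝ) else 0)
          else 0) := fun k _ => by split_ifs <;> norm_num
      split_ifs with hy
      · obtain ⟨k, hk, hki⟩ := Finset.exists_mem_ne (by omega : 1 < J.card) i
        obtain ⟨hkI, hky⟩ := Finset.mem_filter.1 hk
        have := Finset.single_le_sum hnn hkI
        rwa [if_pos hki.symm, if_pos ⟨hy, hky⟩] at this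
      · exact Finset.sum_nonneg hnn
    have h2 : (2:ℝ) ≤ J.card := by exact_mod_cast hcard
    nlinarith

theorem integral_ite_one {P : Measure Ω} {c : Ω → Prop} [DecidablePred c]
    (hc : MeasurableSet {ω | c ω}) : ∫ ω, (if c ω then (1:ℝ) else 0) ∂P = P.real {ω | c ω} := by
  rw [← integral_indicator_one hc]
  refine integral_congr_ae (Eventually.of_forall fun ω => ?_)
  simp [Set.indicator_apply]

theorem integrable_ite_one {P : Measure Ω} [IsFiniteMeasure P] {c : Ω → Prop} [DecidablePred c]
    (hc : MeasurableSet {ω | c ω}) : Integrable (fun ω => if c ω then (1:ℝ) else 0) P :=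
  (integrable_const 1).mono' (Measurable.ite hc measurable_const
    measurable_const).aestronglyMeasurable (Eventually.of_forall fun ω => by split_ifs <;> simp)

/-- Integrated form of `abs_apply_sub_sum_le`. -/
theorem abs_integral_apply_sub_sum_le {P : Measure Ω} [IsProbabilityMeasure P] {ι : Type*}
    [DecidableEq ι] (I : Finset ι) {y : ι → Ω → Vec d} {L : Ω → Vec d} (hy : ∀ i, Measurable (y i))
    (hL : Measurable L) (f : Vec d →ᵇ ℝ) {ρ R w η ε : ℝ} (hf : ∀ x, ‖x‖ < ρ → f x = 0)
    (hερ : ε < ρ) (hη : η < ρ / 2) (hw : 0 ≤ w)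
    (hc : ∀ x z, ‖x‖ ≤ R → ‖z - x‖ ≤ η → |f z - f x| ≤ w) :
    |∫ ω, f (L ω) ∂P - ∑ i ∈ I, ∫ ω, f (y i ω) ∂P| ≤
      w * ∑ i ∈ I, P.real {ω | ρ / 2 < ‖y i ω‖} + 2 * ‖f‖ * ∑ i ∈ I, P.real {ω | R < ‖y i ω‖} +
      2 * ‖f‖ * (∑ i ∈ I, ∑ k ∈ I, (if i ≠ k then
        P.real {ω | ε < ‖y i ω‖ ∧ ε < ‖y k ω‖} else 0) +
      P.real {ω | η < ‖L ω - ∑ i ∈ I, if ε < ‖y i ω‖ then y i ω else 0‖}) := by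
  have hfi : ∀ {W : Ω → Vec d}, Measurable W → Integrable (fun ω => f (W ω)) P := fun hW =>
    (integrable_const ‖f‖).mono' (f.continuous.measurable.comp hW).aestronglyMeasurable
      (Eventually.of_forall fun ω => f.norm_coe_le_norm _)
  have hgt : ∀ (t : ℝ) {W : Ω → Vec d}, Measurable W → MeasurableSet {ω | t < ‖W ω‖} := fun t W hW =>
    measurableSet_lt measurable_const hW.norm
  have hpair : ∀ i k, MeasurableSet {ω | ε < ‖y i ω‖ ∧ ε < ‖y k ω‖} := fun i k =>
    (hgt ε (hy i)).inter (hgt ε (hy k))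
  have hrem : MeasurableSet {ω | η < ‖L ω - ∑ i ∈ I, if ε < ‖y i ω‖ then y i ω else 0‖} :=
    hgt η (hL.sub (Finset.measurable_sum _ fun i _ =>
      Measurable.ite (hgt ε (hy i)) (hy i) measurable_const))
  have i1 : Integrable (fun ω => ∑ i ∈ I, (if ρ / 2 < ‖y i ω‖ then (1:ℝ) else 0)) P :=
    integrable_finsetSum _ fun i _ => integrable_ite_one (hgt _ (hy i))
  have i2 : Integrable (fun ω => ∑ i ∈ I, (if R < ‖y i ω‖ then (1:ℝ) else 0)) P :=
    integrable_finsetSum _ fun i _ => integrable_ite_one (hgt _ (hy i))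
  have i3' : ∀ i k, Integrable (fun ω => if i ≠ k then
      (if ε < ‖y i ω‖ ∧ ε < ‖y k ω‖ then (1:ℝ) else 0) else 0) P := by
    intro i k
    split_ifs
    · exact integrable_ite_one (hpair i k)
    · exact integrable_const _
  have i3 : Integrable (fun ω => ∑ i ∈ I, ∑ k ∈ I, (if i ≠ k then
      (if ε < ‖y i ω‖ ∧ ε < ‖y k ω‖ then (1:ℝ) else 0) else 0)) P :=
    integrable_finsetSum _ fun i _ => integrable_finsetSum _ fun k _ => i3' i k
  have i4 := integrable_ite_one (P := P) hrem
  rw [← integral_finsetSum _ fun i _ => hfi (hy i),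
    ← integral_sub (hfi hL) (integrable_finsetSum _ fun i _ => hfi (hy i))]
  refine (abs_integral_le_integral_abs).trans ((integral_mono ((hfi hL).sub
    (integrable_finsetSum _ fun i _ => hfi (hy i))).abs
    (((i1.const_mul w).add (i2.const_mul (2 * ‖f‖))).add ((i3.add i4).const_mul (2 * ‖f‖)))
    fun ω => abs_apply_sub_sum_le I (fun i => y i ω) (L ω) (fun x => f.norm_coe_le_norm x) hf hερ hη
      hw hc).trans (le_of_eq ?_))
  rw [integral_add' ((i1.const_mul w).add (i2.const_mul (2 * ‖f‖)))
      ((i3.add i4).const_mul (2 * ‖f‖)), integral_add' (i1.const_mul w) (i2.const_mul (2 * ‖f‖)),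
    integral_const_mul, integral_const_mul, integral_const_mul, integral_add' i3 i4,
    integral_finsetSum _ fun i _ => integrable_ite_one (hgt _ (hy i)),
    integral_finsetSum _ fun i _ => integrable_ite_one (hgt _ (hy i)),
    integral_finsetSum _ fun i _ => integrable_finsetSum _ fun k _ => i3' i k,
    integral_ite_one hrem]
  congr 3
  · exact Finset.sum_congr rfl fun i _ => integral_ite_one (hgt _ (hy i))
  · exact Finset.sum_congr rfl fun i _ => integral_ite_one (hgt _ (hy i))
  · refine Finset.sum_congr rfl fun i _ => ?_
    rw [integral_finsetSum _ fun k _ => i3' i k]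
    refine Finset.sum_congr rfl fun k _ => ?_
    split_ifs
    · exact integral_ite_one (hpair i k)
    · exact integral_zero _ _

/-- Uniform continuity of a continuous function on a ball, also towards outside points. -/
theorem exists_modulus (f : Vec d →ᵇ ℝ) (R : ℝ) {w : ℝ} (hw : 0 < w) :
    ∃ η : ℝ, 0 < η ∧ ∀ x z, ‖x‖ ≤ R → ‖z - x‖ ≤ η → |f z - f x| ≤ w := by
  -- The radius R + 1 together with η ≤ 1 keeps z in the compact ball when x has norm at most R.
  have hu := (isCompact_closedBall (0 : Vec d) (R + 1)).uniformContinuousOn_of_continuous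
    f.continuous.continuousOn
  obtain ⟨η, hη, h⟩ := Metric.uniformContinuousOn_iff.1 hu w hw
  refine ⟨min 1 (η / 2), by positivity, fun x z hx hzx => ?_⟩
  have h1 : ‖z - x‖ ≤ 1 := hzx.trans (min_le_left _ _)
  have h2 : ‖z - x‖ ≤ η / 2 := hzx.trans (min_le_right _ _)
  have h3 : ‖z‖ ≤ R + 1 := by
    have := norm_add_le (z - x) x
    rw [sub_add_cancel] at this
    linarith
  have := h z (by simpa using h3) x (by simp; linarith) (by rw [dist_eq_norm]; linarith)
  rw [Real.dist_eq] at this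
  exact this.le

end RCLP

/-! ### The large deviation principle for the partial sums -/

namespace RCLP

variable {Ω : Type*} [MeasurableSpace Ω] {d p : ℕ}

namespace Setup

section

variable {P : Measure Ω} [IsProbabilityMeasure P] {A : ℤ → ℤ → Ω → Mat d p}
    {Z : ℤ → Ω → Vec p} {V : ℝ → ℝ} {α q : ℝ} {γ : ℕ → ℝ}

theorem real_jump_gt_eq (h : Setup P A Z V α q γ) (M : ℕ) (i : ℤ) (t : ℝ) :
    P.real {ω | t < ‖jump A Z M i ω‖} = P.real {ω | t < ‖jump A Z M 0 ω‖} :=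
  congrArg ENNReal.toReal ((h.identDistrib_jump M i).measure_mem_eq (measurableSet_norm_gt t))

/-- The comparison bound for the normalized sums, at a fixed time. -/
theorem abs_integral_sum_sub_le (h : Setup P A Z V α q γ) (M : ℕ) (f : Vec d →ᵇ ℝ)
    {ρ R w η ε : ℝ} (hf : ∀ x, ‖x‖ < ρ → f x = 0) (hερ : ε < ρ) (hη : η < ρ / 2) (hw : 0 ≤ w)
    (hc : ∀ x z, ‖x‖ ≤ R → ‖z - x‖ ≤ η → |f z - f x| ≤ w) {n : ℕ} (hn : 1 ≤ n) (hg : 0 < γ n) :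
    |1 / (n * V (γ n)) * ∫ ω, f ((γ n)⁻¹ • ∑ k ∈ Finset.Icc 1 n, linear A Z M (k : ℤ) ω) ∂P -
      1 / V (γ n) * ∫ ω, f ((γ n)⁻¹ • jump A Z M 0 ω) ∂P| ≤
      w * (1 / V (γ n) * P.real {ω | γ n * (ρ / 2) < ‖jump A Z M 0 ω‖}) +
      2 * ‖f‖ * (1 / V (γ n) * P.real {ω | γ n * R < ‖jump A Z M 0 ω‖}) +
      2 * ‖f‖ * (1 / (n * V (γ n)) * ∑ i ∈ Finset.Icc 1 n, ∑ k ∈ Finset.Icc 1 n,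
        (if i ≠ k then P.real {ω | γ n * ε < ‖jump A Z M (i : ℤ) ω‖ ∧
          γ n * ε < ‖jump A Z M (k : ℤ) ω‖} else 0) +
        1 / (n * V (γ n)) * P.real {ω | γ n * η < ‖∑ k ∈ Finset.Icc 1 n, linear A Z M (k : ℤ) ω -
          ∑ i ∈ Finset.Icc 1 n, if γ n * ε < ‖jump A Z M (i : ℤ) ω‖ then jump A Z M (i : ℤ) ω
          else 0‖}) := by
  have hV := h.growth.rv.pos (γ n)
  have hn0 : (0:ℝ) < n := by exact_mod_cast hn
  have hsc : ∀ (v : Vec d) (t : ℝ), t < ‖(γ n)⁻¹ • v‖ ↔ γ n * t < ‖v‖ := by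
    intro v t
    rw [norm_smul, norm_inv, Real.norm_of_nonneg hg.le, inv_mul_eq_div, lt_div_iff₀ hg, mul_comm]
  have key := abs_integral_apply_sub_sum_le (P := P) (Finset.Icc 1 n)
    (y := fun (i : ℕ) ω => (γ n)⁻¹ • jump A Z M (i : ℤ) ω)
    (L := fun ω => (γ n)⁻¹ • ∑ k ∈ Finset.Icc 1 n, linear A Z M (k : ℤ) ω)
    (fun i => (h.measurable_jump M i).const_smul (γ n)⁻¹)
    ((Finset.measurable_sum _ fun (k : ℕ) _ => h.measurable_linear M k).const_smul (γ n)⁻¹)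
    f hf hερ hη hw hc
  have hrem : ∀ ω, (γ n)⁻¹ • ∑ k ∈ Finset.Icc 1 n, linear A Z M (k : ℤ) ω -
      (∑ i ∈ Finset.Icc 1 n, if γ n * ε < ‖jump A Z M ((i : ℕ) : ℤ) ω‖ then
        (γ n)⁻¹ • jump A Z M (i : ℤ) ω else 0) =
      (γ n)⁻¹ • (∑ k ∈ Finset.Icc 1 n, linear A Z M (k : ℤ) ω - ∑ i ∈ Finset.Icc 1 n,
        if γ n * ε < ‖jump A Z M ((i : ℕ) : ℤ) ω‖ then jump A Z M (i : ℤ) ω else 0) := by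
    intro ω
    rw [smul_sub, Finset.smul_sum (s := Finset.Icc 1 n)
      (f := fun i : ℕ => if γ n * ε < ‖jump A Z M (i : ℤ) ω‖ then jump A Z M (i : ℤ) ω else 0)]
    simp only [smul_ite, smul_zero]
  simp only [hsc, hrem] at key
  have hf1 : ∀ i : ℕ, ∫ ω, f ((γ n)⁻¹ • jump A Z M (i : ℤ) ω) ∂P =
      ∫ ω, f ((γ n)⁻¹ • jump A Z M 0 ω) ∂P := fun i =>
    ((h.identDistrib_jump M i).comp (u := fun x => f ((γ n)⁻¹ • x))
      (f.continuous.measurable.comp (measurable_const_smul _))).integral_eq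
  simp only [hf1, h.real_jump_gt_eq M ((_ : ℕ) : ℤ), Finset.sum_const, Nat.card_Icc, Nat.add_sub_cancel,
    nsmul_eq_mul] at key
  have hmul := mul_le_mul_of_nonneg_left key (show 0 ≤ 1 / (n * V (γ n)) by positivity)
  rw [← abs_of_nonneg (show 0 ≤ 1 / (n * V (γ n)) by positivity), ← abs_mul,
    abs_of_nonneg (show 0 ≤ 1 / (n * V (γ n)) by positivity)] at hmul
  refine le_trans (le_of_eq ?_) (hmul.trans (le_of_eq ?_))
  · congr 1
    field_simp
  · field_simp

/-- The single big jump principle in integrated form: only one jump is felt, and the n jumps are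
identically distributed, so n times one expectation remains. -/
theorem tendsto_sum_sub_jump (h : Setup P A Z V α q γ) (M : ℕ) (f : Vec d →ᵇ ℝ)
    {ρ : ℝ} (hρ : 0 < ρ) (hf : ∀ x, ‖x‖ < ρ → f x = 0) :
    Tendsto (fun n : ℕ =>
      1 / (n * V (γ n)) * ∫ ω, f ((γ n)⁻¹ • ∑ k ∈ Finset.Icc 1 n, linear A Z M (k : ℤ) ω) ∂P -
      1 / V (γ n) * ∫ ω, f ((γ n)⁻¹ • jump A Z M 0 ω) ∂P) atTop (𝓝 0) := by
  have hG := h.growth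
  have hα := hG.rv.index_pos
  have hf0 := norm_nonneg f
  obtain ⟨C, x₀, hC, hx₀, hT⟩ := h.hasTail_jump M 0 (α + 1) (by linarith)
  set s := max 1 (2 / ρ) with hs
  have hs1 : 1 ≤ s := le_max_left _ _
  have hs0 : 0 < s := by linarith
  set C₁ := C * s ^ (α + 1) with hC₁
  have hC₁0 : 0 < C₁ := by positivity
  have hp1 : ∀ᶠ n in atTop, 1 / V (γ n) * P.real {ω | γ n * (ρ / 2) < ‖jump A Z M 0 ω‖} ≤ C₁ := by
    filter_upwards [hG.tendsto.eventually_ge_atTop x₀] with n hn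
    have hV := hG.rv.pos (γ n)
    rw [one_div, inv_mul_le_iff₀ hV, mul_comm (V _)]
    refine (measureReal_mono fun ω hω => ?_).trans (hT (γ n) hn s hs1)
    refine lt_of_le_of_lt ?_ (show γ n * (ρ / 2) < ‖jump A Z M 0 ω‖ from hω)
    rw [div_le_iff₀ hs0, mul_assoc]
    refine le_mul_of_one_le_right (by linarith) ?_
    have : 2 / ρ ≤ s := le_max_right _ _
    rw [div_le_iff₀ hρ] at this
    linarith
  refine Metric.tendsto_atTop.2 fun e he => eventually_atTop.1 ?_
  -- Order of choices: R makes jumps beyond Rγ_n rare, w = e/(4C₁) fixes the oscillation allowed for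
  -- f on the ball of radius R, η is the resulting modulus, and ε is small enough for the remainder
  -- estimate at η. Three errors of at most e/4 remain.
  obtain ⟨R, hR0, hR⟩ : ∃ R : ℝ, 1 ≤ R ∧ 2 * ‖f‖ * (C * R ^ (-α)) < e / 4 := by
    have h1 := ((tendsto_rpow_neg_atTop hα).const_mul C).const_mul (2 * ‖f‖)
    simp only [mul_zero] at h1
    exact ((eventually_ge_atTop 1).and (h1.eventually (gt_mem_nhds (by positivity)))).exists
  have hp2 : ∀ᶠ n in atTop, 2 * ‖f‖ * (1 / V (γ n) *
      P.real {ω | γ n * R < ‖jump A Z M 0 ω‖}) < e / 4 := by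
    have h1 := (((hG.rv.ratio R (by linarith)).comp hG.tendsto).const_mul C).const_mul (2 * ‖f‖)
    filter_upwards [h1.eventually (gt_mem_nhds hR), hG.tendsto.eventually_ge_atTop x₀] with n hn hg
    refine lt_of_le_of_lt ?_ hn
    have hV := hG.rv.pos (γ n)
    refine mul_le_mul_of_nonneg_left ?_ (by positivity)
    have h2 := hT (R * γ n) (by nlinarith) 1 le_rfl
    rw [div_one, Real.one_rpow, mul_one, mul_comm R] at h2
    rw [one_div, inv_mul_le_iff₀ hV]
    refine h2.trans (le_of_eq ?_)
    simp only [Function.comp, mul_comm R]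
    field_simp
  set w := e / (4 * C₁) with hw
  have hw0 : 0 < w := by positivity
  obtain ⟨η', hη', hmod⟩ := exists_modulus f R hw0
  set η := min η' (ρ / 4) with hηd
  have hη0 : 0 < η := by positivity
  have hη : η < ρ / 2 := (min_le_right _ _).trans_lt (by linarith)
  obtain ⟨ε₀, hε₀, hrem⟩ := h.exists_tendsto_remainder M hη0
  set ε := min 1 (min (ε₀ / 2) (ρ / 2)) with hεd
  have hε0 : 0 < ε := by positivity
  have hερ : ε < ρ := ((min_le_right _ _).trans (min_le_right _ _)).trans_lt (by linarith)
  have hεε₀ : ε < ε₀ := ((min_le_right _ _).trans (min_le_left _ _)).trans_lt (by linarith)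
  have h3 := ((h.tendsto_pairs M hε0 (min_le_left _ _)).add (hrem ε hε0 hεε₀)).const_mul (2 * ‖f‖)
  rw [add_zero, mul_zero] at h3
  filter_upwards [hp1, hp2, h3.eventually (gt_mem_nhds (show 0 < e / 4 by positivity)),
    eventually_ge_atTop 1, hG.tendsto.eventually_gt_atTop 0] with n h1 h2 h3 hn hg
  rw [Real.dist_eq, sub_zero]
  refine (h.abs_integral_sum_sub_le M f hf hερ hη hw0.le (fun x z hx hz => hmod x z hx
    (hz.trans (min_le_left _ _))) hn hg).trans_lt ?_
  have h4 := mul_le_mul_of_nonneg_left h1 hw0.le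
  have h5 : w * C₁ = e / 4 := by rw [hw]; field_simp
  linarith

end

section

variable {P : Measure Ω} [IsProbabilityMeasure P] {A : ℤ → ℤ → Ω → Mat d p}
    {Z : ℤ → Ω → Vec p} {α q : ℝ} {γ : ℕ → ℝ}

/-- The comparison with one jump is combined with Breiman's lemma for W_0 Z_0. The entries of W_0 =
∑_j A_{0+j,j} lie on the diagonal, which yields the stated limit. -/
theorem partialSumLD (h : Setup P A Z (fun u => P.real {ω | u < ‖Z 0 ω‖}) α q γ)
    {μ : Measure (Vec p)} (hZ : RegVar P (Z 0) μ α) {M : ℕ}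
    (hfin : ∀ k j : ℤ, (M : ℤ) < |j| → A k j =ᵐ[P] 0) : PartialSumLD P A Z μ γ := by
  have hα := hZ.index_pos
  have hσ := hZ.sigmaFinite
  have hB := h.measurable_weight M 0
  have hBm := h.lintegral_weight_lt_top M 0
  refine ⟨limitMeasure P (weight A M 0) μ, fun s hs _ => ?_, fun n => ?_, ?_, ?_⟩
  · rw [limitMeasure_apply hB hs]
    refine lintegral_congr_ae ?_
    filter_upwards [ae_eq_zero_off_window hfin] with ω hω
    have : ∀ z, weight A M 0 ω z = ∑' j : ℤ, A j j ω z := by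
      intro z
      rw [tsum_eq_sum (s := window M) fun j hj => by rw [hω j j hj]; rfl]
      simp [weight]
    simp only [this]
  · intro r hr
    rw [Measure.smul_apply, smul_eq_mul]
    exact ENNReal.mul_lt_top ENNReal.ofReal_lt_top
      ((measure_mono (Set.subset_univ _)).trans_lt (by
        -- Finiteness needs no measurability of the series defining S_n: otherwise the image measure
        -- is 0 by convention.
        by_cases hm : AEMeasurable (fun ω => (γ n)⁻¹ • S A Z n ω) P
        · rw [Measure.map_apply_of_aemeasurable hm MeasurableSet.univ]
          exact measure_lt_top _ _
        · rw [Measure.map_of_not_aemeasurable hm]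
          simp))
  · exact inM0_limitMeasure hZ hB (lintegral_rpow_lt_top_of_le hα.le h.lt_q.le hBm)
  · rintro f ⟨ρ, hρ, hf⟩
    have hbr := (hZ.tendsto_apply hB (h.measZ 0)
      (h.indepAZ.comp (φ := fun x : ℤ → ℤ → Mat d p => ∑ j ∈ window M, x (0 + j) j)
        (ψ := fun z : ℤ → Vec p => z 0) (Finset.measurable_sum _ fun j _ => by fun_prop)
        (by fun_prop)) h.lt_q hBm f hρ hf).comp h.growth.tendsto
    have hsum := (h.tendsto_sum_sub_jump M f hρ hf).add hbr
    rw [zero_add] at hsum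
    have hSlin : ∀ n, S A Z n =ᵐ[P] fun ω => ∑ k ∈ Finset.Icc 1 n, linear A Z M (k : ℤ) ω := by
      intro n
      filter_upwards [ae_X_eq_linear Z hfin] with ω hω
      simp only [S, hω]
    have hSm : ∀ n : ℕ, Measurable fun ω => ∑ k ∈ Finset.Icc 1 n, linear A Z M (k : ℤ) ω :=
      fun n => Finset.measurable_sum _ fun (k : ℕ) _ => h.measurable_linear M k
    refine hsum.congr fun n => ?_
    have hmap : P.map (fun ω => (γ n)⁻¹ • S A Z n ω) =
        P.map fun ω => (γ n)⁻¹ • ∑ k ∈ Finset.Icc 1 n, linear A Z M (k : ℤ) ω := by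
      refine Measure.map_congr ?_
      filter_upwards [hSlin n] with ω hω
      rw [hω]
    beta_reduce
    rw [hmap, integral_smul_map (hSm n) (r_nonneg P Z γ n) _ _ f.continuous]
    exact sub_add_cancel _ _

end

end Setup

end RCLP

theorem proposition6p3 {Ω : Type*} [MeasurableSpace Ω] (P : Measure Ω) [IsProbabilityMeasure P]
    {d p : ℕ} (A : ℤ → ℤ → Ω → RCLP.Mat d p) (Z : ℤ → Ω → RCLP.Vec p)
    (μ : Measure (RCLP.Vec p)) (α : ℝ) (γ : ℕ → ℝ)
    (hyp : RCLP.Hyp P A Z μ α γ)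
    (indep_A : iIndepFun (fun (k : ℤ) ω (j : ℤ) => A k j ω) P)
    (M : ℕ) (finite_range : ∀ k j : ℤ, (M : ℤ) < |j| → A k j =ᵐ[P] 0) :
    RCLP.SmallJump P A Z γ ∧
    ((α < 1 ∨
        (α = 1 ∧ TendstoInMeasure P
          (fun (n : ℕ) ω => (γ n)⁻¹ * ∑ k ∈ Finset.Icc 1 n, ‖Z (k : ℤ) ω‖)
          atTop (fun _ => (0 : ℝ))) ∨
        (1 < α ∧ Tendsto (fun n : ℕ => (n : ℝ) / γ n) atTop (𝓝 0))) →
      RCLP.SmallJumpAbs1 P A Z γ) ∧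
    (1 < α → (∀ n : ℕ, 1 ≤ n → γ n = n) → RCLP.SmallJumpAbs2 P A Z γ) ∧
    RCLP.SumAabs P A α ∧
    RCLP.SumA P A α ∧
    RCLP.PartialSumLD P A Z μ γ := by
  obtain ⟨q, h⟩ := hyp.setup indep_A
  exact ⟨h.smallJump finite_range, h.smallJumpAbs1 hyp.model.ident_Z finite_range,
    h.smallJumpAbs2 finite_range, h.sumAabs finite_range, h.sumA finite_range,
    h.partialSumLD hyp.regVar finite_range⟩
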